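/- **Setting.** Fix $d\ge 1$ and a compact connected set $U\subseteq\mathbb R^d$ with smooth boundary $M:=\partial U$ (near each boundary point $U$ is a sublevel set $\{f\le 0\}$ of a smooth function $f$ with nonvanishing differential), and a smooth kernel $\mathscr K: M\times M\to\mathbb R_{\ge 0}$. *The space $\mathscr C^{10}_{\simeq}$.* For maps $\varphi,\psi$ on $M$ let $\|\cdot\|_{\mathscr C^{k}}$ be the $\mathscr C^k$ norm: the supremum over $M$ of all iterated tangential derivatives of order at most $k$, taken along the tangential projections of the $d$ standard basis vectors. For $\varphi:M\to\mathbb R^d$ with injective differentials $\mathrm d\varphi(y):T_yM\to\mathbb R^d$, let $(\mathrm{Jac}\,\varphi)^{-1}(y)$ be the inverse of $\mathrm d\varphi(y):T_yM\to \mathrm d\varphi(y)(T_yM)$, extended to $\mathbb R^d$ by $0$ on the orthogonal complement of $\mathrm d\varphi(y)(T_yM)$. Put $$\langle\varphi,\psi\rangle:=\|\varphi-\psi\|_{\mathscr C^{10}}+\|(\mathrm{Jac}\,\varphi)^{-1}-(\mathrm{Jac}\,\psi)^{-1}\|_{\mathscr C^{9}}.$$ Let $\mathscr C^{10}_{\simeq}$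 be the space, with the metric $\langle\cdot,\cdot\rangle$, of all maps $M\to\mathbb R^d$ that are diffeomorphic onto their image and belong to the completion under $\langle\cdot,\cdot\rangle$ of the space of smooth maps $M\to\mathbb R^d$ that are diffeomorphisms onto their image (the completion being realized as the $\mathscr C^{10}$ maps that are $\langle\cdot,\cdot\rangle$-limits of such smooth maps). *The equation.* For $\Phi\in\mathscr C^{10}_{\simeq}$ let $\mathbf T^{\Phi}$ be the pullback under $\Phi:M\to\Phi(M)$ of the $(d-1)$-dimensional surface measure of $\Phi(M)$, normalized to be a probability measure on $M$. Let $\mathsf n^{\Phi}(y)$ be the unit normal to $\Phi(M)$ at $\Phi(y)$ that points away from the region enclosed by $\Phi(M)$, i.e. away from the unique compact set that is the closure of its interior and has boundary $\Phi(M)$. The flow equation with initial data $\Phi_0$ is $$\Phi(t,x)=\Phi_0(x)+\int_0^t\int_{M}\mathscr K(x,y)\,\mathsf n^{\Phi(s,\cdot)}(y)\,\mathbf T^{\Phi(s,\cdot)}(\mathrm dy)\,\mathrm ds,\qquad x\in M.\tag{$*$}$$ **Theorem.** For every $\Phi_0\in\mathscr C^{10}_{\simeq}$ there exists $\tau_{\mathrm{sol}}\in(0,\infty]$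 such that $(*)$ has a unique solution in $\mathscr C([0,\tau_{\mathrm{sol}}),\mathscr C^{10}_{\simeq})$, the space of continuous $\mathscr C^{10}_{\simeq}$-valued functions on $[0,\tau_{\mathrm{sol}})$ (with initial value $\Phi(0,\cdot)=\Phi_0$). -/

import Mathlib

open Set Filter Topology MeasureTheory
open scoped ENNReal ContDiff

noncomputable section

namespace GrowthFlow

/-- Euclidean space `ℝ^d`. -/
abbrev Euc (d : ℕ) : Type := EuclideanSpace ℝ (Fin d)

variable {d : ℕ} {F : Type*} [NormedAddCommGroup F] [NormedSpace ℝ F]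

/-- `U` has smooth boundary: near each of its boundary points, `U` is a sublevel set of a smooth
function with nonvanishing differential. -/
def HasSmoothBoundary (U : Set (Euc d)) : Prop :=
  ∀ p ∈ frontier U, ∃ f : Euc d → ℝ, ContDiff ℝ ∞ f ∧ fderiv ℝ f p ≠ 0 ∧
    ∀ᶠ z in 𝓝 p, (z ∈ U ↔ f z ≤ 0)

/-- A map on the compact hypersurface `∂U` is of class `C^k` if it is the restriction of a `C^k`
map on `ℝ^d`. -/
def IsCk (U : Set (Euc d)) (k : WithTop ℕ∞) (φ : frontier U → F) : Prop :=
  ∃ g : Euc d → F, ContDiff ℝ k g ∧ ∀ y : frontier U, g y = φ y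

/-- A smooth function of two variables in `∂U`. -/
def IsSmoothKernel (U : Set (Euc d)) (K : frontier U → frontier U → ℝ) : Prop :=
  ∃ g : Euc d × Euc d → ℝ, ContDiff ℝ ∞ g ∧ ∀ x y : frontier U, g (x, y) = K x y

/-- The tangent space of `∂U` at `y`, as a linear subspace of `ℝ^d`. -/
def tangentSpace (U : Set (Euc d)) (y : frontier U) : Submodule ℝ (Euc d) :=
  Submodule.span ℝ (tangentConeAt ℝ (frontier U) (y : Euc d))

/-- The orthogonal projection of `ℝ^d` onto the tangent space of `∂U` at `y`. -/
def tangentProj (U : Set (Euc d)) (y : frontier U) : Euc d →L[ℝ] Euc d :=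
  (tangentSpace U y).starProjection

/-- The differential `dφ(y)` of a map `φ` on `∂U`, extended from the tangent space to `ℝ^d` by
zero on the normal line. (Only tangent vectors are fed to `fderivWithin`, on which it is uniquely
determined by the values of `φ` on `∂U`.) -/
def tderiv (U : Set (Euc d)) (φ : frontier U → F) (y : frontier U) : Euc d →L[ℝ] F :=
  (fderivWithin ℝ (Function.extend Subtype.val φ 0) (frontier U) (y : Euc d)).comp
    (tangentProj U y)

/-- The derivative of `φ` along the tangent vector field of `∂U` which is the tangential projection
of the `i`-th standard basis vector; these `d` fields span each tangent space. -/
def tpartial (U : Set (Euc d)) (i : Fin d) (φ : frontier U → F) : frontier U → F :=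
  fun y => tderiv U φ y (EuclideanSpace.single i 1)

/-- Iterated tangential derivatives. -/
def tpartials (U : Set (Euc d)) (J : List (Fin d)) (φ : frontier U → F) : frontier U → F :=
  J.foldr (tpartial U) φ

/-- The `C^k` norm on `∂U`: the supremum of all tangential derivatives of order at most `k`. -/
def ckNorm (U : Set (Euc d)) (k : ℕ) (φ : frontier U → F) : ℝ≥0∞ :=
  ⨆ (J : List (Fin d)) (_ : J.length ≤ k) (y : frontier U), ‖tpartials U J φ y‖ₑ

/-- The inverse of the differential `dφ(y)`, as a map from the tangent space of `φ(∂U)` at `φ(y)` to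
the tangent space of `∂U` at `y`, extended to `ℝ^d` by zero on the normal line of `φ(∂U)`. With
`A = dφ(y)` and `P` the tangential projection it is `(Aᵀ A + (1 - P))⁻¹ Aᵀ`. -/
def invJac (U : Set (Euc d)) (φ : frontier U → Euc d) (y : frontier U) : Euc d →L[ℝ] Euc d :=
  Ring.inverse ((ContinuousLinearMap.adjoint (tderiv U φ y)).comp (tderiv U φ y) +
    (1 - tangentProj U y)) * ContinuousLinearMap.adjoint (tderiv U φ y)

/-- The metric `⟨φ, ψ⟩_{C^k}` (for `k ≥ 1`): the `C^k` distance of the maps plus the `C^{k-1}`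
distance of the inverses of their Jacobians. -/
def ckDist (U : Set (Euc d)) (k : ℕ) (φ ψ : frontier U → Euc d) : ℝ≥0∞ :=
  ckNorm U k (fun y => φ y - ψ y) + ckNorm U (k - 1) (fun y => invJac U φ y - invJac U ψ y)

/-- Smooth maps `∂U → ℝ^d` that are diffeomorphisms onto their image, that is (`∂U` being compact)
smooth injective immersions. -/
def IsSmoothEmbedding (U : Set (Euc d)) (φ : frontier U → Euc d) : Prop :=
  IsCk U ∞ φ ∧ Function.Injective φ ∧
    ∀ y : frontier U, ∀ v ∈ tangentSpace U y, tderiv U φ y v = 0 → v = 0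

/-- The completion of the space of smooth embeddings under `ckDist U k`, realized as the space of
those `C^k` maps that are limits of smooth embeddings. -/
def completedEmbeddings (U : Set (Euc d)) (k : ℕ) : Set (frontier U → Euc d) :=
  {φ | IsCk U k φ ∧ ∃ u : ℕ → frontier U → Euc d, (∀ n, IsSmoothEmbedding U (u n)) ∧
    Tendsto (fun n => ckDist U k (u n) φ) atTop (𝓝 0)}

/-- The elements of the completion that are diffeomorphic onto their image. (Elements of the
completion are immersions because the inverse Jacobians converge, so only injectivity has to be
asked for.) -/
def embeddings (U : Set (Euc d)) (k : ℕ) : Set (frontier U → Euc d) :=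
  {φ | φ ∈ completedEmbeddings U k ∧ Function.Injective φ}

/-- `D` is the region enclosed by `H`: the compact set that is the closure of its interior and
whose boundary is `H`. (For a compact embedded hypersurface `H` there is exactly one.) -/
def IsEnclosedRegion (D H : Set (Euc d)) : Prop :=
  IsCompact D ∧ closure (interior D) = D ∧ frontier D = H

/-- `ν` is the unit normal to the hypersurface `φ(∂U)` at `φ(y)` that points away from the region
enclosed by `φ(∂U)`. -/
def IsOutwardUnitNormal (U : Set (Euc d)) (φ : frontier U → Euc d) (y : frontier U) (ν : Euc d) :
    Prop :=
  ‖ν‖ = 1 ∧ (∀ v : Euc d, inner ℝ ν (tderiv U φ y v) = 0) ∧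
    ∃ D : Set (Euc d), IsEnclosedRegion D (range φ) ∧
      ∀ᶠ s : ℝ in 𝓝[>] 0, φ y + s • ν ∉ D ∧ φ y - s • ν ∈ D

open Classical in
/-- The unit outward normal `n^φ(y)` to `φ(∂U)` at `φ(y)`. -/
def outwardNormal (U : Set (Euc d)) (φ : frontier U → Euc d) (y : frontier U) : Euc d :=
  if h : ∃ ν, IsOutwardUnitNormal U φ y ν then h.choose else 0

/-- The pullback under `φ` of the surface measure, i.e. the `(d-1)`-dimensional Hausdorff measure,
on `φ(∂U)`. -/
def pullbackSurface (U : Set (Euc d)) (φ : frontier U → Euc d) : Measure (frontier U) :=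
  Measure.comap φ (Measure.hausdorffMeasure ((d : ℝ) - 1))

/-- The probability measure `T^φ` on `∂U`: the normalized pullback of the surface measure. (The
normalization of the Hausdorff measure cancels.) -/
def surfaceProb (U : Set (Euc d)) (φ : frontier U → Euc d) : Measure (frontier U) :=
  (pullbackSurface U φ univ)⁻¹ • pullbackSurface U φ

/-- The time interval `[0, τ)`, for `τ ∈ [0, ∞]`. -/
def timeInterval (τ : ℝ≥0∞) : Set ℝ := {t | 0 ≤ t ∧ ENNReal.ofReal t < τ}

/-- `Φ` is a solution on `[0, τ)` of the flow equation with kernel `K` and initial data `Φ₀`, in the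
class of continuous paths of `C^10` embeddings. -/
structure IsFlowSolution (U : Set (Euc d)) (K : frontier U → frontier U → ℝ)
    (Φ₀ : frontier U → Euc d) (τ : ℝ≥0∞) (Φ : ℝ → frontier U → Euc d) : Prop where
  mem : ∀ t ∈ timeInterval τ, Φ t ∈ embeddings U 10
  continuous : ∀ t ∈ timeInterval τ,
    Tendsto (fun s => ckDist U 10 (Φ s) (Φ t)) (𝓝[timeInterval τ] t) (𝓝 0)
  initial : Φ 0 = Φ₀
  equation : ∀ t ∈ timeInterval τ, ∀ x : frontier U,
    Φ t x = Φ 0 x +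
      ∫ s in (0 : ℝ)..t, ∫ y, K x y • outwardNormal U (Φ s) y ∂(surfaceProb U (Φ s))

end GrowthFlow

end

/-!
The velocity of the flow at `x` is the kernel section `K(x, ·)` integrated against the vector
measure `n^Φ T^Φ`, so a solution is determined by the accumulated momentum
`m(t) = ∫₀ᵗ n^Φ(s) T^Φ(s) ds`, an element of the Banach space `Momentum U` of operators from
`C(∂U)` to `ℝ^d`: it is `Φ(t, x) = Φ₀(x) + m(t) (K(x, ·))` (`displaced`). The equation becomes the
ordinary differential equation `m' = momentum (Φ₀ + m (K(x, ·)))`, `m(0) = 0`, in that Banach space.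
The kernel being smooth, `x ↦ K(x, ·)` is a smooth map into `C(∂U)`
(`IsSmoothKernel.exists_sections`), and hence all displacements are smooth and there is no loss of
derivatives. The theorem follows from Picard–Lindelöf and Gronwall once the vector field is
Lipschitz on a ball (`exists_isFlowBall`).

The Lipschitz estimate is `exists_momentum_lipschitz`: if `φ` is a `C^1` embedding with
`c |y - z| ≤ |φ y - φ z|`, and `ψ - φ` has a small Lipschitz constant `L`, then the momenta of `φ`
and `ψ` differ by at most a constant times `L`. Extending `(ψ - φ) ∘ φ⁻¹` to `ℝ^d` gives a
homeomorphism `H` of `ℝ^d`, close to the identity in the Lipschitz sense, with `H ∘ φ = ψ`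
(`HasLowerBound.exists_homeomorph`).
* Since `H` and its inverse are Lipschitz with constants close to one, the two Hausdorff measures
  are comparable (`pullbackSurface_le`), and so are their normalizations (`normalize_le`). No area
  formula is needed.
* `H` maps the region enclosed by `φ(∂U)` to the one enclosed by `ψ(∂U)`, and the unit normals, which
  are close up to sign by linear algebra, are therefore not opposite (`norm_outwardNormal_sub_le`).
  Enclosed regions are unique (`IsEnclosedRegion.unique`), because a region lies locally on exactly
  one side of the hypersurface. That such a region exists is the Jordan–Brouwer theorem; the
  estimate does not depend on it, as both normals are zero by convention when there is none.

It remains to relate this to the space of embeddings and its metric `ckDist`. For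
immersions, convergence in `ckDist` is just convergence in `C^k`, because the inverse Jacobian is a
smooth function of the differential (`CkConv.tendsto_ckDist`, `ckConv_of_tendsto_ckDist`). Elements of the completion are
immersions, so by compactness embeddings are bi-Lipschitz (`IsImmersion.exists_hasLowerBound`), and
Lipschitz-small smooth perturbations stay in the space (`add_mem_embeddings`). Conversely a `C^1`
small map has a small Lipschitz constant on the possibly disconnected `∂U` (`exists_lipBound`), so
that the momentum is continuous in time along any solution, and every solution comes from a
momentum path (`IsFlowBall.unique`).
-/

noncomputable section

namespace GrowthFlow

variable {d : ℕ} {F : Type*} [NormedAddCommGroup F] [NormedSpace ℝ F]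

/-! ### Smooth hypersurfaces: defining functions, straightening charts and tangent spaces -/

/-- `f` is a smooth local defining function of `M` at the point `p` of `M`. -/
structure IsLocalDefining (M : Set (Euc d)) (f : Euc d → ℝ) (p : Euc d) : Prop where
  contDiff : ContDiff ℝ ∞ f
  apply_eq : f p = 0
  fderiv_ne : fderiv ℝ f p ≠ 0
  mem_iff : ∀ᶠ z in 𝓝 p, (z ∈ M ↔ f z = 0)

/-- A smooth hypersurface: locally the regular zero set of a smooth function. -/
def IsHypersurface (M : Set (Euc d)) : Prop :=
  ∀ p ∈ M, ∃ f, IsLocalDefining M f p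

theorem mem_frontier_iff_of_sublevel {U : Set (Euc d)} (hU : IsClosed U) {f : Euc d → ℝ}
    (hf : ContDiff ℝ ∞ f) {q : Euc d} (hq : fderiv ℝ f q ≠ 0)
    (h : ∀ᶠ z in 𝓝 q, (z ∈ U ↔ f z ≤ 0)) : q ∈ frontier U ↔ f q = 0 := by
  rw [hU.frontier_eq]
  constructor
  · rintro ⟨h1, h2⟩
    refine le_antisymm (h.self_of_nhds.1 h1) (not_lt.1 fun h3 => h2 ?_)
    rw [mem_interior_iff_mem_nhds]
    filter_upwards [h, hf.continuous.continuousAt.eventually (gt_mem_nhds h3)] with z hz hz'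
    exact hz.2 hz'.le
  · intro h0
    refine ⟨h.self_of_nhds.2 h0.le, fun h3 => hq ?_⟩
    rw [mem_interior_iff_mem_nhds] at h3
    have : IsLocalMax f q := by
      filter_upwards [h, h3] with z hz hz'
      rw [h0]
      exact hz.1 hz'
    exact this.fderiv_eq_zero

theorem HasSmoothBoundary.isHypersurface {U : Set (Euc d)} (hU : IsClosed U)
    (h : HasSmoothBoundary U) : IsHypersurface (frontier U) := by
  intro p hp
  obtain ⟨f, hf, hfp, hloc⟩ := h p hp
  have hc : Continuous (fderiv ℝ f) := hf.continuous_fderiv (by simp)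
  refine ⟨f, hf, (mem_frontier_iff_of_sublevel hU hf hfp hloc).1 hp, hfp, ?_⟩
  filter_upwards [hloc.eventually_nhds, hc.continuousAt.eventually_ne hfp] with z hz hz'
  exact mem_frontier_iff_of_sublevel hU hf hz' hz

theorem IsLocalDefining.eventually {M : Set (Euc d)} {f : Euc d → ℝ} {p : Euc d}
    (h : IsLocalDefining M f p) : ∀ᶠ z in 𝓝 p, z ∈ M → IsLocalDefining M f z := by
  have hc : Continuous (fderiv ℝ f) := h.contDiff.continuous_fderiv (by simp)
  filter_upwards [h.mem_iff.eventually_nhds, hc.continuousAt.eventually_ne h.fderiv_ne]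
    with z hz hz' hzM
  exact ⟨h.contDiff, hz.self_of_nhds.1 hzM, hz', hz⟩

/-- A chart of `ℝ^d` at the point `p` of `M`, tangent to the identity, that straightens `M` to the
hyperplane through `p` with unit normal `N`. -/
structure StraighteningChart (M : Set (Euc d)) (p N : Euc d) where
  toChart : OpenPartialHomeomorph (Euc d) (Euc d)
  norm_normal : ‖N‖ = 1
  mem_source : p ∈ toChart.source
  apply_eq : toChart p = p
  contDiff : ContDiff ℝ ∞ toChart
  mem_iff : ∀ z ∈ toChart.source, (z ∈ M ↔ inner ℝ N (toChart z - p) = 0)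
  symm_contDiffAt : ContDiffAt ℝ 1 toChart.symm p
  symm_hasFDerivAt : HasFDerivAt toChart.symm (ContinuousLinearMap.id ℝ (Euc d)) p

/-- The unit normal given by a defining function. -/
def unitGradient (f : Euc d → ℝ) (p : Euc d) : Euc d :=
  ‖gradient f p‖⁻¹ • gradient f p

theorem inner_gradient {f : Euc d → ℝ} {p v : Euc d} :
    inner ℝ (gradient f p) v = fderiv ℝ f p v := by
  rw [gradient, InnerProductSpace.toDual_symm_apply]

theorem gradient_ne_zero {f : Euc d → ℝ} {p : Euc d} (h : fderiv ℝ f p ≠ 0) :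
    gradient f p ≠ 0 := by
  rw [gradient]
  simpa using h

theorem norm_unitGradient {f : Euc d → ℝ} {p : Euc d} (h : fderiv ℝ f p ≠ 0) :
    ‖unitGradient f p‖ = 1 := by
  have := gradient_ne_zero h
  rw [unitGradient, norm_smul, norm_inv, norm_norm, inv_mul_cancel₀ (norm_ne_zero_iff.2 this)]

theorem inner_unitGradient {f : Euc d → ℝ} {p v : Euc d} :
    inner ℝ (unitGradient f p) v = ‖gradient f p‖⁻¹ * fderiv ℝ f p v := by
  rw [unitGradient, real_inner_smul_left, inner_gradient]

theorem IsLocalDefining.exists_chart {M : Set (Euc d)} {f : Euc d → ℝ} {p : Euc d}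
    (h : IsLocalDefining M f p) : Nonempty (StraighteningChart M p (unitGradient f p)) := by
  set N := unitGradient f p with hN
  set a := ‖gradient f p‖ with ha
  have ha0 : a ≠ 0 := norm_ne_zero_iff.2 (gradient_ne_zero h.fderiv_ne)
  have hNN : ‖N‖ = 1 := norm_unitGradient h.fderiv_ne
  have hin : ∀ v, inner ℝ N v = a⁻¹ * fderiv ℝ f p v := fun v => inner_unitGradient
  -- the normal coordinate of `z` is replaced by `f z`, normalised
  let S : Euc d → Euc d := fun z => z + (a⁻¹ * f z - inner ℝ N (z - p)) • N
  have hS : ContDiff ℝ ∞ S :=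
    contDiff_id.add (((contDiff_const.mul h.contDiff).sub
      (contDiff_const.inner ℝ (contDiff_id.sub contDiff_const))).smul contDiff_const)
  have hSp : S p = p := by simp [S, h.apply_eq]
  have hSd : HasFDerivAt S ((ContinuousLinearEquiv.refl ℝ (Euc d) : Euc d →L[ℝ] Euc d)) p := by
    have h1 : HasFDerivAt f (fderiv ℝ f p) p :=
      (h.contDiff.differentiable (by simp) p).hasFDerivAt
    have h2 : HasFDerivAt (fun z : Euc d => inner ℝ N (z - p)) (innerSL ℝ N) p := by
      have := (innerSL ℝ N).hasFDerivAt.comp p ((hasFDerivAt_id p).sub_const p)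
      exact this
    have h3 := (hasFDerivAt_id p).add (((h1.const_mul a⁻¹).sub h2).smul_const N)
    refine h3.congr_fderiv ?_
    ext v
    simp [hin]
  have hSin : ∀ z, inner ℝ N (S z - p) = a⁻¹ * f z := by
    intro z
    have : S z - p = (z - p) + (a⁻¹ * f z - inner ℝ N (z - p)) • N := by
      simp only [S]; abel
    rw [this, inner_add_right, real_inner_smul_right, real_inner_self_eq_norm_sq, hNN]
    ring
  have hSat := hS.contDiffAt (x := p)
  let e := hSat.toOpenPartialHomeomorph S hSd (by simp)
  have hps : p ∈ e.source := hSat.mem_toOpenPartialHomeomorph_source hSd (by simp)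
  have hes : ContDiffAt ℝ ∞ e.symm p := by
    have := hSat.to_localInverse hSd (by simp)
    rw [hSp] at this
    exact this
  obtain ⟨O, hO, hOo, hpO⟩ := eventually_nhds_iff.1 h.mem_iff
  refine ⟨⟨e.restrOpen O hOo, hNN, ⟨hps, hpO⟩, hSp, hS, ?_, hes.of_le (by simp), ?_⟩⟩
  · intro z hz
    rw [hO z hz.2]
    change _ ↔ inner ℝ N (S z - p) = 0
    rw [hSin]
    simp [ha0]
  · have hds := e.hasFDerivAt_symm (a := p) (f' := ContinuousLinearEquiv.refl ℝ (Euc d))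
      (by have := e.map_source hps; rwa [show e p = p from hSp] at this)
      (by
        have : e.symm p = p := by
          conv_lhs => rw [← hSp]
          exact e.left_inv hps
        rw [this]; exact hSd)
    exact hds

namespace StraighteningChart

variable {M : Set (Euc d)} {p N : Euc d}

theorem mem_target (χ : StraighteningChart M p N) : p ∈ χ.toChart.target := by
  have := χ.toChart.map_source χ.mem_source
  rwa [χ.apply_eq] at this

theorem symm_apply_eq (χ : StraighteningChart M p N) : χ.toChart.symm p = p := by
  have := χ.toChart.left_inv χ.mem_source
  rwa [χ.apply_eq] at this

theorem symm_mem_iff (χ : StraighteningChart M p N) {x : Euc d} (hx : x ∈ χ.toChart.target) :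
    χ.toChart.symm x ∈ M ↔ inner ℝ N (x - p) = 0 := by
  rw [χ.mem_iff _ (χ.toChart.map_target hx), χ.toChart.right_inv hx]

/-- The chart maps tangent vectors of the hyperplane to tangent vectors of `M`. -/
theorem fderiv_symm_mem_tangentCone (χ : StraighteningChart M p N) {x v : Euc d}
    (hx : x ∈ χ.toChart.target) (hxN : inner ℝ N (x - p) = 0)
    (hd : DifferentiableAt ℝ χ.toChart.symm x) (hv : inner ℝ N v = 0) :
    fderiv ℝ χ.toChart.symm x v ∈ tangentConeAt ℝ M (χ.toChart.symm x) := by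
  let Hp : Set (Euc d) := {z | inner ℝ N (z - p) = 0}
  have h1 : v ∈ tangentConeAt ℝ (Hp ∩ χ.toChart.target) x := by
    rw [tangentConeAt_inter_nhds (χ.toChart.open_target.mem_nhds hx)]
    refine mem_tangentConeAt_of_pow_smul (r := 2⁻¹) (by norm_num) (by norm_num) (.of_forall ?_)
    intro n
    change inner ℝ N (x + (2⁻¹ : ℝ) ^ n • v - p) = 0
    rw [add_sub_right_comm, inner_add_right, real_inner_smul_right, hxN, hv]
    simp
  have h2 := (hd.hasFDerivAt.hasFDerivWithinAt (s := Hp ∩ χ.toChart.target)).mapsTo_tangent_cone h1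
  refine tangentConeAt_mono ?_ h2
  rintro _ ⟨z, hz, rfl⟩
  exact (χ.symm_mem_iff hz.2).2 hz.1

end StraighteningChart

theorem IsLocalDefining.mem_tangentCone_iff {M : Set (Euc d)} {f : Euc d → ℝ} {p : Euc d}
    (h : IsLocalDefining M f p) {v : Euc d} :
    v ∈ tangentConeAt ℝ M p ↔ fderiv ℝ f p v = 0 := by
  constructor
  · intro hv
    have hf : HasFDerivAt f (fderiv ℝ f p) p :=
      (h.contDiff.differentiable (by simp) p).hasFDerivAt
    obtain ⟨O, hO, hOo, hpO⟩ := eventually_nhds_iff.1 h.mem_iff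
    have h1 : v ∈ tangentConeAt ℝ (M ∩ O) p := by
      rwa [tangentConeAt_inter_nhds (hOo.mem_nhds hpO)]
    have h2 : HasFDerivWithinAt f (0 : Euc d →L[ℝ] ℝ) (M ∩ O) p :=
      (hasFDerivWithinAt_const (0 : ℝ) p (M ∩ O)).congr (fun z hz => (hO z hz.2).1 hz.1) h.apply_eq
    exact hf.hasFDerivWithinAt.unique_on h2 h1
  · intro hv
    obtain ⟨χ⟩ := h.exists_chart
    have := χ.fderiv_symm_mem_tangentCone (x := p) (v := v) χ.mem_target (by simp)
      χ.symm_hasFDerivAt.differentiableAt (by rw [inner_unitGradient, hv, mul_zero])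
    rw [χ.symm_apply_eq, χ.symm_hasFDerivAt.fderiv] at this
    exact this

theorem IsLocalDefining.tangentSpace_eq {U : Set (Euc d)} {f : Euc d → ℝ} {y : frontier U}
    (h : IsLocalDefining (frontier U) f y) :
    tangentSpace U y = LinearMap.ker (fderiv ℝ f (y : Euc d)).toLinearMap := by
  have : tangentConeAt ℝ (frontier U) (y : Euc d)
      = (LinearMap.ker (fderiv ℝ f (y : Euc d)).toLinearMap : Set (Euc d)) := by
    ext v
    simp [h.mem_tangentCone_iff]
  rw [tangentSpace, this, Submodule.span_eq]

theorem IsHypersurface.tangentSpace_eq_tangentCone {U : Set (Euc d)}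
    (hM : IsHypersurface (frontier U)) (y : frontier U) :
    (tangentSpace U y : Set (Euc d)) = tangentConeAt ℝ (frontier U) (y : Euc d) := by
  obtain ⟨f, hf⟩ := hM y y.2
  ext v
  simp [hf.tangentSpace_eq, hf.mem_tangentCone_iff]

theorem IsLocalDefining.mem_tangentSpace_iff {U : Set (Euc d)} {f : Euc d → ℝ} {y : frontier U}
    (h : IsLocalDefining (frontier U) f y) {v : Euc d} :
    v ∈ tangentSpace U y ↔ inner ℝ (unitGradient f y) v = 0 := by
  have := norm_ne_zero_iff.2 (gradient_ne_zero h.fderiv_ne)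
  rw [h.tangentSpace_eq, inner_unitGradient]
  simp [this]

theorem IsLocalDefining.tangentProj_apply {U : Set (Euc d)} {f : Euc d → ℝ} {y : frontier U}
    (h : IsLocalDefining (frontier U) f y) (v : Euc d) :
    tangentProj U y v = v - inner ℝ (unitGradient f y) v • unitGradient f y := by
  have hN := norm_unitGradient h.fderiv_ne
  rw [tangentProj]
  refine Submodule.eq_starProjection_of_mem_of_inner_eq_zero ?_ ?_
  · rw [h.mem_tangentSpace_iff, inner_sub_right, real_inner_smul_right,
      real_inner_self_eq_norm_sq, hN]
    ring
  · intro w hw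
    rw [h.mem_tangentSpace_iff] at hw
    simp [real_inner_smul_left, hw]

theorem tangentProj_mem (U : Set (Euc d)) (y : frontier U) (v : Euc d) :
    tangentProj U y v ∈ tangentSpace U y := by
  rw [tangentProj]; exact Submodule.starProjection_apply_mem _ _

theorem tangentProj_eq_self {U : Set (Euc d)} {y : frontier U} {v : Euc d}
    (h : v ∈ tangentSpace U y) : tangentProj U y v = v := by
  rw [tangentProj]; exact Submodule.starProjection_eq_self_iff.2 h

theorem norm_tangentProj_le (U : Set (Euc d)) (y : frontier U) : ‖tangentProj U y‖ ≤ 1 := by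
  rw [tangentProj]; exact Submodule.starProjection_norm_le _

/-- Local extensions of class `C^k` can be glued to a global one. -/
theorem isCk_of_local {U : Set (Euc d)} {k : ℕ∞} {φ : frontier U → F} [FiniteDimensional ℝ F]
    (h : ∀ y : frontier U, ∃ O : Set (Euc d), IsOpen O ∧ (y : Euc d) ∈ O ∧ ∃ g : Euc d → F,
      ContDiffOn ℝ k g O ∧ ∀ z : frontier U, (z : Euc d) ∈ O → g z = φ z) : IsCk U k φ := by
  let t : Euc d → Set F := fun x => {c | ∀ hx : x ∈ frontier U, c = φ ⟨x, hx⟩}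
  have ht : ∀ x, Convex ℝ (t x) := by
    intro x a ha b hb α β _ _ hab hx
    rw [ha hx, hb hx, ← add_smul, hab, one_smul]
  obtain ⟨g, hg⟩ := exists_contMDiffMap_forall_mem_convex_of_local
    (n := k) (modelWithCornersSelf ℝ (Euc d)) (M := Euc d) (t := t) ht (by
      intro x
      by_cases hx : x ∈ frontier U
      · obtain ⟨O, hO, hxO, g, hg, hgφ⟩ := h ⟨x, hx⟩
        exact ⟨O, hO.mem_nhds hxO, g, hg.contMDiffOn, fun z hz hzM => hgφ ⟨z, hzM⟩ hz⟩
      · refine ⟨(frontier U)ᶜ, isClosed_frontier.isOpen_compl.mem_nhds hx, fun _ => 0,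
          contMDiffOn_const, fun z hz hzM => absurd hzM hz⟩)
  exact ⟨g, g.contMDiff.contDiff, fun y => hg y y.2⟩

theorem IsHypersurface.isCk_tangentProj {U : Set (Euc d)} (hM : IsHypersurface (frontier U)) :
    IsCk U ∞ (tangentProj U) := by
  refine isCk_of_local fun y => ?_
  obtain ⟨f, hf⟩ := hM y y.2
  have hg : ContDiff ℝ ∞ (fun z => fderiv ℝ f z) := hf.contDiff.fderiv_right (by simp)
  have hgrad : ContDiff ℝ ∞ (fun z => gradient f z) :=
    (InnerProductSpace.toDual ℝ (Euc d)).symm.contDiff.comp hg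
  have hne := hg.continuous.continuousAt.eventually_ne hf.fderiv_ne
  obtain ⟨O, hO, hOo, hyO⟩ := eventually_nhds_iff.1 (hne.and hf.eventually)
  refine ⟨O, hOo, hyO, fun z => ContinuousLinearMap.id ℝ (Euc d) -
    (‖gradient f z‖ ^ 2)⁻¹ • (fderiv ℝ f z).smulRight (gradient f z), ?_, ?_⟩
  · have h1 : ContDiffOn ℝ ∞ (fun z => (‖gradient f z‖ ^ 2)⁻¹) O := by
      refine ContDiffOn.inv (hgrad.norm_sq ℝ).contDiffOn fun z hz => ?_
      exact pow_ne_zero _ (norm_ne_zero_iff.2 (gradient_ne_zero (hO z hz).1))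
    have h2 : ContDiff ℝ ∞ fun z => (fderiv ℝ f z).smulRight (gradient f z) :=
      hg.smulRight hgrad
    exact contDiffOn_const.sub (h1.smul h2.contDiffOn)
  · intro z hz
    have h1 := (hO z hz).2 z.2
    ext1 v
    rw [h1.tangentProj_apply, inner_unitGradient, unitGradient, smul_smul]
    simp only [sub_apply, ContinuousLinearMap.id_apply, smul_apply,
      ContinuousLinearMap.smulRight_apply, smul_smul]
    ring_nf

/-! ### Tangential calculus on a hypersurface -/

section TangentialCalculus

variable {U : Set (Euc d)} {G H : Type*} [NormedAddCommGroup G] [NormedSpace ℝ G]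
  [NormedAddCommGroup H] [NormedSpace ℝ H] {k : WithTop ℕ∞}

theorem IsCk.of_le {l : WithTop ℕ∞} {φ : frontier U → F} (h : IsCk U k φ) (hl : l ≤ k) :
    IsCk U l φ :=
  let ⟨g, hg, h⟩ := h
  ⟨g, hg.of_le hl, h⟩

theorem IsCk.continuous {φ : frontier U → F} (h : IsCk U k φ) : Continuous φ := by
  obtain ⟨g, hg, h⟩ := h
  rw [show φ = fun y : frontier U => g y from funext fun y => (h y).symm]
  exact hg.continuous.comp continuous_subtype_val

theorem isCk_const (c : F) : IsCk U k (fun _ => c) :=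
  ⟨fun _ => c, contDiff_const, fun _ => rfl⟩

theorem IsCk.add {φ ψ : frontier U → F} (hφ : IsCk U k φ) (hψ : IsCk U k ψ) :
    IsCk U k (fun y => φ y + ψ y) :=
  let ⟨g, hg, h⟩ := hφ
  let ⟨g', hg', h'⟩ := hψ
  ⟨fun y => g y + g' y, hg.add hg', fun y => by simp only [h, h']⟩

theorem IsCk.sub {φ ψ : frontier U → F} (hφ : IsCk U k φ) (hψ : IsCk U k ψ) :
    IsCk U k (fun y => φ y - ψ y) :=
  let ⟨g, hg, h⟩ := hφ
  let ⟨g', hg', h'⟩ := hψ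
  ⟨fun y => g y - g' y, hg.sub hg', fun y => by simp only [h, h']⟩

theorem IsCk.clm_comp {φ : frontier U → F} (hφ : IsCk U k φ) (L : F →L[ℝ] G) :
    IsCk U k (fun y => L (φ y)) :=
  let ⟨g, hg, h⟩ := hφ
  ⟨fun y => L (g y), L.contDiff.comp hg, fun y => by simp only [h]⟩

theorem IsCk.bilin {φ : frontier U → F} {ψ : frontier U → G} (hφ : IsCk U k φ) (hψ : IsCk U k ψ)
    (B : F →L[ℝ] G →L[ℝ] H) : IsCk U k (fun y => B (φ y) (ψ y)) :=
  let ⟨g, hg, h⟩ := hφ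
  let ⟨g', hg', h'⟩ := hψ
  ⟨fun y => B (g y) (g' y), B.isBoundedBilinearMap.contDiff.comp (hg.prodMk hg'),
    fun y => by simp only [h, h']⟩

/-- The tangential derivative can be computed with any extension to the ambient space. -/
theorem tderiv_eq {φ : frontier U → F} {g : Euc d → F} (hg : ∀ y : frontier U, g y = φ y)
    {y : frontier U} (hd : DifferentiableAt ℝ g y) :
    tderiv U φ y = (fderiv ℝ g y).comp (tangentProj U y) := by
  have h1 : HasFDerivWithinAt (Function.extend Subtype.val φ 0) (fderiv ℝ g y) (frontier U)
      (y : Euc d) := by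
    refine hd.hasFDerivAt.hasFDerivWithinAt.congr (fun z hz => ?_) ?_
    · exact (Subtype.val_injective.extend_apply φ 0 ⟨z, hz⟩).trans (hg ⟨z, hz⟩).symm
    · exact (Subtype.val_injective.extend_apply φ 0 y).trans (hg y).symm
  have h2 := h1.differentiableWithinAt.hasFDerivWithinAt
  have h3 : EqOn (fderivWithin ℝ (Function.extend Subtype.val φ 0) (frontier U) (y : Euc d))
      (fderiv ℝ g y) (tangentSpace U y) :=
    LinearMap.eqOn_span' (f := (fderivWithin ℝ (Function.extend Subtype.val φ 0) (frontier U)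
      (y : Euc d)).toLinearMap) (g := (fderiv ℝ g y).toLinearMap) (h2.unique_on h1)
  ext v
  exact h3 (tangentProj_mem U y v)

theorem tpartial_eq {φ : frontier U → F} {g : Euc d → F} (hg : ∀ y : frontier U, g y = φ y)
    {y : frontier U} (hd : DifferentiableAt ℝ g y) (i : Fin d) :
    tpartial U i φ y = fderiv ℝ g y (tangentProj U y (EuclideanSpace.single i 1)) := by
  rw [tpartial, tderiv_eq hg hd]; rfl

theorem IsCk.tderiv_comp_tangentProj {φ : frontier U → F} (hφ : IsCk U 1 φ) (y : frontier U) :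
    (tderiv U φ y).comp (tangentProj U y) = tderiv U φ y := by
  obtain ⟨g, hg, h⟩ := hφ
  rw [tderiv_eq h (hg.differentiable (by simp) y)]
  ext v
  simp only [ContinuousLinearMap.comp_apply]
  rw [tangentProj_eq_self (tangentProj_mem U y v)]

theorem tderiv_add {φ ψ : frontier U → F} (hφ : IsCk U 1 φ) (hψ : IsCk U 1 ψ) (y : frontier U) :
    tderiv U (fun y => φ y + ψ y) y = tderiv U φ y + tderiv U ψ y := by
  obtain ⟨g, hg, h⟩ := hφ
  obtain ⟨g', hg', h'⟩ := hψ
  have hd := hg.differentiable (by simp) (y : Euc d)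
  have hd' := hg'.differentiable (by simp) (y : Euc d)
  rw [tderiv_eq h hd, tderiv_eq h' hd',
    tderiv_eq (g := fun z => g z + g' z) (fun y => by rw [h, h']) (hd.add hd'),
    fderiv_fun_add hd hd', ContinuousLinearMap.add_comp]

theorem tderiv_sub {φ ψ : frontier U → F} (hφ : IsCk U 1 φ) (hψ : IsCk U 1 ψ) (y : frontier U) :
    tderiv U (fun y => φ y - ψ y) y = tderiv U φ y - tderiv U ψ y := by
  obtain ⟨g, hg, h⟩ := hφ
  obtain ⟨g', hg', h'⟩ := hψ
  have hd := hg.differentiable (by simp) (y : Euc d)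
  have hd' := hg'.differentiable (by simp) (y : Euc d)
  rw [tderiv_eq h hd, tderiv_eq h' hd',
    tderiv_eq (g := fun z => g z - g' z) (fun y => by rw [h, h']) (hd.sub hd'),
    fderiv_fun_sub hd hd', ContinuousLinearMap.sub_comp]

theorem tpartial_sub {φ ψ : frontier U → F} (hφ : IsCk U 1 φ) (hψ : IsCk U 1 ψ) (i : Fin d) :
    tpartial U i (fun y => φ y - ψ y) = fun y => tpartial U i φ y - tpartial U i ψ y := by
  ext y
  simp [tpartial, tderiv_sub hφ hψ]

theorem tpartial_const (c : F) (i : Fin d) :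
    tpartial U i (fun _ => c) = fun _ => 0 := by
  ext y
  rw [tpartial_eq (g := fun _ => c) (fun _ => rfl) (differentiableAt_const c)]
  simp

/-- The Leibniz rule. -/
theorem tpartial_bilin {φ : frontier U → F} {ψ : frontier U → G} (hφ : IsCk U 1 φ)
    (hψ : IsCk U 1 ψ) (B : F →L[ℝ] G →L[ℝ] H) (i : Fin d) :
    tpartial U i (fun y => B (φ y) (ψ y)) =
      fun y => B (tpartial U i φ y) (ψ y) + B (φ y) (tpartial U i ψ y) := by
  obtain ⟨g, hg, h⟩ := hφ
  obtain ⟨g', hg', h'⟩ := hψ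
  ext y
  have hd := hg.differentiable (by simp) (y : Euc d)
  have hd' := hg'.differentiable (by simp) (y : Euc d)
  have hB := B.hasFDerivAt_of_bilinear hd.hasFDerivAt hd'.hasFDerivAt
  rw [tpartial_eq h hd, tpartial_eq h' hd', tpartial_eq (g := fun z => B (g z) (g' z))
    (fun y => by rw [h, h']) hB.differentiableAt, hB.fderiv]
  simp [h, h', add_comm]

theorem tpartial_congr_isCk {φ : frontier U → F} {g : Euc d → F}
    (hg : ∀ y : frontier U, g y = φ y) (hd : Differentiable ℝ g) (i : Fin d) :
    tpartial U i φ = fun y : frontier U =>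
      fderiv ℝ g y (tangentProj U y (EuclideanSpace.single i 1)) :=
  funext fun y => tpartial_eq hg (hd y) i

theorem IsCk.tpartial (hM : IsHypersurface (frontier U)) {k l : ℕ∞} (hl : l + 1 ≤ k)
    {φ : frontier U → F} (hφ : IsCk U k φ) (i : Fin d) : IsCk U l (tpartial U i φ) := by
  obtain ⟨g, hg, h⟩ := hφ
  have h1k : (1 : WithTop ℕ∞) ≤ k := by
    have : (1 : ℕ∞) ≤ k := le_trans le_add_self hl
    exact_mod_cast this
  obtain ⟨P, hP, hPe⟩ := hM.isCk_tangentProj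
  rw [tpartial_congr_isCk h (hg.differentiable (fun h0 => by simp [h0] at h1k)) i]
  refine ⟨fun z => fderiv ℝ g z (P z (EuclideanSpace.single i 1)), ?_, fun y => by simp only [hPe]⟩
  have h1 : ContDiff ℝ l (fderiv ℝ g) := hg.fderiv_right (by exact_mod_cast hl)
  have h2 : ContDiff ℝ l P := hP.of_le (by exact_mod_cast le_top)
  exact h1.clm_apply (h2.clm_apply contDiff_const)

theorem IsCk.tpartial_nat (hM : IsHypersurface (frontier U)) {k : ℕ}
    {φ : frontier U → F} (hφ : IsCk U ((k + 1 : ℕ) : WithTop ℕ∞) φ) (i : Fin d) :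
    IsCk U (k : WithTop ℕ∞) (GrowthFlow.tpartial U i φ) :=
  IsCk.tpartial hM (k := ((k + 1 : ℕ) : ℕ∞)) (l := ((k : ℕ) : ℕ∞)) (by simp) hφ i

/-- The linear map that rebuilds an operator from its columns. -/
def ofColumns (d : ℕ) (F : Type*) [NormedAddCommGroup F] [NormedSpace ℝ F] (i : Fin d) :
    F →L[ℝ] (Euc d →L[ℝ] F) :=
  ContinuousLinearMap.smulRightL ℝ (Euc d) F (EuclideanSpace.proj i)

theorem tderiv_eq_sum (φ : frontier U → F) (y : frontier U) :
    tderiv U φ y = ∑ i, ofColumns d F i (tpartial U i φ y) := by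
  refine ContinuousLinearMap.coe_injective
    ((EuclideanSpace.basisFun (Fin d) ℝ).toBasis.ext fun j => ?_)
  simp only [OrthonormalBasis.coe_toBasis, EuclideanSpace.basisFun_apply,
    ContinuousLinearMap.coe_coe]
  simp [ofColumns, tpartial]

theorem IsCk.sum {ι : Type*} (s : Finset ι) {φ : ι → frontier U → F}
    (h : ∀ i ∈ s, IsCk U k (φ i)) : IsCk U k (fun y => ∑ i ∈ s, φ i y) := by
  classical
  induction s using Finset.induction_on with
  | empty => simpa using isCk_const (0 : F)
  | insert a s ha ih =>
    simp only [Finset.sum_insert ha]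
    exact (h a (by simp)).add (ih fun i hi => h i (by simp [hi]))

theorem IsCk.tderiv_nat (hM : IsHypersurface (frontier U)) {k : ℕ}
    {φ : frontier U → F} (hφ : IsCk U ((k + 1 : ℕ) : WithTop ℕ∞) φ) :
    IsCk U (k : WithTop ℕ∞) (tderiv U φ) := by
  rw [show tderiv U φ = fun y => ∑ i, ofColumns d F i (GrowthFlow.tpartial U i φ y) from
    funext (tderiv_eq_sum φ)]
  exact IsCk.sum _ fun i _ => (hφ.tpartial_nat hM i).clm_comp _

/-- Inversion preserves the class `C^k`. -/
theorem IsCk.ringInverse {k : ℕ} {R : frontier U → (Euc d →L[ℝ] Euc d)}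
    (hR : IsCk U (k : WithTop ℕ∞) R) (hu : ∀ y, IsUnit (R y)) :
    IsCk U (k : WithTop ℕ∞) (fun y => Ring.inverse (R y)) := by
  obtain ⟨g, hg, h⟩ := hR
  refine isCk_of_local (k := ((k : ℕ) : ℕ∞)) fun y => ⟨g ⁻¹' {x | IsUnit x},
    Units.isOpen.preimage hg.continuous, by simpa [h] using hu y, fun z => Ring.inverse (g z),
    fun z hz => ?_, fun z _ => by simp only [h]⟩
  obtain ⟨u, hu⟩ := (hz : IsUnit (g z))
  have h1 := contDiffAt_ringInverse (n := (k : WithTop ℕ∞)) ℝ u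
  rw [hu] at h1
  exact (h1.comp z hg.contDiffAt).contDiffWithinAt

theorem tpartial_ringInverse {R : frontier U → (Euc d →L[ℝ] Euc d)}
    (hR : IsCk U 1 R) (hu : ∀ y, IsUnit (R y)) (i : Fin d) :
    tpartial U i (fun y => Ring.inverse (R y)) =
      fun y => -(Ring.inverse (R y) * tpartial U i R y * Ring.inverse (R y)) := by
  have hR' : IsCk U 1 (fun y => Ring.inverse (R y)) := by
    have := IsCk.ringInverse (k := 1) (by simpa using hR) hu
    simpa using this
  have h1 := tpartial_bilin hR hR' (ContinuousLinearMap.compL ℝ (Euc d) (Euc d) (Euc d)) i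
  have h2 : (fun y => ContinuousLinearMap.compL ℝ (Euc d) (Euc d) (Euc d) (R y)
      (Ring.inverse (R y))) =
      fun _ => 1 := funext fun y => Ring.mul_inverse_cancel _ (hu y)
  rw [h2, tpartial_const] at h1
  funext y
  have h3 := congrFun h1 y
  have h4 : R y * tpartial U i (fun y => Ring.inverse (R y)) y =
      -(tpartial U i R y * Ring.inverse (R y)) := by
    rw [eq_neg_iff_add_eq_zero, add_comm]; exact h3.symm
  calc _ = Ring.inverse (R y) * (R y * tpartial U i (fun y => Ring.inverse (R y)) y) := by
        rw [← mul_assoc, Ring.inverse_mul_cancel _ (hu y), one_mul]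
    _ = _ := by rw [h4]; ext1 v; simp

end TangentialCalculus

/-! ### Convergence in `C^k` -/

section UniformConvergence

variable {ι X E₁ E₂ : Type*} {l : Filter ι}

theorem tendstoUniformly_const [UniformSpace E₁] (φ : X → E₁) :
    TendstoUniformly (fun _ : ι => φ) φ l :=
  fun _ hs => .of_forall fun _ _ => refl_mem_uniformity hs

theorem tendstoUniformly_congr [UniformSpace E₁] {u v : ι → X → E₁} {φ : X → E₁}
    (h : TendstoUniformly u φ l) (huv : ∀ᶠ n in l, u n = v n) : TendstoUniformly v φ l :=
  fun s hs => by
    filter_upwards [h s hs, huv] with n hn hn'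
    rwa [← hn']

/-- A continuous operation on values preserves uniform convergence on a compact space. -/
theorem tendstoUniformly_comp [TopologicalSpace X] [CompactSpace X] [UniformSpace E₁]
    [UniformSpace E₂] {u : ι → X → E₁}
    {φ : X → E₁} (h : TendstoUniformly u φ l) (hφ : Continuous φ) {f : E₁ → E₂}
    (hf : ∀ y, ContinuousAt f (φ y)) :
    TendstoUniformly (fun n y => f (u n y)) (fun y => f (φ y)) l := by
  rw [← tendstoLocallyUniformly_iff_tendstoUniformly_of_compactSpace] at h ⊢
  rw [tendstoLocallyUniformly_iff_forall_tendsto] at h ⊢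
  intro y
  have h1 : Tendsto (fun p : ι × X => φ p.2) (l ×ˢ 𝓝 y) (𝓝 (φ y)) :=
    hφ.continuousAt.tendsto.comp tendsto_snd
  have h2 : Tendsto (fun p : ι × X => u p.1 p.2) (l ×ˢ 𝓝 y) (𝓝 (φ y)) :=
    h1.congr_uniformity (h y)
  have h3 := ((hf y).tendsto.comp h1).prodMk_nhds ((hf y).tendsto.comp h2)
  exact h3.mono_right (nhds_prod_eq.trans_le (nhds_prod_eq.symm.trans_le (nhds_le_uniformity _)))

theorem tendstoUniformly_prodMk [PseudoMetricSpace E₁] [PseudoMetricSpace E₂] {u : ι → X → E₁}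
    {φ : X → E₁} {v : ι → X → E₂} {ψ : X → E₂} (h : TendstoUniformly u φ l)
    (h' : TendstoUniformly v ψ l) :
    TendstoUniformly (fun n y => (u n y, v n y)) (fun y => (φ y, ψ y)) l := by
  rw [Metric.tendstoUniformly_iff] at *
  intro ε hε
  filter_upwards [h ε hε, h' ε hε] with n h1 h2 y
  exact max_lt (h1 y) (h2 y)

theorem tendstoUniformly_iff_enorm_sub [NormedAddCommGroup E₁] {u : ι → X → E₁} {φ : X → E₁} :
    TendstoUniformly u φ l ↔ ∀ ε : ℝ≥0∞, 0 < ε → ∀ᶠ n in l, ∀ y, ‖u n y - φ y‖ₑ ≤ ε := by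
  rw [EMetric.tendstoUniformly_iff]
  have key : ∀ n y, edist (φ y) (u n y) = ‖u n y - φ y‖ₑ := fun n y => by
    rw [edist_comm, edist_eq_enorm_sub]
  simp only [key]
  constructor
  · intro h ε hε
    exact (h ε hε).mono fun n hn y => (hn y).le
  · intro h ε hε
    obtain ⟨δ, hδ, hδε⟩ := exists_between hε
    exact (h δ hδ).mono fun n hn y => (hn y).trans_lt hδε

end UniformConvergence

section Convergence

variable {U : Set (Euc d)} {G H : Type*} [NormedAddCommGroup G] [NormedSpace ℝ G]
  [NormedAddCommGroup H] [NormedSpace ℝ H] {ι : Type*} {l : Filter ι}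

/-- Convergence in `C^k`, by recursion on `k`: the maps converge uniformly and their tangential
partial derivatives converge in `C^{k-1}`. Unlike the norm `ckNorm`, this compares the maps without
subtracting them, which suits nonlinear operations. -/
def CkConv (U : Set (Euc d)) (l : Filter ι) :
    ℕ → (ι → frontier U → F) → (frontier U → F) → Prop
  | 0, u, φ => TendstoUniformly u φ l
  | k + 1, u, φ => TendstoUniformly u φ l ∧
      ∀ i, CkConv U l k (fun n => tpartial U i (u n)) (tpartial U i φ)

theorem CkConv.tendstoUniformly {k : ℕ} {u : ι → frontier U → F} {φ : frontier U → F}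
    (h : CkConv U l k u φ) : TendstoUniformly u φ l := by
  cases k with
  | zero => exact h
  | succ k => exact h.1

theorem CkConv.pred {k : ℕ} {u : ι → frontier U → F} {φ : frontier U → F}
    (h : CkConv U l (k + 1) u φ) : CkConv U l k u φ := by
  induction k generalizing u φ with
  | zero => exact h.1
  | succ k ih => exact ⟨h.1, fun i => ih (h.2 i)⟩

theorem CkConv.congr {k : ℕ} {u v : ι → frontier U → F} {φ : frontier U → F}
    (h : CkConv U l k u φ) (huv : ∀ᶠ n in l, u n = v n) : CkConv U l k v φ := by
  induction k generalizing u v φ with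
  | zero => exact tendstoUniformly_congr h huv
  | succ k ih =>
    refine ⟨tendstoUniformly_congr h.1 huv, fun i => ih (h.2 i) ?_⟩
    exact huv.mono fun n hn => by rw [hn]

theorem ckConv_const (k : ℕ) (φ : frontier U → F) : CkConv U l k (fun _ => φ) φ := by
  induction k generalizing φ with
  | zero => exact tendstoUniformly_const φ
  | succ k ih => exact ⟨tendstoUniformly_const φ, fun i => ih _⟩

theorem one_le_natCast_succ (k : ℕ) : (1 : WithTop ℕ∞) ≤ ((k + 1 : ℕ) : WithTop ℕ∞) := by
  exact_mod_cast Nat.le_add_left 1 k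

theorem natCast_le_succ (k : ℕ) : ((k : ℕ) : WithTop ℕ∞) ≤ ((k + 1 : ℕ) : WithTop ℕ∞) := by
  exact_mod_cast Nat.le_succ k

theorem CkConv.add {k : ℕ} {u v : ι → frontier U → F} {φ ψ : frontier U → F}
    (hM : IsHypersurface (frontier U)) (h : CkConv U l k u φ) (h' : CkConv U l k v ψ)
    (hu : ∀ᶠ n in l, IsCk U (k : WithTop ℕ∞) (u n)) (hφ : IsCk U (k : WithTop ℕ∞) φ)
    (hv : ∀ᶠ n in l, IsCk U (k : WithTop ℕ∞) (v n)) (hψ : IsCk U (k : WithTop ℕ∞) ψ) :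
    CkConv U l k (fun n y => u n y + v n y) (fun y => φ y + ψ y) := by
  induction k generalizing u φ v ψ with
  | zero => exact TendstoUniformly.add h h'
  | succ k ih =>
    refine ⟨h.1.add h'.1, fun i => ?_⟩
    have key : ∀ {φ ψ : frontier U → F}, IsCk U ((k + 1 : ℕ) : WithTop ℕ∞) φ →
        IsCk U ((k + 1 : ℕ) : WithTop ℕ∞) ψ → tpartial U i (fun y => φ y + ψ y) =
          fun y => tpartial U i φ y + tpartial U i ψ y := fun {φ ψ} h1 h2 => by
      ext y
      simp [tpartial, tderiv_add (h1.of_le (one_le_natCast_succ k))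
        (h2.of_le (one_le_natCast_succ k))]
    rw [key hφ hψ]
    refine (ih (h.2 i) (h'.2 i) (hu.mono fun n hn => hn.tpartial_nat hM i) (hφ.tpartial_nat hM i)
      (hv.mono fun n hn => hn.tpartial_nat hM i) (hψ.tpartial_nat hM i)).congr ?_
    filter_upwards [hu, hv] with n h1 h2
    rw [key h1 h2]

theorem CkConv.bilin [CompactSpace (frontier U)] {k : ℕ}
    {u : ι → frontier U → F} {φ : frontier U → F}
    {v : ι → frontier U → G} {ψ : frontier U → G} (hM : IsHypersurface (frontier U))
    (h : CkConv U l k u φ) (h' : CkConv U l k v ψ)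
    (hu : ∀ᶠ n in l, IsCk U (k : WithTop ℕ∞) (u n)) (hφ : IsCk U (k : WithTop ℕ∞) φ)
    (hv : ∀ᶠ n in l, IsCk U (k : WithTop ℕ∞) (v n)) (hψ : IsCk U (k : WithTop ℕ∞) ψ)
    (B : F →L[ℝ] G →L[ℝ] H) :
    CkConv U l k (fun n y => B (u n y) (v n y)) (fun y => B (φ y) (ψ y)) := by
  have h0 : TendstoUniformly (fun n y => B (u n y) (v n y)) (fun y => B (φ y) (ψ y)) l :=
    tendstoUniformly_comp (f := fun p : F × G => B p.1 p.2)
      (tendstoUniformly_prodMk h.tendstoUniformly h'.tendstoUniformly)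
      (hφ.continuous.prodMk hψ.continuous)
      (fun y => B.isBoundedBilinearMap.continuous.continuousAt)
  induction k generalizing u φ v ψ with
  | zero => exact h0
  | succ k ih =>
    refine ⟨h0, fun i => ?_⟩
    have key : ∀ {φ : frontier U → F} {ψ : frontier U → G},
        IsCk U ((k + 1 : ℕ) : WithTop ℕ∞) φ → IsCk U ((k + 1 : ℕ) : WithTop ℕ∞) ψ →
        tpartial U i (fun y => B (φ y) (ψ y)) =
          fun y => B (tpartial U i φ y) (ψ y) + B (φ y) (tpartial U i ψ y) := fun {φ ψ} h1 h2 =>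
      tpartial_bilin (h1.of_le (one_le_natCast_succ k)) (h2.of_le (one_le_natCast_succ k)) B i
    have hu' := hu.mono fun n hn => hn.tpartial_nat hM i
    have hv' := hv.mono fun n hn => hn.tpartial_nat hM i
    have hφ' := hφ.tpartial_nat hM i
    have hψ' := hψ.tpartial_nat hM i
    have hu0 := hu.mono fun n hn => hn.of_le (natCast_le_succ k)
    have hv0 := hv.mono fun n hn => hn.of_le (natCast_le_succ k)
    have hφ0 := hφ.of_le (natCast_le_succ k)
    have hψ0 := hψ.of_le (natCast_le_succ k)
    rw [key hφ hψ]
    have hunif : ∀ {u : ι → frontier U → F} {φ : frontier U → F}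
        {v : ι → frontier U → G} {ψ : frontier U → G}, CkConv U l k u φ → CkConv U l k v ψ →
        Continuous φ → Continuous ψ →
        TendstoUniformly (fun n y => B (u n y) (v n y)) (fun y => B (φ y) (ψ y)) l :=
      fun {u φ v ψ} a b c e => tendstoUniformly_comp (f := fun p : F × G => B p.1 p.2)
        (tendstoUniformly_prodMk a.tendstoUniformly b.tendstoUniformly)
        (c.prodMk e) (fun y => B.isBoundedBilinearMap.continuous.continuousAt)
    refine ((ih (h.2 i) h'.pred hu' hφ' hv0 hψ0
        (hunif (h.2 i) h'.pred hφ'.continuous hψ0.continuous)).add hM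
      (ih h.pred (h'.2 i) hu0 hφ0 hv' hψ'
        (hunif h.pred (h'.2 i) hφ0.continuous hψ'.continuous)) ?_ (hφ'.bilin hψ0 B) ?_
        (hφ0.bilin hψ' B)).congr ?_
    · filter_upwards [hu', hv0] with n h1 h2 using h1.bilin h2 B
    · filter_upwards [hu0, hv'] with n h1 h2 using h1.bilin h2 B
    · filter_upwards [hu, hv] with n h1 h2
      rw [key h1 h2]

theorem CkConv.clm_comp [CompactSpace (frontier U)] {k : ℕ}
    {u : ι → frontier U → F} {φ : frontier U → F} (hM : IsHypersurface (frontier U))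
    (h : CkConv U l k u φ)
    (hu : ∀ᶠ n in l, IsCk U (k : WithTop ℕ∞) (u n)) (hφ : IsCk U (k : WithTop ℕ∞) φ)
    (L : F →L[ℝ] G) : CkConv U l k (fun n y => L (u n y)) (fun y => L (φ y)) :=
  CkConv.bilin hM (ckConv_const k (fun _ => L)) h (.of_forall fun _ => isCk_const L)
    (isCk_const L) hu hφ (ContinuousLinearMap.id ℝ (F →L[ℝ] G))

theorem CkConv.sum {κ : Type*} (s : Finset κ) {k : ℕ}
    {u : κ → ι → frontier U → F} {φ : κ → frontier U → F} (hM : IsHypersurface (frontier U))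
    (h : ∀ i, CkConv U l k (u i) (φ i))
    (hu : ∀ i, ∀ᶠ n in l, IsCk U (k : WithTop ℕ∞) (u i n))
    (hφ : ∀ i, IsCk U (k : WithTop ℕ∞) (φ i)) :
    CkConv U l k (fun n y => ∑ i ∈ s, u i n y) (fun y => ∑ i ∈ s, φ i y) := by
  classical
  induction s using Finset.induction_on with
  | empty => simpa using ckConv_const k (fun _ => (0 : F))
  | insert a s ha ih =>
    simp only [Finset.sum_insert ha]
    refine (h a).add hM ih (hu a) (hφ a) ?_ (IsCk.sum s fun i _ => hφ i)
    have : ∀ᶠ n in l, ∀ i ∈ s, IsCk U (k : WithTop ℕ∞) (u i n) :=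
      (Finset.eventually_all s).2 fun i _ => hu i
    exact this.mono fun n hn => IsCk.sum s hn

theorem CkConv.tderiv [CompactSpace (frontier U)] {k : ℕ}
    {u : ι → frontier U → F} {φ : frontier U → F} (hM : IsHypersurface (frontier U))
    (h : CkConv U l (k + 1) u φ)
    (hu : ∀ᶠ n in l, IsCk U ((k + 1 : ℕ) : WithTop ℕ∞) (u n))
    (hφ : IsCk U ((k + 1 : ℕ) : WithTop ℕ∞) φ) :
    CkConv U l k (fun n => tderiv U (u n)) (tderiv U φ) := by
  have key : ∀ φ : frontier U → F, GrowthFlow.tderiv U φ =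
      fun y => ∑ i, ofColumns d F i (tpartial U i φ y) := fun φ => funext (tderiv_eq_sum φ)
  rw [key φ]
  simp only [key]
  exact CkConv.sum (u := fun i n y => ofColumns d F i (tpartial U i (u n) y))
    (φ := fun i y => ofColumns d F i (tpartial U i φ y)) _ hM
    (fun i => (h.2 i).clm_comp hM (hu.mono fun n hn => hn.tpartial_nat hM i)
      (hφ.tpartial_nat hM i) _)
    (fun i => hu.mono fun n hn => (hn.tpartial_nat hM i).clm_comp _)
    (fun i => (hφ.tpartial_nat hM i).clm_comp _)

theorem CkConv.ringInverse [CompactSpace (frontier U)] {k : ℕ}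
    {u : ι → frontier U → (Euc d →L[ℝ] Euc d)} {φ : frontier U → (Euc d →L[ℝ] Euc d)}
    (hM : IsHypersurface (frontier U)) (h : CkConv U l k u φ)
    (hu : ∀ᶠ n in l, IsCk U (k : WithTop ℕ∞) (u n) ∧ ∀ y, IsUnit (u n y))
    (hφ : IsCk U (k : WithTop ℕ∞) φ) (hφu : ∀ y, IsUnit (φ y)) :
    CkConv U l k (fun n y => Ring.inverse (u n y)) (fun y => Ring.inverse (φ y)) := by
  have h0 : TendstoUniformly (fun n y => Ring.inverse (u n y)) (fun y => Ring.inverse (φ y)) l :=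
    tendstoUniformly_comp h.tendstoUniformly hφ.continuous fun y => by
      obtain ⟨r, hr⟩ := hφu y
      rw [← hr]
      exact NormedRing.inverse_continuousAt r
  induction k with
  | zero => exact h0
  | succ k ih =>
    refine ⟨h0, fun i => ?_⟩
    have hu0 := hu.mono fun n hn =>
      (⟨hn.1.of_le (natCast_le_succ k), hn.2⟩ : IsCk U (k : WithTop ℕ∞) (u n) ∧ _)
    have hφ0 := hφ.of_le (natCast_le_succ k)
    have hinv := ih h.pred hu0 hφ0
    have hu1 := hu.mono fun n hn => hn.1.tpartial_nat hM i
    have hφ1 := hφ.tpartial_nat hM i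
    have hu2 := hu0.mono fun n hn => IsCk.ringInverse hn.1 hn.2
    have hφ2 := IsCk.ringInverse hφ0 hφu
    let B := ContinuousLinearMap.compL ℝ (Euc d) (Euc d) (Euc d)
    have h1 := CkConv.bilin hM hinv (h.2 i) hu2 hφ2 hu1 hφ1 B
    have hu3 : ∀ᶠ n in l, IsCk U (k : WithTop ℕ∞)
        (fun y => B (Ring.inverse (u n y)) (tpartial U i (u n) y)) := by
      filter_upwards [hu1, hu2] with n a b using b.bilin a B
    have h2 := CkConv.bilin hM h1 hinv hu3 (hφ2.bilin hφ1 B) hu2 hφ2 (-B)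
    rw [tpartial_ringInverse (hφ.of_le (one_le_natCast_succ k)) hφu i]
    refine h2.congr ?_
    filter_upwards [hu] with n hn
    rw [tpartial_ringInverse (hn.1.of_le (one_le_natCast_succ k)) hn.2 i]
    rfl

theorem ckNorm_zero_le_iff {φ : frontier U → F} {c : ℝ≥0∞} :
    ckNorm U 0 φ ≤ c ↔ ∀ y, ‖φ y‖ₑ ≤ c := by
  simp only [ckNorm, iSup_le_iff, Nat.le_zero, List.length_eq_zero_iff]
  exact ⟨fun h => h [] rfl, fun h J hJ => by rw [hJ]; exact h⟩

theorem ckNorm_succ_le_iff {k : ℕ} {φ : frontier U → F} {c : ℝ≥0∞} :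
    ckNorm U (k + 1) φ ≤ c ↔ (∀ y, ‖φ y‖ₑ ≤ c) ∧ ∀ i, ckNorm U k (tpartial U i φ) ≤ c := by
  simp only [ckNorm, iSup_le_iff]
  constructor
  · refine fun h => ⟨h [] (by simp), fun i J hJ y => ?_⟩
    have := h (J ++ [i]) (by simpa using hJ) y
    simpa [tpartials] using this
  · rintro ⟨h1, h2⟩ J hJ
    rcases List.eq_nil_or_concat J with rfl | ⟨J', i, rfl⟩
    · exact h1
    · have := h2 i J' (by simpa using hJ)
      simpa [tpartials] using this

/-- Convergence in `C^k` is convergence with respect to the norm `ckNorm`. -/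
theorem ckConv_iff {k : ℕ} {u : ι → frontier U → F} {φ : frontier U → F}
    (hM : IsHypersurface (frontier U)) (hu : ∀ᶠ n in l, IsCk U (k : WithTop ℕ∞) (u n))
    (hφ : IsCk U (k : WithTop ℕ∞) φ) :
    CkConv U l k u φ ↔ Tendsto (fun n => ckNorm U k (fun y => u n y - φ y)) l (𝓝 0) := by
  rw [ENNReal.tendsto_nhds_zero]
  induction k generalizing u φ with
  | zero =>
    simp only [ckNorm_zero_le_iff]
    exact tendstoUniformly_iff_enorm_sub
  | succ k ih =>
    have key : ∀ i, ∀ᶠ n in l, tpartial U i (fun y => u n y - φ y) =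
        fun y => tpartial U i (u n) y - tpartial U i φ y := fun i => hu.mono fun n hn =>
      tpartial_sub (hn.of_le (one_le_natCast_succ k)) (hφ.of_le (one_le_natCast_succ k)) i
    have ih' := fun i => ih (hu.mono fun n hn => hn.tpartial_nat hM i) (hφ.tpartial_nat hM i)
    simp only [ckNorm_succ_le_iff, CkConv, ih', tendstoUniformly_iff_enorm_sub, gt_iff_lt]
    constructor
    · rintro ⟨h1, h2⟩ ε hε
      refine (h1 ε hε).and (eventually_all.2 fun i => ?_)
      filter_upwards [h2 i ε hε, key i] with n hn hn'
      rwa [hn']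
    · refine fun h => ⟨fun ε hε => (h ε hε).mono fun n hn => hn.1, fun i ε hε => ?_⟩
      filter_upwards [h ε hε, key i] with n hn hn'
      rw [← hn']
      exact hn.2 i

end Convergence

section InverseJacobian

variable {U : Set (Euc d)} {ι : Type*} {l : Filter ι}

/-- The differential of `φ` is injective on every tangent space. -/
def IsImmersion (U : Set (Euc d)) (φ : frontier U → F) : Prop :=
  ∀ y : frontier U, ∀ v ∈ tangentSpace U y, tderiv U φ y v = 0 → v = 0

/-- Passing to the adjoint, as a continuous real linear map. -/
def adjointCLM (d : ℕ) : (Euc d →L[ℝ] Euc d) →L[ℝ] (Euc d →L[ℝ] Euc d) :=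
  LinearMap.mkContinuous
    { toFun := fun A => ContinuousLinearMap.adjoint A
      map_add' := fun A B => map_add _ A B
      map_smul' := fun c A => by simp } 1 fun A => by simp

/-- The operator `Aᵀ A + (1 - P)` with `A = dφ(y)`. -/
def gramOperator (U : Set (Euc d)) (φ : frontier U → Euc d) (y : frontier U) :
    Euc d →L[ℝ] Euc d :=
  ContinuousLinearMap.compL ℝ (Euc d) (Euc d) (Euc d) (adjointCLM d (tderiv U φ y)) (tderiv U φ y)
    + (1 - tangentProj U y)

theorem invJac_eq (U : Set (Euc d)) (φ : frontier U → Euc d) (y : frontier U) :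
    invJac U φ y = ContinuousLinearMap.compL ℝ (Euc d) (Euc d) (Euc d)
      (Ring.inverse (gramOperator U φ y)) (adjointCLM d (tderiv U φ y)) := rfl

theorem isUnit_of_injective {R : Euc d →L[ℝ] Euc d} (h : ∀ v, R v = 0 → v = 0) : IsUnit R := by
  have hinj : Function.Injective R := (injective_iff_map_eq_zero R).2 h
  have hb : Function.Bijective R :=
    ⟨hinj, LinearMap.surjective_of_injective (f := R.toLinearMap) hinj⟩
  exact ContinuousLinearMap.isUnit_iff_bijective.2 hb

theorem IsImmersion.isUnit_gramOperator {φ : frontier U → Euc d} (h : IsImmersion U φ)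
    (y : frontier U) : IsUnit (gramOperator U φ y) := by
  refine isUnit_of_injective fun v hv => ?_
  set A := tderiv U φ y with hA
  set P := tangentProj U y with hP
  have h1 : inner ℝ (gramOperator U φ y v) v = ‖A v‖ ^ 2 + ‖v - P v‖ ^ 2 := by
    have e1 : gramOperator U φ y v = ContinuousLinearMap.adjoint A (A v) + (v - P v) := rfl
    have e2 : inner ℝ (v - P v) (P v) = 0 := by
      rw [hP, tangentProj]
      exact Submodule.starProjection_inner_eq_zero v _ (Submodule.starProjection_apply_mem _ _)
    have e3 : inner ℝ (v - P v) v = ‖v - P v‖ ^ 2 := by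
      conv_lhs => rw [show v = (v - P v) + P v by abel]
      rw [inner_add_right]
      simp only [sub_add_cancel]
      rw [e2, add_zero, real_inner_self_eq_norm_sq]
    rw [e1, inner_add_left, ContinuousLinearMap.adjoint_inner_left, real_inner_self_eq_norm_sq, e3]
  rw [hv, inner_zero_left] at h1
  have h2 : ‖A v‖ = 0 := by nlinarith [sq_nonneg ‖A v‖, sq_nonneg ‖v - P v‖]
  have h3 : ‖v - P v‖ = 0 := by nlinarith [sq_nonneg ‖A v‖, sq_nonneg ‖v - P v‖]
  have h4 : v = P v := sub_eq_zero.1 (norm_eq_zero.1 h3)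
  refine h y v ?_ (norm_eq_zero.1 h2)
  rw [h4]
  exact tangentProj_mem U y v

/-- `invJac` is a left inverse of the differential on the tangent space. -/
theorem IsImmersion.invJac_comp {φ : frontier U → Euc d} (h : IsImmersion U φ)
    (hφ : IsCk U 1 φ) (y : frontier U) :
    (invJac U φ y).comp (tderiv U φ y) = tangentProj U y := by
  have hu := h.isUnit_gramOperator y
  have h1 : gramOperator U φ y * tangentProj U y =
      (ContinuousLinearMap.adjoint (tderiv U φ y)).comp (tderiv U φ y) := by
    have e := hφ.tderiv_comp_tangentProj y
    ext1 v
    have e' : tderiv U φ y (tangentProj U y v) = tderiv U φ y v := DFunLike.congr_fun e v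
    change ContinuousLinearMap.adjoint (tderiv U φ y) (tderiv U φ y (tangentProj U y v)) +
      (tangentProj U y v - tangentProj U y (tangentProj U y v)) = _
    rw [e', tangentProj_eq_self (tangentProj_mem U y v), sub_self, add_zero]
    rfl
  calc (invJac U φ y).comp (tderiv U φ y)
      = Ring.inverse (gramOperator U φ y) *
        ((ContinuousLinearMap.adjoint (tderiv U φ y)).comp (tderiv U φ y)) := rfl
    _ = tangentProj U y := by rw [← h1, ← mul_assoc, Ring.inverse_mul_cancel _ hu, one_mul]

theorem IsCk.gramOperator (hM : IsHypersurface (frontier U)) {k : ℕ} {φ : frontier U → Euc d}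
    (hφ : IsCk U ((k + 1 : ℕ) : WithTop ℕ∞) φ) :
    IsCk U (k : WithTop ℕ∞) (gramOperator U φ) :=
  (((hφ.tderiv_nat hM).clm_comp (adjointCLM d)).bilin (hφ.tderiv_nat hM) _).add
    ((isCk_const 1).sub (hM.isCk_tangentProj.of_le (by exact_mod_cast le_top)))

theorem IsCk.invJac (hM : IsHypersurface (frontier U)) {k : ℕ} {φ : frontier U → Euc d}
    (hφ : IsCk U ((k + 1 : ℕ) : WithTop ℕ∞) φ) (h : IsImmersion U φ) :
    IsCk U (k : WithTop ℕ∞) (invJac U φ) := by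
  rw [show GrowthFlow.invJac U φ = _ from funext (invJac_eq U φ)]
  exact (IsCk.ringInverse (IsCk.gramOperator hM hφ) h.isUnit_gramOperator).bilin
    ((hφ.tderiv_nat hM).clm_comp (adjointCLM d)) _

theorem CkConv.invJac [CompactSpace (frontier U)] {k : ℕ}
    {u : ι → frontier U → Euc d} {φ : frontier U → Euc d} (hM : IsHypersurface (frontier U))
    (h : CkConv U l (k + 1) u φ)
    (hu : ∀ᶠ n in l, IsCk U ((k + 1 : ℕ) : WithTop ℕ∞) (u n) ∧ IsImmersion U (u n))
    (hφ : IsCk U ((k + 1 : ℕ) : WithTop ℕ∞) φ) (hφi : IsImmersion U φ) :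
    CkConv U l k (fun n => invJac U (u n)) (invJac U φ) := by
  have h1 := CkConv.tderiv hM h (hu.mono fun n hn => hn.1) hφ
  have hu1 := hu.mono fun n hn => hn.1.tderiv_nat hM
  have hφ1 := hφ.tderiv_nat hM
  have h2 := h1.clm_comp hM hu1 hφ1 (adjointCLM d)
  have hu2 := hu1.mono fun n hn => hn.clm_comp (adjointCLM d)
  have hφ2 := hφ1.clm_comp (adjointCLM d)
  have h3 := CkConv.bilin hM h2 h1 hu2 hφ2 hu1 hφ1
    (ContinuousLinearMap.compL ℝ (Euc d) (Euc d) (Euc d))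
  have hP : IsCk U (k : WithTop ℕ∞) (fun y : frontier U => 1 - tangentProj U y) :=
    (isCk_const 1).sub (hM.isCk_tangentProj.of_le (by exact_mod_cast le_top))
  have h4 : CkConv U l k (fun n => gramOperator U (u n)) (gramOperator U φ) :=
    h3.add hM (ckConv_const k fun y : frontier U => 1 - tangentProj U y)
      (by filter_upwards [hu1, hu2] with n a b using b.bilin a _) (hφ2.bilin hφ1 _)
      (.of_forall fun _ => hP) hP
  have hu4 := hu.mono fun n hn =>
    (⟨IsCk.gramOperator hM hn.1, hn.2.isUnit_gramOperator⟩ :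
      IsCk U (k : WithTop ℕ∞) (gramOperator U (u n)) ∧ ∀ y, IsUnit (gramOperator U (u n) y))
  have h5 := CkConv.ringInverse hM h4 hu4 (IsCk.gramOperator hM hφ) hφi.isUnit_gramOperator
  exact CkConv.bilin hM h5 h2 (hu4.mono fun n hn => IsCk.ringInverse hn.1 hn.2)
    (IsCk.ringInverse (IsCk.gramOperator hM hφ) hφi.isUnit_gramOperator) hu2 hφ2
    (ContinuousLinearMap.compL ℝ (Euc d) (Euc d) (Euc d))

/-- For immersions, convergence in the metric `ckDist` follows from convergence in `C^k`: the
inverse Jacobians converge automatically. -/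
theorem CkConv.tendsto_ckDist [CompactSpace (frontier U)] {k : ℕ}
    {u : ι → frontier U → Euc d} {φ : frontier U → Euc d} (hM : IsHypersurface (frontier U))
    (h : CkConv U l (k + 1) u φ)
    (hu : ∀ᶠ n in l, IsCk U ((k + 1 : ℕ) : WithTop ℕ∞) (u n) ∧ IsImmersion U (u n))
    (hφ : IsCk U ((k + 1 : ℕ) : WithTop ℕ∞) φ) (hφi : IsImmersion U φ) :
    Tendsto (fun n => ckDist U (k + 1) (u n) φ) l (𝓝 0) := by
  have h1 := (ckConv_iff hM (hu.mono fun n hn => hn.1) hφ).1 h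
  have h2 := (ckConv_iff hM (hu.mono fun n hn => IsCk.invJac hM hn.1 hn.2)
    (IsCk.invJac hM hφ hφi)).1 (CkConv.invJac hM h hu hφ hφi)
  simpa [ckDist] using h1.add h2

theorem ckConv_of_tendsto_ckDist {k : ℕ}
    {u : ι → frontier U → Euc d} {φ : frontier U → Euc d} (hM : IsHypersurface (frontier U))
    (hu : ∀ᶠ n in l, IsCk U (k : WithTop ℕ∞) (u n)) (hφ : IsCk U (k : WithTop ℕ∞) φ)
    (h : Tendsto (fun n => ckDist U k (u n) φ) l (𝓝 0)) : CkConv U l k u φ := by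
  rw [ckConv_iff hM hu hφ]
  exact tendsto_of_tendsto_of_tendsto_of_le_of_le tendsto_const_nhds h (fun _ => zero_le)
    (fun _ => le_self_add)

end InverseJacobian

/-! ### Lipschitz bounds on the hypersurface -/

section LipschitzBounds

variable {U : Set (Euc d)} {ι : Type*} {l : Filter ι} {E : Type*} [NormedAddCommGroup E]

/-- `X` is Lipschitz with constant `L`, for the chordal distance on `∂U`. -/
def HasLipBound (U : Set (Euc d)) (L : ℝ) (X : frontier U → E) : Prop :=
  ∀ y z : frontier U, ‖X y - X z‖ ≤ L * dist y z

/-- `φ` expands the chordal distance on `∂U` at least by the factor `c`. -/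
def HasLowerBound (U : Set (Euc d)) (c : ℝ) (φ : frontier U → E) : Prop :=
  ∀ y z : frontier U, c * dist y z ≤ ‖φ y - φ z‖

theorem HasLowerBound.injective {c : ℝ} {φ : frontier U → E} (h : HasLowerBound U c φ)
    (hc : 0 < c) : Function.Injective φ := by
  intro y z hyz
  have h1 := h y z
  rw [hyz, sub_self, norm_zero] at h1
  have h2 : dist y z ≤ 0 := by nlinarith [dist_nonneg (x := y) (y := z)]
  exact dist_le_zero.1 h2

theorem HasLowerBound.perturb {c L : ℝ} {φ ψ : frontier U → E} (h : HasLowerBound U c φ)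
    (h' : HasLipBound U L (fun y => ψ y - φ y)) : HasLowerBound U (c - L) ψ := by
  intro y z
  have h1 := h y z
  have h2 := h' y z
  have h3 : φ y - φ z = (ψ y - ψ z) - ((ψ y - φ y) - (ψ z - φ z)) := by abel
  have h4 := norm_sub_le (ψ y - ψ z) ((ψ y - φ y) - (ψ z - φ z))
  rw [← h3] at h4
  linarith

/-- On tangent vectors `tderiv` is the limit of difference quotients along the hypersurface. -/
theorem exists_difference_quotients (hM : IsHypersurface (frontier U)) {φ : frontier U → F}
    (hφ : IsCk U 1 φ) (y : frontier U) {v : Euc d} (hv : v ∈ tangentSpace U y) :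
    ∃ (α : Type) (l : Filter α) (_ : l.NeBot) (c : α → ℝ) (z : α → frontier U),
      Tendsto (fun n => c n • ((z n : Euc d) - y)) l (𝓝 v) ∧
      Tendsto (fun n => c n • (φ (z n) - φ y)) l (𝓝 (tderiv U φ y v)) := by
  obtain ⟨g, hg, h⟩ := hφ
  have hd := hg.differentiable (by simp) (y : Euc d)
  have hv' : v ∈ tangentConeAt ℝ (frontier U) (y : Euc d) := by
    rw [← hM.tangentSpace_eq_tangentCone]; exact hv
  rw [mem_tangentConeAt_iff_exists_seq] at hv'
  obtain ⟨c, e, he, hmem, hlim⟩ := hv'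
  have hlim' := hd.hasFDerivAt.hasFDerivWithinAt.lim he hmem hlim
  classical
  let z : ℕ → frontier U := fun n =>
    if hn : (y : Euc d) + e n ∈ frontier U then ⟨(y : Euc d) + e n, hn⟩ else y
  have hz : ∀ᶠ n in atTop, (z n : Euc d) = y + e n := by
    filter_upwards [hmem] with n hn
    simp [z, hn]
  refine ⟨ℕ, atTop, inferInstance, c, z, hlim.congr' ?_, ?_⟩
  · filter_upwards [hz] with n hn
    rw [hn, add_sub_cancel_left]
  · rw [tderiv_eq h hd]
    simp only [ContinuousLinearMap.comp_apply]
    rw [tangentProj_eq_self hv]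
    refine hlim'.congr' ?_
    filter_upwards [hz] with n hn
    rw [← hn, h, h]

theorem HasLowerBound.le_norm_tderiv (hM : IsHypersurface (frontier U)) {φ : frontier U → F}
    (hφ : IsCk U 1 φ) {c : ℝ} (h : HasLowerBound U c φ) (y : frontier U) {v : Euc d}
    (hv : v ∈ tangentSpace U y) : c * ‖v‖ ≤ ‖tderiv U φ y v‖ := by
  obtain ⟨α, l, hl, a, z, h1, h2⟩ := exists_difference_quotients hM hφ y hv
  refine le_of_tendsto_of_tendsto' (h1.norm.const_mul c) h2.norm fun n => ?_
  rw [norm_smul, norm_smul]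
  have := mul_le_mul_of_nonneg_left (h (z n) y) (norm_nonneg (a n))
  rw [Subtype.dist_eq, dist_eq_norm] at this
  linarith

theorem HasLowerBound.isImmersion (hM : IsHypersurface (frontier U)) {φ : frontier U → F}
    (hφ : IsCk U 1 φ) {c : ℝ} (hc : 0 < c) (h : HasLowerBound U c φ) : IsImmersion U φ := by
  intro y v hv h0
  have := h.le_norm_tderiv hM hφ y hv
  rw [h0, norm_zero] at this
  exact norm_le_zero_iff.1 (by nlinarith [norm_nonneg v])

theorem HasLipBound.norm_tderiv_le (hM : IsHypersurface (frontier U)) {φ : frontier U → F}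
    (hφ : IsCk U 1 φ) {L : ℝ} (hL : 0 ≤ L) (h : HasLipBound U L φ) (y : frontier U) :
    ‖tderiv U φ y‖ ≤ L := by
  refine ContinuousLinearMap.opNorm_le_bound _ hL fun v => ?_
  have e : tderiv U φ y (tangentProj U y v) = tderiv U φ y v :=
    DFunLike.congr_fun (hφ.tderiv_comp_tangentProj y) v
  obtain ⟨α, l, hl, a, z, h1, h2⟩ :=
    exists_difference_quotients hM hφ y (tangentProj_mem U y v)
  rw [e] at h2
  have h3 : ‖tderiv U φ y v‖ ≤ L * ‖tangentProj U y v‖ := by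
    refine le_of_tendsto_of_tendsto' h2.norm (h1.norm.const_mul L) fun n => ?_
    rw [norm_smul, norm_smul]
    have := mul_le_mul_of_nonneg_left (h (z n) y) (norm_nonneg (a n))
    rw [Subtype.dist_eq, dist_eq_norm] at this
    linarith
  refine h3.trans (mul_le_mul_of_nonneg_left ?_ hL)
  exact (ContinuousLinearMap.le_opNorm _ _).trans
    ((mul_le_mul_of_nonneg_right (norm_tangentProj_le U y) (norm_nonneg v)).trans (one_mul _).le)

theorem exists_local_lipBound (hM : IsHypersurface (frontier U)) (p : frontier U) :
    ∃ V ∈ 𝓝 (p : Euc d), ∃ C : ℝ, 0 ≤ C ∧ ∀ X : frontier U → F, IsCk U 1 X → ∀ ε : ℝ, 0 ≤ ε →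
      (∀ y, ‖tderiv U X y‖ ≤ ε) → ∀ y z : frontier U, (y : Euc d) ∈ V → (z : Euc d) ∈ V →
        ‖X y - X z‖ ≤ C * ε * dist y z := by
  obtain ⟨f, hf⟩ := hM p p.2
  obtain ⟨χ⟩ := hf.exists_chart
  set N := unitGradient f p with hN
  set κ := χ.toChart.symm with hκ
  have h1 : ∀ᶠ x in 𝓝 (p : Euc d), ContDiffAt ℝ 1 κ x := χ.symm_contDiffAt.eventually (by simp)
  have h2 : ∀ᶠ x in 𝓝 (p : Euc d), ‖fderiv ℝ κ x‖ < 2 := by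
    have hc : ContinuousAt (fderiv ℝ κ) (p : Euc d) :=
      (χ.symm_contDiffAt.fderiv_right (m := 0) (by simp)).continuousAt
    have : ‖fderiv ℝ κ (p : Euc d)‖ < 2 := by
      rw [χ.symm_hasFDerivAt.fderiv]
      exact lt_of_le_of_lt ContinuousLinearMap.norm_id_le (by norm_num)
    exact hc.norm.eventually (gt_mem_nhds this)
  obtain ⟨r, hr, hball⟩ := Metric.eventually_nhds_iff_ball.1
    ((h1.and h2).and (χ.toChart.open_target.mem_nhds χ.mem_target))
  obtain ⟨K, t, ht, hK⟩ :=
    ((χ.contDiff.of_le (by simp)).contDiffAt (x := (p : Euc d))).exists_lipschitzOnWith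
  have hV : t ∩ (χ.toChart.source ∩ χ.toChart ⁻¹' Metric.ball (p : Euc d) r) ∈ 𝓝 (p : Euc d) := by
    refine inter_mem ht (inter_mem (χ.toChart.open_source.mem_nhds χ.mem_source) ?_)
    refine χ.contDiff.continuous.continuousAt.preimage_mem_nhds ?_
    rw [χ.apply_eq]
    exact Metric.ball_mem_nhds _ hr
  refine ⟨_, hV, 2 * K, by positivity, fun X hX ε hε hbd y z hy hz => ?_⟩
  obtain ⟨g, hg, h⟩ := hX
  set a := χ.toChart y with ha
  set b := χ.toChart z with hb
  have haN : inner ℝ N (a - p) = 0 := (χ.mem_iff _ hy.2.1).1 y.2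
  have hbN : inner ℝ N (b - p) = 0 := (χ.mem_iff _ hz.2.1).1 z.2
  have hbaN : inner ℝ N (b - a) = 0 := by
    rw [show b - a = (b - p) - (a - p) by abel, inner_sub_right, haN, hbN, sub_zero]
  have hdist : ‖b - a‖ ≤ K * dist y z := by
    rw [← dist_eq_norm, dist_comm]
    exact hK.dist_le_mul _ hy.1 _ hz.1
  let γ : ℝ → Euc d := fun s => a + s • (b - a)
  have hγ : ∀ s ∈ Icc (0 : ℝ) 1, γ s ∈ Metric.ball (p : Euc d) r := fun s hs =>
    (convex_ball (p : Euc d) r).add_smul_sub_mem hy.2.2 hz.2.2 hs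
  have hγd : ∀ s, HasDerivAt γ (b - a) s := fun s => by
    simpa [γ] using ((hasDerivAt_id s).smul_const (b - a)).const_add a
  have hγN : ∀ s, inner ℝ N (γ s - p) = 0 := fun s => by
    rw [show γ s - p = (a - p) + s • (b - a) by simp only [γ]; abel, inner_add_right,
      real_inner_smul_right, haN, hbaN]
    simp
  have hderiv : ∀ s ∈ Icc (0 : ℝ) 1, HasDerivWithinAt (fun s => g (κ (γ s)))
      (fderiv ℝ g (κ (γ s)) (fderiv ℝ κ (γ s) (b - a))) (Icc 0 1) s := fun s hs => by
    have hb1 := hball _ (hγ s hs)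
    have e1 := (hb1.1.1.differentiableAt (by simp)).hasFDerivAt.comp_hasDerivAt s (hγd s)
    have e2 := (hg.differentiable (by simp) (κ (γ s))).hasFDerivAt.comp_hasDerivAt s e1
    exact e2.hasDerivWithinAt
  have hbound : ∀ s ∈ Ico (0 : ℝ) 1,
      ‖fderiv ℝ g (κ (γ s)) (fderiv ℝ κ (γ s) (b - a))‖ ≤ 2 * K * ε * dist y z := by
    intro s hs
    have hs' := Ico_subset_Icc_self hs
    have hb1 := hball _ (hγ s hs')
    have hmem : κ (γ s) ∈ frontier U := (χ.symm_mem_iff hb1.2).2 (hγN s)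
    have htan := χ.fderiv_symm_mem_tangentCone hb1.2 (hγN s)
      (hb1.1.1.differentiableAt (by simp)) hbaN
    have htan' : fderiv ℝ κ (γ s) (b - a) ∈ tangentSpace U ⟨κ (γ s), hmem⟩ :=
      Submodule.subset_span htan
    have e1 : fderiv ℝ g (κ (γ s)) (fderiv ℝ κ (γ s) (b - a)) =
        tderiv U X ⟨κ (γ s), hmem⟩ (fderiv ℝ κ (γ s) (b - a)) := by
      rw [tderiv_eq h (hg.differentiable (by simp) _), ContinuousLinearMap.comp_apply,
        tangentProj_eq_self htan']
    rw [e1]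
    calc _ ≤ ‖tderiv U X ⟨κ (γ s), hmem⟩‖ * ‖fderiv ℝ κ (γ s) (b - a)‖ :=
          ContinuousLinearMap.le_opNorm _ _
      _ ≤ ε * (2 * (K * dist y z)) := by
          gcongr
          · exact hbd _
          · exact (ContinuousLinearMap.le_opNorm _ _).trans
              (mul_le_mul hb1.1.2.le hdist (norm_nonneg _) (by norm_num))
      _ = _ := by ring
  have := norm_image_sub_le_of_norm_deriv_le_segment_01' hderiv hbound
  have e0 : κ (γ 0) = y := by
    simp only [γ, zero_smul, add_zero]
    exact χ.toChart.left_inv hy.2.1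
  have e1 : κ (γ 1) = z := by
    simp only [γ, one_smul, add_sub_cancel]
    exact χ.toChart.left_inv hz.2.1
  rw [e0, e1, h, h] at this
  rwa [norm_sub_rev]

/-- On a compact hypersurface the Lipschitz constant for the chordal distance is controlled by the
`C^1` norm. -/
theorem exists_lipBound [CompactSpace (frontier U)] (hM : IsHypersurface (frontier U)) :
    ∃ C : ℝ, 0 < C ∧ ∀ X : frontier U → F, IsCk U 1 X → ∀ ε : ℝ, 0 ≤ ε →
      (∀ y, ‖X y‖ ≤ ε) → (∀ y, ‖tderiv U X y‖ ≤ ε) → HasLipBound U (C * ε) X := by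
  let p : Set (frontier U × frontier U) → Prop := fun s =>
    ∃ C : ℝ, 0 < C ∧ ∀ X : frontier U → F, IsCk U 1 X → ∀ ε : ℝ, 0 ≤ ε →
      (∀ y, ‖X y‖ ≤ ε) → (∀ y, ‖tderiv U X y‖ ≤ ε) →
        ∀ q ∈ s, ‖X q.1 - X q.2‖ ≤ C * ε * dist q.1 q.2
  have hp : p univ := by
    refine isCompact_univ.induction_on (p := p) ⟨1, one_pos, by simp⟩ ?_ ?_ ?_
    · rintro s t hst ⟨C, hC, h⟩
      exact ⟨C, hC, fun X hX ε hε h1 h2 q hq => h X hX ε hε h1 h2 q (hst hq)⟩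
    · rintro s t ⟨C, hC, h⟩ ⟨C', hC', h'⟩
      refine ⟨C + C', by positivity, fun X hX ε hε h1 h2 q hq => ?_⟩
      have hd : 0 ≤ ε * dist q.1 q.2 := by positivity
      rcases hq with hq | hq
      · have := h X hX ε hε h1 h2 q hq
        nlinarith
      · have := h' X hX ε hε h1 h2 q hq
        nlinarith
    · rintro ⟨a, b⟩ -
      by_cases hab : a = b
      · subst hab
        obtain ⟨V, hV, C, hC, h⟩ := exists_local_lipBound (F := F) hM a
        have hV' : Subtype.val ⁻¹' V ∈ 𝓝 a :=
          continuous_subtype_val.continuousAt.preimage_mem_nhds hV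
        refine ⟨_, mem_nhdsWithin_of_mem_nhds (prod_mem_nhds hV' hV'), C + 1, by positivity, ?_⟩
        intro X hX ε hε h1 h2 q hq
        have := h X hX ε hε h2 q.1 q.2 hq.1 hq.2
        have hd : 0 ≤ ε * dist q.1 q.2 := by positivity
        nlinarith
      · have hpos : 0 < dist a b := dist_pos.2 hab
        refine ⟨{q | dist a b / 2 < dist q.1 q.2}, mem_nhdsWithin_of_mem_nhds ?_,
          4 / dist a b, by positivity, ?_⟩
        · exact (continuous_dist.tendsto (a, b)).eventually (lt_mem_nhds (half_lt_self hpos))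
        · intro X hX ε hε h1 h2 q hq
          have h3 : ‖X q.1 - X q.2‖ ≤ 2 * ε :=
            (norm_sub_le _ _).trans (by linarith [h1 q.1, h1 q.2])
          have h4 : 4 / dist a b * ε * (dist a b / 2) = 2 * ε := by field_simp; ring
          rw [← h4] at h3
          exact h3.trans (mul_le_mul_of_nonneg_left (le_of_lt hq) (by positivity))
  obtain ⟨C, hC, h⟩ := hp
  exact ⟨C, hC, fun X hX ε hε h1 h2 y z => h X hX ε hε h1 h2 (y, z) (mem_univ _)⟩

theorem CkConv.eventually_hasLipBound [CompactSpace (frontier U)]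
    (hM : IsHypersurface (frontier U)) {k : ℕ}
    {u : ι → frontier U → F} {φ : frontier U → F} (h : CkConv U l (k + 1) u φ)
    (hu : ∀ᶠ n in l, IsCk U ((k + 1 : ℕ) : WithTop ℕ∞) (u n))
    (hφ : IsCk U ((k + 1 : ℕ) : WithTop ℕ∞) φ) {ε : ℝ} (hε : 0 < ε) :
    ∀ᶠ n in l, HasLipBound U ε (fun y => u n y - φ y) := by
  obtain ⟨C, hC, hbd⟩ := exists_lipBound (F := F) hM
  have h1 := Metric.tendstoUniformly_iff.1 h.tendstoUniformly (ε / C) (by positivity)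
  have h2 := Metric.tendstoUniformly_iff.1 (CkConv.tderiv hM h hu hφ).tendstoUniformly (ε / C)
    (by positivity)
  filter_upwards [h1, h2, hu] with n a b hn
  have hn1 := hn.of_le (one_le_natCast_succ k)
  have hφ1 := hφ.of_le (one_le_natCast_succ k)
  have := hbd _ (hn1.sub hφ1) (ε / C) (by positivity) (fun y => ?_) (fun y => ?_)
  · rwa [mul_div_cancel₀ _ hC.ne'] at this
  · rw [← dist_eq_norm, dist_comm]; exact (a y).le
  · rw [tderiv_sub hn1 hφ1, ← dist_eq_norm, dist_comm]; exact (b y).le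

/-- There is a unit vector orthogonal to the image of the tangent space, because the differential
(extended by zero) is not injective, hence not surjective. -/
theorem exists_unit_normal (hM : IsHypersurface (frontier U)) {φ : frontier U → Euc d}
    (hφ : IsCk U 1 φ) (y : frontier U) :
    ∃ ν : Euc d, ‖ν‖ = 1 ∧ ∀ v, inner ℝ ν (tderiv U φ y v) = 0 := by
  obtain ⟨f, hf⟩ := hM y y.2
  set N := unitGradient f y
  have hN : ‖N‖ = 1 := norm_unitGradient hf.fderiv_ne
  have h0 : tderiv U φ y N = 0 := by
    rw [← hφ.tderiv_comp_tangentProj y, ContinuousLinearMap.comp_apply, hf.tangentProj_apply,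
      real_inner_self_eq_norm_sq, hN, one_pow, one_smul, sub_self, map_zero]
  have hns : LinearMap.range (tderiv U φ y).toLinearMap ≠ ⊤ := by
    intro htop
    have hinj := LinearMap.injective_iff_surjective.2 (LinearMap.range_eq_top.1 htop)
    have : N = 0 := hinj (by simpa using h0)
    rw [this, norm_zero] at hN
    exact zero_ne_one hN
  have hne : (LinearMap.range (tderiv U φ y).toLinearMap)ᗮ ≠ ⊥ := fun hb =>
    hns ((Submodule.orthogonal_eq_bot_iff).1 hb)
  obtain ⟨w, hw, hw0⟩ := Submodule.exists_mem_ne_zero_of_ne_bot hne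
  refine ⟨‖w‖⁻¹ • w, ?_, fun v => ?_⟩
  · rw [norm_smul, norm_inv, norm_norm, inv_mul_cancel₀ (norm_ne_zero_iff.2 hw0)]
  · have : inner ℝ (tderiv U φ y v) w = 0 := (Submodule.mem_orthogonal _ w).1 hw _ ⟨v, rfl⟩
    rw [real_inner_smul_left, real_inner_comm, this, mul_zero]

/-- An immersion of the hypersurface extends, near each point, to a local diffeomorphism of the
ambient space. -/
theorem IsImmersion.exists_local_diffeo {φ : frontier U → Euc d} (h : IsImmersion U φ)
    (hM : IsHypersurface (frontier U)) (hφ : IsCk U 1 φ) {y : frontier U} {f : Euc d → ℝ}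
    (hf : IsLocalDefining (frontier U) f y) :
    ∃ (G : Euc d → Euc d) (G' : Euc d ≃L[ℝ] Euc d), ContDiff ℝ 1 G ∧
      HasStrictFDerivAt G (G' : Euc d →L[ℝ] Euc d) (y : Euc d) ∧
      ∀ᶠ z in 𝓝 (y : Euc d), ∀ hz : z ∈ frontier U, G z = φ ⟨z, hz⟩ := by
  obtain ⟨ν, hν, hνA⟩ := exists_unit_normal hM hφ y
  obtain ⟨g, hg, hgφ⟩ := hφ
  have hd := hg.differentiable (by simp) (y : Euc d)
  set N := unitGradient f y with hN
  have hNN : ‖N‖ = 1 := norm_unitGradient hf.fderiv_ne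
  set a := ‖gradient f (y : Euc d)‖ with ha
  have ha0 : a ≠ 0 := norm_ne_zero_iff.2 (gradient_ne_zero hf.fderiv_ne)
  -- the normal vector `N` is sent to the normal vector `ν` of the image
  set w := a⁻¹ • (ν - fderiv ℝ g y N) with hw
  let G : Euc d → Euc d := fun z => g z + f z • w
  have hG : ContDiff ℝ 1 G := hg.add ((hf.contDiff.of_le (by simp)).smul contDiff_const)
  have hGd : HasFDerivAt G (fderiv ℝ g y + (fderiv ℝ f y).smulRight w) (y : Euc d) :=
    hd.hasFDerivAt.add ((hf.contDiff.differentiable (by simp) _).hasFDerivAt.smul_const w)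
  have hGapp : ∀ v, (fderiv ℝ g y + (fderiv ℝ f y).smulRight w) v =
      tderiv U φ y v + inner ℝ N v • ν := by
    intro v
    have e1 : fderiv ℝ f (y : Euc d) v = a * inner ℝ N v := by
      rw [inner_unitGradient, ← mul_assoc, mul_inv_cancel₀ ha0, one_mul]
    have e2 : fderiv ℝ g (y : Euc d) v = tderiv U φ y v + inner ℝ N v • fderiv ℝ g y N := by
      rw [tderiv_eq hgφ hd, ContinuousLinearMap.comp_apply, hf.tangentProj_apply, map_sub,
        map_smul, sub_add_cancel]
    simp only [add_apply, ContinuousLinearMap.smulRight_apply]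
    rw [e1, e2, hw, smul_smul, mul_right_comm, mul_inv_cancel₀ ha0, one_mul, smul_sub]
    abel
  have hinj : ∀ v, (fderiv ℝ g y + (fderiv ℝ f y).smulRight w) v = 0 → v = 0 := by
    intro v hv
    rw [hGapp] at hv
    have e1 : inner ℝ N v = 0 := by
      have := congrArg (fun x => inner ℝ ν x) hv
      simpa [inner_add_right, hνA, real_inner_smul_right, real_inner_self_eq_norm_sq, hν] using this
    rw [e1, zero_smul, add_zero] at hv
    exact h y v (hf.mem_tangentSpace_iff.2 e1) hv
  obtain ⟨G', hG'⟩ := isUnit_of_injective hinj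
  refine ⟨G, ContinuousLinearEquiv.unitsEquiv ℝ (Euc d) G', hG, ?_, ?_⟩
  · have h1 : HasStrictFDerivAt G (fderiv ℝ G y) (y : Euc d) :=
      hG.contDiffAt.hasStrictFDerivAt (by simp)
    rw [hGd.fderiv, ← hG'] at h1
    exact h1
  · filter_upwards [hf.mem_iff] with z hz hzM
    simp only [G]
    rw [hz.1 hzM, zero_smul, add_zero]
    exact hgφ ⟨z, hzM⟩

theorem exists_lower_bound_of_equiv (G' : Euc d ≃L[ℝ] Euc d) :
    ∃ c : ℝ, 0 < c ∧ ∀ v, c * ‖v‖ ≤ ‖G' v‖ := by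
  refine ⟨(‖(G'.symm : Euc d →L[ℝ] Euc d)‖ + 1)⁻¹, by positivity, fun v => ?_⟩
  rw [inv_mul_le_iff₀ (by positivity)]
  have := (G'.symm : Euc d →L[ℝ] Euc d).le_opNorm (G' v)
  simp only [ContinuousLinearEquiv.coe_coe, ContinuousLinearEquiv.symm_apply_apply] at this
  nlinarith [norm_nonneg (G' v)]

/-- An injective `C^1` immersion of a compact hypersurface is bi-Lipschitz. -/
theorem IsImmersion.exists_hasLowerBound [CompactSpace (frontier U)] {φ : frontier U → Euc d}
    (h : IsImmersion U φ) (hM : IsHypersurface (frontier U)) (hφ : IsCk U 1 φ)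
    (hinj : Function.Injective φ) : ∃ c : ℝ, 0 < c ∧ HasLowerBound U c φ := by
  let p : Set (frontier U × frontier U) → Prop := fun s =>
    ∃ c : ℝ, 0 < c ∧ ∀ q ∈ s, c * dist q.1 q.2 ≤ ‖φ q.1 - φ q.2‖
  have hp : p univ := by
    refine isCompact_univ.induction_on (p := p) ⟨1, one_pos, by simp⟩ ?_ ?_ ?_
    · rintro s t hst ⟨c, hc, h⟩
      exact ⟨c, hc, fun q hq => h q (hst hq)⟩
    · rintro s t ⟨c, hc, h⟩ ⟨c', hc', h'⟩
      refine ⟨min c c', lt_min hc hc', fun q hq => ?_⟩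
      rcases hq with hq | hq
      · exact (mul_le_mul_of_nonneg_right (min_le_left _ _) dist_nonneg).trans (h q hq)
      · exact (mul_le_mul_of_nonneg_right (min_le_right _ _) dist_nonneg).trans (h' q hq)
    · rintro ⟨a, b⟩ -
      by_cases hab : a = b
      · subst hab
        obtain ⟨f, hf⟩ := hM a a.2
        obtain ⟨G, G', hG, hGd, hGφ⟩ := h.exists_local_diffeo hM hφ hf
        obtain ⟨c, hc, hcG⟩ := exists_lower_bound_of_equiv G'
        have h1 := hGd.isLittleO.def (half_pos hc)
        have h2 : ∀ᶠ q : Euc d × Euc d in 𝓝 ((a : Euc d), (a : Euc d)),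
            c / 2 * ‖q.1 - q.2‖ ≤ ‖G q.1 - G q.2‖ := by
          filter_upwards [h1] with q hq
          have e1 := hcG (q.1 - q.2)
          have e2 : G' (q.1 - q.2) = (G q.1 - G q.2) - (G q.1 - G q.2 - G' (q.1 - q.2)) := by abel
          have e3 := norm_sub_le (G q.1 - G q.2) (G q.1 - G q.2 - G' (q.1 - q.2))
          rw [← e2] at e3
          have e4 : ‖G q.1 - G q.2 - G' (q.1 - q.2)‖ ≤ c / 2 * ‖q.1 - q.2‖ := hq
          linarith
        have h3 : ∀ᶠ q : Euc d × Euc d in 𝓝 ((a : Euc d), (a : Euc d)),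
            (∀ hz : q.1 ∈ frontier U, G q.1 = φ ⟨q.1, hz⟩) ∧
            (∀ hz : q.2 ∈ frontier U, G q.2 = φ ⟨q.2, hz⟩) := by
          rw [nhds_prod_eq]
          exact (tendsto_fst.eventually hGφ).and (tendsto_snd.eventually hGφ)
        have hcont : Tendsto (fun q : frontier U × frontier U => ((q.1 : Euc d), (q.2 : Euc d)))
            (𝓝 (a, a)) (𝓝 ((a : Euc d), (a : Euc d))) :=
          ((continuous_subtype_val.comp continuous_fst).prodMk
            (continuous_subtype_val.comp continuous_snd)).tendsto (a, a)
        refine ⟨_, mem_nhdsWithin_of_mem_nhds (hcont.eventually (h2.and h3)), c / 2, by positivity,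
          fun q hq => ?_⟩
        have e := hq.1
        simp only [hq.2.1 q.1.2, hq.2.2 q.2.2] at e
        rw [Subtype.dist_eq, dist_eq_norm]
        exact e
      · have hne : φ a ≠ φ b := fun e => hab (hinj e)
        have hpos : 0 < ‖φ a - φ b‖ := norm_pos_iff.2 (sub_ne_zero.2 hne)
        have hdist : 0 < dist a b := dist_pos.2 hab
        have hc : Continuous fun q : frontier U × frontier U => ‖φ q.1 - φ q.2‖ :=
          ((hφ.continuous.comp continuous_fst).sub (hφ.continuous.comp continuous_snd)).norm
        have h1 := (hc.tendsto (a, b)).eventually (lt_mem_nhds (half_lt_self hpos))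
        have h2 := (continuous_dist.tendsto (a, b)).eventually
          (gt_mem_nhds (show dist a b < 2 * dist a b by linarith))
        refine ⟨_, mem_nhdsWithin_of_mem_nhds (h1.and h2),
          ‖φ a - φ b‖ / 2 / (2 * dist a b), by positivity, fun q hq => ?_⟩
        have h3 : ‖φ a - φ b‖ / 2 / (2 * dist a b) * dist q.1 q.2 ≤
            ‖φ a - φ b‖ / 2 / (2 * dist a b) * (2 * dist a b) :=
          mul_le_mul_of_nonneg_left hq.2.le (by positivity)
        rw [div_mul_cancel₀ _ (by positivity)] at h3
        exact h3.trans hq.1.le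
  obtain ⟨c, hc, h⟩ := hp
  exact ⟨c, hc, fun y z => h (y, z) (mem_univ _)⟩

end LipschitzBounds

/-! ### The space of embeddings -/

section Embeddings

variable {U : Set (Euc d)}

theorem tendsto_of_tendsto_ckNorm {ι : Type*} {l : Filter ι} {k : ℕ} {X : ι → frontier U → F}
    (h : Tendsto (fun n => ckNorm U k (X n)) l (𝓝 0)) (y : frontier U) :
    Tendsto (fun n => X n y) l (𝓝 0) := by
  rw [tendsto_zero_iff_enorm_tendsto_zero]
  refine tendsto_of_tendsto_of_tendsto_of_le_of_le tendsto_const_nhds h (fun _ => zero_le)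
    fun n => ?_
  have := le_iSup₂_of_le (f := fun (J : List (Fin d)) (_ : J.length ≤ k) =>
    ⨆ y : frontier U, ‖tpartials U J (X n) y‖ₑ) [] (by simp)
    (le_iSup (fun y : frontier U => ‖tpartials U [] (X n) y‖ₑ) y)
  exact this

/-- Elements of the completion are immersions: a left inverse of the differential persists in the
limit. -/
theorem isImmersion_of_mem_completedEmbeddings [CompactSpace (frontier U)]
    (hM : IsHypersurface (frontier U)) {k : ℕ} {φ : frontier U → Euc d}
    (h : φ ∈ completedEmbeddings U (k + 1)) : IsImmersion U φ := by
  obtain ⟨hφ, u, hu, hlim⟩ := h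
  have hun : ∀ n, IsCk U ((k + 1 : ℕ) : WithTop ℕ∞) (u n) := fun n =>
    (hu n).1.of_le (by exact_mod_cast le_top)
  have hconv := ckConv_of_tendsto_ckDist hM (.of_forall hun) hφ hlim
  have h1 := CkConv.tderiv hM hconv (.of_forall hun) hφ
  intro y v hv h0
  have e1 : Tendsto (fun n => tderiv U (u n) y) atTop (𝓝 (tderiv U φ y)) :=
    h1.tendstoUniformly.tendsto_at y
  have e2 : Tendsto (fun n => invJac U (u n) y - invJac U φ y) atTop (𝓝 0) :=
    tendsto_of_tendsto_ckNorm (X := fun n y => invJac U (u n) y - invJac U φ y) (k := k)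
      (tendsto_of_tendsto_of_tendsto_of_le_of_le tendsto_const_nhds hlim (fun _ => zero_le)
        (fun _ => le_add_self)) y
  have e3 : Tendsto (fun n => invJac U (u n) y) atTop (𝓝 (invJac U φ y)) :=
    tendsto_sub_nhds_zero_iff.1 e2
  have happ : ∀ {A : ℕ → Euc d →L[ℝ] Euc d} {B : Euc d →L[ℝ] Euc d} {x : ℕ → Euc d} {z : Euc d},
      Tendsto A atTop (𝓝 B) → Tendsto x atTop (𝓝 z) →
      Tendsto (fun n => A n (x n)) atTop (𝓝 (B z)) := fun {A B x z} h h' =>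
    (isBoundedBilinearMap_apply.continuous.tendsto (B, z)).comp (h.prodMk_nhds h')
  have e4 := happ e3 (happ e1 (tendsto_const_nhds (x := v)))
  have e5 : ∀ n, invJac U (u n) y (tderiv U (u n) y v) = v := fun n => by
    have := IsImmersion.invJac_comp (hu n).2.2 ((hun n).of_le (one_le_natCast_succ k)) y
    have := DFunLike.congr_fun this v
    rwa [tangentProj_eq_self hv] at this
  simp only [e5, h0, map_zero] at e4
  exact tendsto_nhds_unique tendsto_const_nhds e4

theorem exists_hasLowerBound_of_mem_embeddings [CompactSpace (frontier U)]
    (hM : IsHypersurface (frontier U)) {k : ℕ} {φ : frontier U → Euc d}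
    (h : φ ∈ embeddings U (k + 1)) : ∃ c : ℝ, 0 < c ∧ HasLowerBound U c φ :=
  (isImmersion_of_mem_completedEmbeddings hM h.1).exists_hasLowerBound hM
    (h.1.1.of_le (one_le_natCast_succ k)) h.2

/-- A Lipschitz-small smooth perturbation of an embedding is an embedding. -/
theorem add_mem_embeddings [CompactSpace (frontier U)]
    (hM : IsHypersurface (frontier U)) {k : ℕ} {φ X : frontier U → Euc d}
    (h : φ ∈ embeddings U (k + 1)) {c L : ℝ} (hφc : HasLowerBound U c φ) (hLc : L < c)
    (hX : IsCk U ∞ X) (hXL : HasLipBound U L X) :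
    (fun y => φ y + X y) ∈ embeddings U (k + 1) := by
  obtain ⟨⟨hφ, u, hu, hlim⟩, hinj⟩ := h
  have hun : ∀ n, IsCk U ((k + 1 : ℕ) : WithTop ℕ∞) (u n) := fun n =>
    (hu n).1.of_le (by exact_mod_cast le_top)
  have hXk : IsCk U ((k + 1 : ℕ) : WithTop ℕ∞) X := hX.of_le (by exact_mod_cast le_top)
  have hconv := ckConv_of_tendsto_ckDist hM (.of_forall hun) hφ hlim
  have hev := hconv.eventually_hasLipBound hM (.of_forall hun) hφ
    (show 0 < (c - L) / 2 by linarith)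
  have hψ := hφ.add hXk
  have hψc : HasLowerBound U (c - L) (fun y => φ y + X y) :=
    hφc.perturb (by simpa using hXL)
  have hψ1 := hψ.of_le (one_le_natCast_succ k)
  have hgood : ∀ᶠ n in atTop, IsSmoothEmbedding U (fun y => u n y + X y) := by
    filter_upwards [hev] with n hn
    have hlow : HasLowerBound U (c - L - (c - L) / 2) (fun y => u n y + X y) :=
      hψc.perturb (by simpa using hn)
    have hpos : 0 < c - L - (c - L) / 2 := by linarith
    exact ⟨(hu n).1.add hX, hlow.injective hpos,
      hlow.isImmersion hM (((hu n).1.add hX).of_le (by exact_mod_cast le_top)) hpos⟩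
  obtain ⟨n₀, hn₀⟩ := eventually_atTop.1 hgood
  have hconv' : CkConv U atTop (k + 1) (fun n y => u n y + X y) (fun y => φ y + X y) :=
    hconv.add hM (ckConv_const _ X) (.of_forall hun) hφ (.of_forall fun _ => hXk) hXk
  have hlim' := hconv'.tendsto_ckDist hM
    (hgood.mono fun n hn => ⟨(hun n).add hXk, hn.2.2⟩) hψ
    (hψc.isImmersion hM hψ1 (by linarith))
  refine ⟨⟨hψ, fun n y => u (n + n₀) y + X y, fun n => hn₀ _ (Nat.le_add_left _ _), ?_⟩,
    hψc.injective (by linarith)⟩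
  exact hlim'.comp (tendsto_add_atTop_nat n₀)

end Embeddings

/-! ### The two sides of an embedded hypersurface and the outward normal -/

section Sides

variable {U : Set (Euc d)}

/-- On the open set `W` the hypersurface `S` is the regular zero set of the `C^1` function `h`, and
it separates `W` into the two connected sides `{h > 0}` and `{h < 0}`. -/
structure IsSideFunction (S W : Set (Euc d)) (h : Euc d → ℝ) : Prop where
  isOpen : IsOpen W
  contDiffAt : ∀ z ∈ W, ContDiffAt ℝ 1 h z
  fderiv_ne : ∀ z ∈ W, fderiv ℝ h z ≠ 0
  mem_iff : ∀ z ∈ W, (z ∈ S ↔ h z = 0)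
  pos_side : IsPreconnected (W ∩ {z | 0 < h z})
  neg_side : IsPreconnected (W ∩ {z | h z < 0})

theorem IsSideFunction.neg {S W : Set (Euc d)} {h : Euc d → ℝ} (H : IsSideFunction S W h) :
    IsSideFunction S W (fun z => -h z) where
  isOpen := H.isOpen
  contDiffAt z hz := (H.contDiffAt z hz).neg
  fderiv_ne z hz := by
    rw [fderiv_fun_neg]
    exact neg_ne_zero.2 (H.fderiv_ne z hz)
  mem_iff z hz := by rw [H.mem_iff z hz, neg_eq_zero]
  pos_side := by simpa using H.neg_side
  neg_side := by simpa using H.pos_side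

theorem unitGradient_neg (h : Euc d → ℝ) (p : Euc d) :
    unitGradient (fun z => -h z) p = -unitGradient h p := by
  have : gradient (fun z => -h z) p = -gradient h p := by
    rw [gradient, gradient, fderiv_fun_neg, map_neg]
  rw [unitGradient, unitGradient, this, norm_neg, smul_neg]

/-- A `C^1` embedding with a quantitative lower bound on distances. -/
structure IsBiLipEmbedding (U : Set (Euc d)) (c : ℝ) (φ : frontier U → Euc d) : Prop where
  isCk : IsCk U 1 φ
  pos : 0 < c
  lower : HasLowerBound U c φ

theorem IsBiLipEmbedding.injective {c : ℝ} {φ : frontier U → Euc d}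
    (h : IsBiLipEmbedding U c φ) : Function.Injective φ := h.lower.injective h.pos

theorem IsBiLipEmbedding.isImmersion {c : ℝ} {φ : frontier U → Euc d}
    (h : IsBiLipEmbedding U c φ) (hM : IsHypersurface (frontier U)) : IsImmersion U φ :=
  h.lower.isImmersion hM h.isCk h.pos

theorem IsBiLipEmbedding.exists_sideFunction [CompactSpace (frontier U)] {c : ℝ}
    {φ : frontier U → Euc d} (hφ : IsBiLipEmbedding U c φ) (hM : IsHypersurface (frontier U))
    (y : frontier U) : ∃ W h, φ y ∈ W ∧ IsSideFunction (range φ) W h := by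
  obtain ⟨f, hf⟩ := hM y y.2
  obtain ⟨χ⟩ := hf.exists_chart
  obtain ⟨G, G', hG, hGd, hGφ⟩ := (hφ.isImmersion hM).exists_local_diffeo hM hφ.isCk hf
  set N := unitGradient f y with hN
  have hGat := hG.contDiffAt (x := (y : Euc d))
  let eG := hGat.toOpenPartialHomeomorph G hGd.hasFDerivAt (by simp)
  have hyG : (y : Euc d) ∈ eG.source :=
    hGat.mem_toOpenPartialHomeomorph_source hGd.hasFDerivAt (by simp)
  have hGy : G y = φ y := hGφ.self_of_nhds y.2
  have hGsymm : ContDiffAt ℝ 1 eG.symm (φ y) := by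
    have := hGat.to_localInverse hGd.hasFDerivAt (by simp)
    rw [hGy] at this
    exact this
  have heGsymm : eG.symm (φ y) = y := by
    rw [← hGy]
    exact eG.left_inv hyG
  -- `e` straightens the image: the hyperplane through `y` is mapped to `φ(M)` near `φ y`
  let e := χ.toChart.symm.trans eG
  have hye : (y : Euc d) ∈ e.source := by
    rw [OpenPartialHomeomorph.trans_source]
    refine ⟨χ.mem_target, ?_⟩
    change χ.toChart.symm y ∈ eG.source
    rw [χ.symm_apply_eq]; exact hyG
  have he : ∀ x, e x = G (χ.toChart.symm x) := fun x => rfl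
  have hes : ∀ z, e.symm z = χ.toChart (eG.symm z) := fun x => rfl
  have hey : e y = φ y := by rw [he, χ.symm_apply_eq, hGy]
  let h : Euc d → ℝ := fun z => inner ℝ N (e.symm z - y)
  have hhe : ∀ x ∈ e.source, h (e x) = inner ℝ N (x - y) := fun x hx => by
    simp only [h]
    rw [e.left_inv hx]
  have hesC : ContDiffAt ℝ 1 e.symm (φ y) :=
    ((χ.contDiff.of_le (by simp)).contDiffAt).comp (φ y) hGsymm
  have hhC : ContDiffAt ℝ 1 h (φ y) := contDiffAt_const.inner ℝ (hesC.sub contDiffAt_const)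
  have hhd : fderiv ℝ h (φ y) ≠ 0 := by
    intro h0
    have h1 : HasFDerivAt h (0 : Euc d →L[ℝ] ℝ) (e y) := by
      rw [hey, ← h0]
      exact (hhC.differentiableAt (by simp)).hasFDerivAt
    have h2 : DifferentiableAt ℝ e y := by
      have hs : DifferentiableAt ℝ χ.toChart.symm (y : Euc d) := χ.symm_hasFDerivAt.differentiableAt
      exact (hG.differentiable (by simp) _).comp _ hs
    have h3 := h1.comp (y : Euc d) h2.hasFDerivAt
    have h4 : HasFDerivAt (fun x : Euc d => inner ℝ N (x - y)) (innerSL ℝ N) (y : Euc d) :=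
      (innerSL ℝ N).hasFDerivAt.comp _ ((hasFDerivAt_id _).sub_const _)
    have h5 : h ∘ e =ᶠ[𝓝 (y : Euc d)] fun x => inner ℝ N (x - y) := by
      filter_upwards [e.open_source.mem_nhds hye] with x hx using hhe x hx
    have h6 := (h3.congr_of_eventuallyEq h5.symm).unique h4
    have h7 := DFunLike.congr_fun h6 N
    simp only [ContinuousLinearMap.zero_comp, zero_apply, innerSL_apply_apply,
      real_inner_self_eq_norm_sq] at h7
    rw [χ.norm_normal] at h7
    norm_num at h7
  have hev1 : ∀ᶠ z in 𝓝 (φ y), ContDiffAt ℝ 1 h z ∧ fderiv ℝ h z ≠ 0 :=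
    (hhC.eventually (by simp)).and
      ((hhC.fderiv_right (m := 0) (by simp)).continuousAt.eventually_ne hhd)
  have hκc : Tendsto χ.toChart.symm (𝓝 (y : Euc d)) (𝓝 (y : Euc d)) := by
    have := (χ.toChart.continuousAt_symm χ.mem_target).tendsto
    rwa [χ.symm_apply_eq] at this
  obtain ⟨r₁, hr₁, hball₁⟩ := Metric.eventually_nhds_iff_ball.1
    ((show ∀ᶠ x in 𝓝 (y : Euc d), x ∈ e.source from e.open_source.mem_nhds hye).and
      (hκc.eventually hGφ))
  -- the rest of the compact image stays away from `φ y`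
  let V : Set (frontier U) :=
    Subtype.val ⁻¹' (χ.toChart.source ∩ χ.toChart ⁻¹' Metric.ball (y : Euc d) r₁)
  have hV : IsOpen V :=
    (χ.toChart.open_source.inter (Metric.isOpen_ball.preimage
      χ.contDiff.continuous)).preimage continuous_subtype_val
  have hyV : y ∈ V := by
    refine ⟨χ.mem_source, ?_⟩
    rw [mem_preimage, χ.apply_eq]
    exact Metric.mem_ball_self hr₁
  have hK : IsClosed (φ '' Vᶜ) := (hV.isClosed_compl.isCompact.image hφ.isCk.continuous).isClosed
  have hyK : φ y ∈ (φ '' Vᶜ)ᶜ := by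
    rintro ⟨m, hm, hmy⟩
    exact hm (by rwa [hφ.injective hmy])
  have hec : Tendsto e (𝓝 (y : Euc d)) (𝓝 (φ y)) := by
    have := (e.continuousAt hye).tendsto
    rwa [hey] at this
  obtain ⟨r₂, hr₂, hball₂⟩ := Metric.eventually_nhds_iff_ball.1
    (hec.eventually (hev1.and (hK.isOpen_compl.mem_nhds hyK)))
  set B := Metric.ball (y : Euc d) (min r₁ r₂) with hB
  have hB₁ : ∀ x ∈ B, x ∈ Metric.ball (y : Euc d) r₁ := fun x hx =>
    Metric.ball_subset_ball (min_le_left _ _) hx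
  have hB₂ : ∀ x ∈ B, x ∈ Metric.ball (y : Euc d) r₂ := fun x hx =>
    Metric.ball_subset_ball (min_le_right _ _) hx
  have hBs : B ⊆ e.source := fun x hx => (hball₁ x (hB₁ x hx)).1
  have hside : ∀ s : Set ℝ, Convex ℝ s → IsPreconnected (e '' B ∩ h ⁻¹' s) := by
    intro s hs
    have : e '' B ∩ h ⁻¹' s = e '' (B ∩ (fun x => inner ℝ N (x - y)) ⁻¹' s) := by
      ext z
      constructor
      · rintro ⟨⟨x, hx, rfl⟩, hz⟩
        exact ⟨x, ⟨hx, by rwa [mem_preimage, hhe x (hBs hx)] at hz⟩, rfl⟩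
      · rintro ⟨x, ⟨hx, hz⟩, rfl⟩
        exact ⟨⟨x, hx, rfl⟩, by rwa [mem_preimage, hhe x (hBs hx)]⟩
    rw [this]
    refine IsPreconnected.image (Convex.isPreconnected ?_) _
      (e.continuousOn.mono fun x hx => hBs hx.1)
    refine (convex_ball _ _).inter ?_
    have hlin : (fun x : Euc d => inner ℝ N (x - y)) ⁻¹' s =
        (fun x : Euc d => x + -(y : Euc d)) ⁻¹' ((innerSL ℝ N) ⁻¹' s) := by
      ext x; simp [sub_eq_add_neg]
    rw [hlin]
    exact (hs.linear_preimage (innerSL ℝ N).toLinearMap).translate_preimage_left _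
  refine ⟨e '' B, h, ⟨y, Metric.mem_ball_self (lt_min hr₁ hr₂), hey⟩,
    e.isOpen_image_of_subset_source Metric.isOpen_ball hBs, ?_, ?_, ?_,
    hside (Ioi 0) (convex_Ioi 0), hside (Iio 0) (convex_Iio 0)⟩
  · rintro _ ⟨x, hx, rfl⟩
    exact (hball₂ x (hB₂ x hx)).1.1
  · rintro _ ⟨x, hx, rfl⟩
    exact (hball₂ x (hB₂ x hx)).1.2
  · rintro _ ⟨x, hx, rfl⟩
    have hxt : x ∈ χ.toChart.target := (hBs hx).1
    rw [hhe x (hBs hx), ← χ.symm_mem_iff hxt]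
    constructor
    · rintro ⟨m, hm⟩
      have hmV : m ∈ V := by
        by_contra hmV
        exact (hball₂ x (hB₂ x hx)).2 ⟨m, hmV, hm⟩
      have e1 : e (χ.toChart m) = e x := by
        have h1 := (hball₁ _ hmV.2).2
        rw [he, ← hm]
        rw [χ.toChart.left_inv hmV.1] at h1 ⊢
        exact h1 m.2
      have e2 := e.injOn (hball₁ _ hmV.2).1 (hBs hx) e1
      rw [← e2, χ.toChart.left_inv hmV.1]
      exact m.2
    · intro hmem
      exact ⟨⟨_, hmem⟩, ((hball₁ x (hB₁ x hx)).2 hmem).symm⟩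

/-- Near its boundary a region lies on exactly one side. -/
theorem IsSideFunction.region_eq {S W D : Set (Euc d)} {h : Euc d → ℝ} (H : IsSideFunction S W h)
    (hD : IsEnclosedRegion D S) (hne : (S ∩ W).Nonempty) :
    (∀ z ∈ W, (z ∈ D ↔ h z ≤ 0)) ∨ (∀ z ∈ W, (z ∈ D ↔ 0 ≤ h z)) := by
  obtain ⟨hDc, hDi, hDS⟩ := hD
  have hSD : ∀ z ∈ S, z ∈ D := fun z hz => by
    rw [← hDS] at hz
    exact hDc.isClosed.frontier_subset hz
  have hside : ∀ T : Set (Euc d), IsPreconnected T → T ∩ S = ∅ → T ⊆ D ∨ T ⊆ Dᶜ := by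
    intro T hT hTS
    by_contra hcon
    push Not at hcon
    obtain ⟨⟨a, ha, ha'⟩, ⟨b, hb, hb'⟩⟩ := And.imp not_subset.1 not_subset.1 hcon
    have hcover : ∀ z ∈ T, z ∈ D → z ∈ interior D := fun z hz hzD => by
      by_contra hzi
      have : z ∈ T ∩ S := ⟨hz, by rw [← hDS, hDc.isClosed.frontier_eq]; exact ⟨hzD, hzi⟩⟩
      rw [hTS] at this
      exact this
    obtain ⟨q, -, hq, hq'⟩ := hT (interior D) Dᶜ isOpen_interior hDc.isClosed.isOpen_compl
      (fun z hz => or_iff_not_imp_right.2 fun hzD => hcover z hz (not_not.1 hzD))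
      ⟨b, hb, hcover b hb (not_not.1 hb')⟩ ⟨a, ha, ha'⟩
    exact hq' (interior_subset hq)
  have hpos := hside _ H.pos_side (by
    ext z
    simp only [mem_inter_iff, mem_ofPred_eq, mem_empty_iff_false, iff_false, not_and]
    intro hz hzS
    rw [H.mem_iff z hz.1] at hzS
    exact hz.2.ne' hzS)
  have hneg := hside _ H.neg_side (by
    ext z
    simp only [mem_inter_iff, mem_ofPred_eq, mem_empty_iff_false, iff_false, not_and]
    intro hz hzS
    rw [H.mem_iff z hz.1] at hzS
    exact hz.2.ne hzS)
  have hzero : ∀ z ∈ W, h z = 0 → z ∈ D := fun z hz h0 => hSD z ((H.mem_iff z hz).2 h0)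
  obtain ⟨p, hpS, hpW⟩ := hne
  rcases hpos with hpos | hpos <;> rcases hneg with hneg | hneg
  · exfalso
    have hWD : W ⊆ D := fun z hz => by
      rcases lt_trichotomy (h z) 0 with h1 | h1 | h1
      · exact hneg ⟨hz, h1⟩
      · exact hzero z hz h1
      · exact hpos ⟨hz, h1⟩
    have hpi : p ∈ interior D := interior_mono hWD (by rwa [H.isOpen.interior_eq])
    rw [← hDS] at hpS
    exact hpS.2 hpi
  · right
    intro z hz
    refine ⟨fun hzD => not_lt.1 fun h1 => hneg ⟨hz, h1⟩ hzD, fun h1 => ?_⟩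
    rcases h1.eq_or_lt with h1 | h1
    · exact hzero z hz h1.symm
    · exact hpos ⟨hz, h1⟩
  · left
    intro z hz
    refine ⟨fun hzD => not_lt.1 fun h1 => hpos ⟨hz, h1⟩ hzD, fun h1 => ?_⟩
    rcases h1.eq_or_lt with h1 | h1
    · exact hzero z hz h1
    · exact hneg ⟨hz, h1⟩
  · exfalso
    have hpD : p ∈ closure (interior D) := by rw [hDi]; exact hSD p hpS
    obtain ⟨q, hqW, hqD⟩ := mem_closure_iff.1 hpD W H.isOpen hpW
    have hq0 : h q = 0 := by
      rcases lt_trichotomy (h q) 0 with h1 | h1 | h1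
      · exact absurd (interior_subset hqD) (hneg ⟨hqW, h1⟩)
      · exact h1
      · exact absurd (interior_subset hqD) (hpos ⟨hqW, h1⟩)
    have hqS : q ∈ frontier D := by rw [hDS]; exact (H.mem_iff q hqW).2 hq0
    exact hqS.2 hqD

/-- The enclosed region is unique: the set of points near which two candidates agree is open,
closed, and contains the points far away. -/
theorem IsEnclosedRegion.unique (hd : 1 ≤ d) {S D₁ D₂ : Set (Euc d)}
    (hS : ∀ p ∈ S, ∃ W h, p ∈ W ∧ IsSideFunction S W h)
    (h₁ : IsEnclosedRegion D₁ S) (h₂ : IsEnclosedRegion D₂ S) : D₁ = D₂ := by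
  let Z : Set (Euc d) := {z | ∀ᶠ w in 𝓝 z, (w ∈ D₁ ↔ w ∈ D₂)}
  have hZo : IsOpen Z := isOpen_setOfPred_eventually_nhds
  have hloc : ∀ {D : Set (Euc d)}, IsEnclosedRegion D S → ∀ z ∉ S,
      (∀ᶠ w in 𝓝 z, w ∈ D) ∨ (∀ᶠ w in 𝓝 z, w ∉ D) := by
    intro D hD z hz
    by_cases hzi : z ∈ interior D
    · left; exact mem_interior_iff_mem_nhds.1 hzi
    · right
      have : z ∉ D := fun hzD => hz (by
        rw [← hD.2.2, hD.1.isClosed.frontier_eq]; exact ⟨hzD, hzi⟩)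
      exact hD.1.isClosed.isOpen_compl.mem_nhds this
  have hZc : IsOpen Zᶜ := by
    rw [isOpen_iff_mem_nhds]
    intro z hz
    by_cases hzS : z ∈ S
    · obtain ⟨W, h, hzW, H⟩ := hS z hzS
      have hopp : ∀ {a b : Set (Euc d)}, IsEnclosedRegion a S → (∀ w ∈ W, (w ∈ a ↔ h w ≤ 0)) →
          (∀ w ∈ W, (w ∈ b ↔ 0 ≤ h w)) → ∀ w ∈ W, ¬ ∀ᶠ x in 𝓝 w, (x ∈ a ↔ x ∈ b) := by
        intro a b ha h1 h2 w hw hev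
        have h3 : ∀ᶠ x in 𝓝 w, x ∈ frontier a := by
          filter_upwards [hev, H.isOpen.mem_nhds hw] with x hx hxW
          rw [ha.2.2, H.mem_iff x hxW]
          rw [h1 x hxW, h2 x hxW] at hx
          rcases le_total (h x) 0 with h4 | h4
          · exact le_antisymm h4 (hx.1 h4)
          · exact le_antisymm (hx.2 h4) h4
        have h4 : w ∈ interior (frontier a) := mem_interior_iff_mem_nhds.2 h3
        rw [interior_frontier ha.1.isClosed] at h4
        exact h4
      filter_upwards [H.isOpen.mem_nhds hzW] with w hw
      rcases H.region_eq h₁ ⟨z, hzS, hzW⟩ with a | a <;>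
        rcases H.region_eq h₂ ⟨z, hzS, hzW⟩ with b | b
      · refine absurd ?_ hz
        filter_upwards [H.isOpen.mem_nhds hzW] with x hx using (a x hx).trans (b x hx).symm
      · exact hopp h₁ a b w hw
      · refine fun hw' => hopp h₂ b a w hw ?_
        exact Eventually.mono hw' fun x hx => hx.symm
      · refine absurd ?_ hz
        filter_upwards [H.isOpen.mem_nhds hzW] with x hx using (a x hx).trans (b x hx).symm
    · rcases hloc h₁ z hzS with a | a <;> rcases hloc h₂ z hzS with b | b
      · exact absurd (by filter_upwards [a, b] with x ha hb using iff_of_true ha hb) hz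
      · filter_upwards [(a.and b)] with x hx hxZ
        exact hx.2 (Eventually.self_of_nhds hxZ |>.1 hx.1)
      · filter_upwards [(a.and b)] with x hx hxZ
        exact hx.1 (Eventually.self_of_nhds hxZ |>.2 hx.2)
      · exact absurd (by filter_upwards [a, b] with x ha hb using iff_of_false ha hb) hz
  have hZne : Z.Nonempty := by
    have hb : Bornology.IsBounded (D₁ ∪ D₂) := h₁.1.isBounded.union h₂.1.isBounded
    have : Nontrivial (Euc d) := by
      have : Nonempty (Fin d) := ⟨⟨0, hd⟩⟩
      infer_instance
    have hne : (D₁ ∪ D₂)ᶜ.Nonempty := by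
      by_contra hcon
      rw [not_nonempty_iff_eq_empty, compl_empty_iff] at hcon
      rw [hcon] at hb
      exact NormedSpace.unbounded_univ ℝ (Euc d) hb
    obtain ⟨z, hz⟩ := hne
    refine ⟨z, ?_⟩
    filter_upwards [(h₁.1.union h₂.1).isClosed.isOpen_compl.mem_nhds hz] with w hw
    exact iff_of_false (fun a => hw (Or.inl a)) (fun a => hw (Or.inr a))
  have hZ : Z = univ := IsClopen.eq_univ ⟨⟨hZc⟩, hZo⟩ hZne
  ext z
  have hz : ∀ᶠ w in 𝓝 z, (w ∈ D₁ ↔ w ∈ D₂) := by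
    change z ∈ Z
    rw [hZ]; trivial
  exact hz.self_of_nhds

/-- To first order the sign of `h` at `z` is that of the normal component of `z - p`. -/
theorem eventually_pos_of_inner {h : Euc d → ℝ} {p : Euc d} (hC : DifferentiableAt ℝ h p)
    (h0 : h p = 0) (hd : fderiv ℝ h p ≠ 0) {η : ℝ} (hη : 0 < η) :
    ∀ᶠ z in 𝓝 p, η * ‖z - p‖ < inner ℝ (unitGradient h p) (z - p) → 0 < h z := by
  have ha : 0 < ‖gradient h p‖ := norm_pos_iff.2 (gradient_ne_zero hd)
  have h1 := hC.hasFDerivAt.isLittleO.def (mul_pos hη ha)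
  filter_upwards [h1] with z hz hlt
  rw [h0, sub_zero] at hz
  rw [inner_unitGradient, lt_inv_mul_iff₀ ha] at hlt
  have h2 := abs_le.1 ((Real.norm_eq_abs _).symm.trans_le hz)
  linarith [h2.1]

theorem tendsto_add_smul (p v : Euc d) :
    Tendsto (fun s : ℝ => p + s • v) (𝓝[>] 0) (𝓝 p) := by
  have : Continuous fun s : ℝ => p + s • v := by fun_prop
  have h := this.tendsto 0
  simp only [zero_smul, add_zero] at h
  exact h.mono_left nhdsWithin_le_nhds

theorem IsSideFunction.unitGradient_orthogonal {W : Set (Euc d)} {h : Euc d → ℝ}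
    {φ : frontier U → Euc d} (hM : IsHypersurface (frontier U)) (hφ : IsCk U 1 φ)
    (H : IsSideFunction (range φ) W h) {y : frontier U} (hy : φ y ∈ W) (v : Euc d) :
    inner ℝ (unitGradient h (φ y)) (tderiv U φ y v) = 0 := by
  have hφc := hφ.continuous
  have e : tderiv U φ y (tangentProj U y v) = tderiv U φ y v :=
    DFunLike.congr_fun (hφ.tderiv_comp_tangentProj y) v
  obtain ⟨g, hg, hgφ⟩ := hφ
  have hd := hg.differentiable (by simp) (y : Euc d)
  rw [← e, inner_unitGradient, tderiv_eq hgφ hd, ContinuousLinearMap.comp_apply,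
    tangentProj_eq_self (tangentProj_mem U y v)]
  have hhd : HasFDerivAt h (fderiv ℝ h (φ y)) (g y) := by
    rw [hgφ]; exact ((H.contDiffAt _ hy).differentiableAt (by simp)).hasFDerivAt
  have h1 := hhd.comp (y : Euc d) hd.hasFDerivAt
  let O := g ⁻¹' W
  have hO : O ∈ 𝓝 (y : Euc d) :=
    (H.isOpen.preimage hg.continuous).mem_nhds (by simpa [O, hgφ] using hy)
  have h2 : HasFDerivWithinAt (h ∘ g) (0 : Euc d →L[ℝ] ℝ) (frontier U ∩ O) (y : Euc d) := by
    have hz : ∀ z ∈ frontier U, z ∈ O → (h ∘ g) z = 0 := fun z hz hzO => by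
      refine (H.mem_iff _ hzO).1 ⟨⟨z, hz⟩, (hgφ ⟨z, hz⟩).symm⟩
    exact (hasFDerivWithinAt_const (0 : ℝ) _ _).congr (fun z hz' => hz z hz'.1 hz'.2)
      (hz y y.2 (mem_of_mem_nhds hO))
  have hv : tangentProj U y v ∈ tangentConeAt ℝ (frontier U ∩ O) (y : Euc d) := by
    rw [tangentConeAt_inter_nhds hO, ← hM.tangentSpace_eq_tangentCone]
    exact tangentProj_mem U y v
  have h3 := h1.hasFDerivWithinAt.unique_on h2 hv
  rw [show fderiv ℝ h (φ y) (fderiv ℝ g y (tangentProj U y v)) = 0 from h3, mul_zero]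

/-- The ambient space is spanned by the image of the tangent space and a unit normal. -/
theorem IsImmersion.exists_decomp {φ : frontier U → Euc d} (h : IsImmersion U φ)
    (hM : IsHypersurface (frontier U)) (hφ : IsCk U 1 φ) {y : frontier U} {ν : Euc d}
    (hν : ‖ν‖ = 1) (hνA : ∀ v, inner ℝ ν (tderiv U φ y v) = 0) (x : Euc d) :
    ∃ v ∈ tangentSpace U y, x = tderiv U φ y v + inner ℝ ν x • ν := by
  obtain ⟨f, hf⟩ := hM y y.2
  set N := unitGradient f y
  let R : Euc d →L[ℝ] Euc d := tderiv U φ y + (innerSL ℝ N).smulRight ν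
  have hR : ∀ v, R v = tderiv U φ y v + inner ℝ N v • ν := fun v => rfl
  have hRν : ∀ v, inner ℝ ν (R v) = inner ℝ N v := fun v => by
    rw [hR, inner_add_right, hνA, real_inner_smul_right, real_inner_self_eq_norm_sq, hν]
    ring
  have hinj : ∀ v, R v = 0 → v = 0 := by
    intro v hv
    have e1 : inner ℝ N v = 0 := by rw [← hRν, hv, inner_zero_right]
    rw [hR, e1, zero_smul, add_zero] at hv
    exact h y v (hf.mem_tangentSpace_iff.2 e1) hv
  obtain ⟨v, hv⟩ := (ContinuousLinearMap.isUnit_iff_bijective.1 (isUnit_of_injective hinj)).2 x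
  have e : tderiv U φ y (tangentProj U y v) = tderiv U φ y v :=
    DFunLike.congr_fun (hφ.tderiv_comp_tangentProj y) v
  refine ⟨tangentProj U y v, tangentProj_mem U y v, ?_⟩
  rw [e]
  conv_rhs => rw [← hv, hRν]
  rw [← hR, hv]

theorem IsImmersion.normal_unique {φ : frontier U → Euc d} (h : IsImmersion U φ)
    (hM : IsHypersurface (frontier U)) (hφ : IsCk U 1 φ) {y : frontier U} {ν μ : Euc d}
    (hν : ‖ν‖ = 1) (hνA : ∀ v, inner ℝ ν (tderiv U φ y v) = 0)
    (hμ : ‖μ‖ = 1) (hμA : ∀ v, inner ℝ μ (tderiv U φ y v) = 0) : μ = ν ∨ μ = -ν := by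
  obtain ⟨v, -, hv⟩ := h.exists_decomp hM hφ hν hνA μ
  have h1 : tderiv U φ y v = 0 := by
    have e1 : inner ℝ (tderiv U φ y v) (tderiv U φ y v) = (0 : ℝ) := by
      have := hμA v
      rw [hv, inner_add_left, real_inner_smul_left, hνA, mul_zero, add_zero] at this
      exact this
    exact inner_self_eq_zero.1 e1
  rw [h1, zero_add] at hv
  set a := inner ℝ ν μ
  have h2 : |a| = 1 := by
    have := congrArg norm hv
    rw [norm_smul, hν, hμ, mul_one, Real.norm_eq_abs] at this
    exact this.symm
  rcases eq_or_eq_neg_of_abs_eq h2 with h3 | h3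
  · left; rw [hv, h3, one_smul]
  · right; rw [hv, h3, neg_smul, one_smul]

theorem outwardNormal_eq {φ : frontier U → Euc d} {y : frontier U} {n : Euc d}
    (h : ∀ ν, IsOutwardUnitNormal U φ y ν ↔ ν = n) : outwardNormal U φ y = n := by
  have hex : ∃ ν, IsOutwardUnitNormal U φ y ν := ⟨n, (h n).2 rfl⟩
  rw [outwardNormal, dif_pos hex]
  exact (h _).1 hex.choose_spec

theorem outwardNormal_eq_zero {φ : frontier U → Euc d}
    (h : ¬ ∃ D, IsEnclosedRegion D (range φ)) (y : frontier U) : outwardNormal U φ y = 0 := by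
  rw [outwardNormal, dif_neg]
  rintro ⟨ν, -, -, D, hD, -⟩
  exact h ⟨D, hD⟩

theorem norm_outwardNormal_le (φ : frontier U → Euc d) (y : frontier U) :
    ‖outwardNormal U φ y‖ ≤ 1 := by
  rw [outwardNormal]
  split_ifs with h
  · exact h.choose_spec.1.le
  · simp

variable [CompactSpace (frontier U)]

/-- If `D` is the sublevel set of the side function `h`, the outward unit normal is the normalised
gradient of `h`. -/
theorem IsSideFunction.isOutwardUnitNormal_iff (hd : 1 ≤ d) (hM : IsHypersurface (frontier U))
    {c : ℝ} {φ : frontier U → Euc d} (hφ : IsBiLipEmbedding U c φ) {W D : Set (Euc d)}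
    {h : Euc d → ℝ} (H : IsSideFunction (range φ) W h) (hD : IsEnclosedRegion D (range φ))
    (hDW : ∀ z ∈ W, (z ∈ D ↔ h z ≤ 0)) {y : frontier U} (hy : φ y ∈ W) {ν : Euc d} :
    IsOutwardUnitNormal U φ y ν ↔ ν = unitGradient h (φ y) := by
  have hC := (H.contDiffAt _ hy).differentiableAt (by simp)
  have h0 : h (φ y) = 0 := (H.mem_iff _ hy).1 ⟨y, rfl⟩
  have hne := H.fderiv_ne _ hy
  set n := unitGradient h (φ y) with hn
  have hn1 : ‖n‖ = 1 := norm_unitGradient hne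
  have hnA := H.unitGradient_orthogonal hM hφ.isCk hy
  have hout : ∀ᶠ s : ℝ in 𝓝[>] 0, φ y + s • n ∉ D := by
    filter_upwards [(tendsto_add_smul (φ y) n).eventually
      (eventually_pos_of_inner hC h0 hne one_half_pos),
      (tendsto_add_smul (φ y) n).eventually (H.isOpen.mem_nhds hy), self_mem_nhdsWithin]
      with s hs hsW hs0
    have hs0' : (0 : ℝ) < s := hs0
    rw [hDW _ hsW, not_le]
    refine hs ?_
    rw [add_sub_cancel_left, norm_smul, real_inner_smul_right, real_inner_self_eq_norm_sq, hn1,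
      Real.norm_of_nonneg hs0'.le]
    linarith
  have hin : ∀ᶠ s : ℝ in 𝓝[>] 0, φ y - s • n ∈ D := by
    have hne' := H.neg.fderiv_ne _ hy
    filter_upwards [(tendsto_add_smul (φ y) (-n)).eventually
      (eventually_pos_of_inner (h := fun z => -h z) hC.neg (by simp [h0]) hne' one_half_pos),
      (tendsto_add_smul (φ y) (-n)).eventually (H.isOpen.mem_nhds hy), self_mem_nhdsWithin]
      with s hs hsW hs0
    have hs0' : (0 : ℝ) < s := hs0
    have e : φ y - s • n = φ y + s • (-n) := by rw [smul_neg, sub_eq_add_neg]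
    rw [e, hDW _ hsW]
    have := hs (by
      rw [unitGradient_neg, add_sub_cancel_left, norm_smul, real_inner_smul_right, inner_neg_neg,
        real_inner_self_eq_norm_sq, norm_neg, hn1, Real.norm_of_nonneg hs0'.le]
      linarith)
    linarith
  constructor
  · rintro ⟨h1, h2, D', hD', hev⟩
    have hDD : D' = D := IsEnclosedRegion.unique hd (by
      rintro _ ⟨m, rfl⟩
      exact hφ.exists_sideFunction hM m) hD' hD
    subst hDD
    rcases (hφ.isImmersion hM).normal_unique hM hφ.isCk hn1 hnA h1 h2 with h3 | h3
    · exact h3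
    · exfalso
      obtain ⟨s, hs1, hs2⟩ := (hev.and hin).exists
      refine hs1.1 ?_
      rw [h3, smul_neg, ← sub_eq_add_neg]
      exact hs2
  · rintro rfl
    exact ⟨hn1, hnA, D, hD, hout.and hin⟩

theorem IsBiLipEmbedding.exists_sideFunction_region (hM : IsHypersurface (frontier U))
    {c : ℝ} {φ : frontier U → Euc d} (hφ : IsBiLipEmbedding U c φ) {D : Set (Euc d)}
    (hD : IsEnclosedRegion D (range φ)) (y : frontier U) :
    ∃ W h, φ y ∈ W ∧ IsSideFunction (range φ) W h ∧ ∀ z ∈ W, (z ∈ D ↔ h z ≤ 0) := by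
  obtain ⟨W, h, hy, H⟩ := hφ.exists_sideFunction hM y
  rcases H.region_eq hD ⟨φ y, ⟨y, rfl⟩, hy⟩ with h1 | h1
  · exact ⟨W, h, hy, H, h1⟩
  · exact ⟨W, _, hy, H.neg, fun z hz => by rw [h1 z hz, neg_nonpos]⟩

theorem IsSideFunction.outwardNormal_eq (hd : 1 ≤ d) (hM : IsHypersurface (frontier U))
    {c : ℝ} {φ : frontier U → Euc d} (hφ : IsBiLipEmbedding U c φ) {W D : Set (Euc d)}
    {h : Euc d → ℝ} (H : IsSideFunction (range φ) W h) (hD : IsEnclosedRegion D (range φ))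
    (hDW : ∀ z ∈ W, (z ∈ D ↔ h z ≤ 0)) {y : frontier U} (hy : φ y ∈ W) :
    outwardNormal U φ y = unitGradient h (φ y) :=
  GrowthFlow.outwardNormal_eq fun _ => H.isOutwardUnitNormal_iff hd hM hφ hD hDW hy

theorem IsBiLipEmbedding.isOutwardUnitNormal (hd : 1 ≤ d) (hM : IsHypersurface (frontier U))
    {c : ℝ} {φ : frontier U → Euc d} (hφ : IsBiLipEmbedding U c φ) {D : Set (Euc d)}
    (hD : IsEnclosedRegion D (range φ)) (y : frontier U) :
    IsOutwardUnitNormal U φ y (outwardNormal U φ y) := by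
  obtain ⟨W, h, hy, H, hDW⟩ := hφ.exists_sideFunction_region hM hD y
  rw [H.isOutwardUnitNormal_iff hd hM hφ hD hDW hy, H.outwardNormal_eq hd hM hφ hD hDW hy]

theorem IsBiLipEmbedding.continuous_outwardNormal (hd : 1 ≤ d) (hM : IsHypersurface (frontier U))
    {c : ℝ} {φ : frontier U → Euc d} (hφ : IsBiLipEmbedding U c φ) :
    Continuous (outwardNormal U φ) := by
  by_cases hD : ∃ D, IsEnclosedRegion D (range φ)
  · obtain ⟨D, hD⟩ := hD
    rw [continuous_iff_continuousAt]
    intro y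
    obtain ⟨W, h, hy, H, hDW⟩ := hφ.exists_sideFunction_region hM hD y
    have hev : (fun z => unitGradient h (φ z)) =ᶠ[𝓝 y] outwardNormal U φ := by
      filter_upwards [(H.isOpen.preimage hφ.isCk.continuous).mem_nhds hy] with z hz
      exact (H.outwardNormal_eq hd hM hφ hD hDW hz).symm
    refine ContinuousAt.congr ?_ hev
    have h1 : ContinuousAt (fun z => gradient h z) (φ y) :=
      (InnerProductSpace.toDual ℝ (Euc d)).symm.continuous.continuousAt.comp
        (((H.contDiffAt _ hy).fderiv_right (m := 0) (by simp)).continuousAt)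
    have h2 : ContinuousAt (fun z => unitGradient h z) (φ y) :=
      (h1.norm.inv₀ (norm_ne_zero_iff.2 (gradient_ne_zero (H.fderiv_ne _ hy)))).smul h1
    exact ContinuousAt.comp (f := φ) (g := fun z => unitGradient h z) h2
      hφ.isCk.continuous.continuousAt
  · rw [show outwardNormal U φ = fun _ => 0 from funext (outwardNormal_eq_zero hD)]
    exact continuous_const

end Sides

/-! ### Ambient homeomorphisms between nearby embeddings -/

section Stability

open scoped NNReal

variable {U : Set (Euc d)}

/-- The homeomorphism `H` of `ℝ^d` is `κ`-close to the identity in the Lipschitz sense. -/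
def IsNearId (κ : ℝ) (H : Euc d ≃ₜ Euc d) : Prop :=
  ∀ a b, ‖(H a - H b) - (a - b)‖ ≤ κ * ‖a - b‖

theorem one_le_lipschitzExtensionConstant :
    (1 : ℝ≥0) ≤ lipschitzExtensionConstant (Euc d) := by
  rw [lipschitzExtensionConstant]
  exact le_max_right _ _

/-- Lipschitz-close embeddings differ by a homeomorphism of the ambient space close to the
identity: the displacement is extended to `ℝ^d` as a Lipschitz map. -/
theorem HasLowerBound.exists_homeomorph (hd : 1 ≤ d) {c L : ℝ} (hc : 0 < c) (hL : 0 ≤ L)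
    {φ ψ : frontier U → Euc d} (hφ : HasLowerBound U c φ)
    (hψ : HasLipBound U L (fun y => ψ y - φ y))
    (hs : lipschitzExtensionConstant (Euc d) * (L / c) < 1) :
    ∃ H : Euc d ≃ₜ Euc d, IsNearId (lipschitzExtensionConstant (Euc d) * (L / c)) H ∧
      ∀ y, H (φ y) = ψ y := by
  have hinj := hφ.injective hc
  let K : ℝ≥0 := ⟨L / c, by positivity⟩
  let e : Euc d → Euc d := Function.extend φ (fun y => ψ y - φ y) 0
  have he : ∀ y, e (φ y) = ψ y - φ y := fun y => hinj.extend_apply _ _ y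
  have hlip : LipschitzOnWith K e (range φ) := by
    refine LipschitzOnWith.of_dist_le_mul ?_
    rintro _ ⟨y, rfl⟩ _ ⟨z, rfl⟩
    rw [he, he, dist_eq_norm, dist_eq_norm]
    refine (hψ y z).trans ?_
    change L * dist y z ≤ L / c * ‖φ y - φ z‖
    rw [div_mul_eq_mul_div, le_div_iff₀ hc, mul_assoc, mul_comm (dist y z)]
    exact mul_le_mul_of_nonneg_left (hφ y z) hL
  obtain ⟨g, hg, hge⟩ := hlip.extend_finite_dimension
  set κ : ℝ≥0 := lipschitzExtensionConstant (Euc d) * K with hκ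
  have hκ1 : κ < 1 := by
    rw [← NNReal.coe_lt_coe]
    rw [hκ, NNReal.coe_mul]
    exact hs
  have happ : ApproximatesLinearOn (fun x => x + g x)
      ((ContinuousLinearEquiv.refl ℝ (Euc d) : Euc d ≃L[ℝ] Euc d) : Euc d →L[ℝ] Euc d) univ κ := by
    intro a _ b _
    have : a + g a - (b + g b) -
        ((ContinuousLinearEquiv.refl ℝ (Euc d) : Euc d ≃L[ℝ] Euc d) : Euc d →L[ℝ] Euc d) (a - b)
        = g a - g b := by
      simp only [ContinuousLinearEquiv.coe_refl, ContinuousLinearMap.id_apply]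
      abel
    rw [this, ← dist_eq_norm, ← dist_eq_norm]
    exact hg.dist_le_mul a b
  have : Nontrivial (Euc d) := by
    have : Nonempty (Fin d) := ⟨⟨0, hd⟩⟩
    infer_instance
  let H := happ.toHomeomorph _ (Or.inr (by simpa using hκ1))
  have hH : ∀ x, H x = x + g x := fun x => rfl
  refine ⟨H, fun a b => ?_, fun y => ?_⟩
  · have := happ a trivial b trivial
    exact this
  · rw [hH, ← hge ⟨y, rfl⟩, he]
    abel

theorem IsNearId.norm_le {κ : ℝ} {H : Euc d ≃ₜ Euc d} (h : IsNearId κ H) (a b : Euc d) :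
    ‖H a - H b‖ ≤ (1 + κ) * ‖a - b‖ := by
  have h1 := h a b
  have h2 := norm_add_le ((H a - H b) - (a - b)) (a - b)
  rw [sub_add_cancel] at h2
  linarith

theorem IsNearId.le_norm {κ : ℝ} {H : Euc d ≃ₜ Euc d} (h : IsNearId κ H) (a b : Euc d) :
    (1 - κ) * ‖a - b‖ ≤ ‖H a - H b‖ := by
  have h1 := h a b
  have h2 := norm_sub_le (H a - H b) ((H a - H b) - (a - b))
  rw [sub_sub_cancel] at h2
  linarith

theorem IsNearId.symm_norm_le {κ : ℝ} {H : Euc d ≃ₜ Euc d} (h : IsNearId κ H) (h0 : 0 ≤ κ)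
    (h1 : κ ≤ 1 / 2) (a b : Euc d) : ‖H.symm a - H.symm b‖ ≤ (1 + 2 * κ) * ‖a - b‖ := by
  have h2 := h.le_norm (H.symm a) (H.symm b)
  rw [H.apply_symm_apply, H.apply_symm_apply] at h2
  have h3 : 1 ≤ (1 + 2 * κ) * (1 - κ) := by nlinarith
  calc ‖H.symm a - H.symm b‖ ≤ ((1 + 2 * κ) * (1 - κ)) * ‖H.symm a - H.symm b‖ :=
        le_mul_of_one_le_left (norm_nonneg _) h3
    _ = (1 + 2 * κ) * ((1 - κ) * ‖H.symm a - H.symm b‖) := by ring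
    _ ≤ _ := mul_le_mul_of_nonneg_left h2 (by linarith)

theorem IsEnclosedRegion.image {D S : Set (Euc d)} (h : IsEnclosedRegion D S)
    (H : Euc d ≃ₜ Euc d) : IsEnclosedRegion (H '' D) (H '' S) := by
  obtain ⟨h1, h2, h3⟩ := h
  refine ⟨h1.image H.continuous, ?_, ?_⟩
  · rw [← H.image_interior, ← H.image_closure, h2]
  · rw [← H.image_frontier, h3]

theorem image_range_eq {φ ψ : frontier U → Euc d} {H : Euc d ≃ₜ Euc d}
    (h : ∀ y, H (φ y) = ψ y) : H '' range φ = range ψ := by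
  rw [← range_comp]
  exact congrArg range (funext h)

/-! ### Lipschitz dependence of the normal on the embedding -/

/-- The outward normals of `φ` and `ψ` are close if a homeomorphism of `ℝ^d` near the identity
carries `φ` to `ψ`. Both are orthogonal to nearly the same hyperplane, hence close up to sign; the
sign is the right one since the homeomorphism carries one enclosed region to the other. -/
theorem norm_outwardNormal_sub_le [CompactSpace (frontier U)] (hd : 1 ≤ d)
    (hM : IsHypersurface (frontier U)) {c c' L κ : ℝ} (hL : 0 ≤ L) (hLc : L ≤ c / 4)
    {φ ψ : frontier U → Euc d} (hφ : IsBiLipEmbedding U c φ) (hψ : IsBiLipEmbedding U c' ψ)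
    (hlip : HasLipBound U L (fun y => ψ y - φ y)) {H : Euc d ≃ₜ Euc d} (hH : IsNearId κ H)
    (hκ1 : κ ≤ 1 / 4) (hHφ : ∀ y, H (φ y) = ψ y) (y : frontier U) :
    ‖outwardNormal U ψ y - outwardNormal U φ y‖ ≤ 2 * (L / c) := by
  have hc := hφ.pos
  by_cases hD : ∃ D, IsEnclosedRegion D (range φ)
  swap
  · have hD' : ¬ ∃ D, IsEnclosedRegion D (range ψ) := by
      rintro ⟨D, hD'⟩
      have := hD'.image H.symm
      rw [← image_range_eq hHφ, ← image_comp, H.symm_comp_self, image_id] at this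
      exact hD ⟨_, this⟩
    rw [outwardNormal_eq_zero hD, outwardNormal_eq_zero hD', sub_zero, norm_zero]
    positivity
  obtain ⟨D, hD⟩ := hD
  have hD' : IsEnclosedRegion (H '' D) (range ψ) := by
    rw [← image_range_eq hHφ]; exact hD.image H
  obtain ⟨hn, hnA, -⟩ := hφ.isOutwardUnitNormal hd hM hD y
  obtain ⟨hn', hnB, D', hDD, hev⟩ := hψ.isOutwardUnitNormal hd hM hD' y
  have hDeq : D' = H '' D := IsEnclosedRegion.unique hd (by
    rintro _ ⟨m, rfl⟩
    exact hψ.exists_sideFunction hM m) hDD hD'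
  subst hDeq
  obtain ⟨W, h, hyW, Hs, hDW⟩ := hφ.exists_sideFunction_region hM hD y
  have hnh := Hs.outwardNormal_eq hd hM hφ hD hDW hyW
  set n := outwardNormal U φ y with hndef
  set n' := outwardNormal U ψ y with hndef'
  set q := L / c with hq
  have hq0 : 0 ≤ q := by positivity
  have hq1 : q ≤ 1 / 4 := by rw [hq, div_le_iff₀ hc]; linarith
  obtain ⟨v, hv, hdec⟩ := (hφ.isImmersion hM).exists_decomp hM hφ.isCk hn hnA n'
  set a := inner ℝ n n' with ha
  -- the part of `n'` tangent to `φ(M)` has norm at most `q`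
  have hAv : ‖tderiv U φ y v‖ ≤ q := by
    have e1 : inner ℝ (tderiv U φ y v) n' = ‖tderiv U φ y v‖ ^ 2 := by
      conv_lhs => rw [hdec]
      rw [inner_add_right, real_inner_smul_right, real_inner_comm, real_inner_comm n, hnA,
        mul_zero, add_zero, real_inner_self_eq_norm_sq]
    have e2 : inner ℝ (tderiv U φ y v) n' =
        -inner ℝ ((tderiv U (fun y => ψ y - φ y) y) v) n' := by
      rw [tderiv_sub hψ.isCk hφ.isCk, sub_apply, inner_sub_left,
        real_inner_comm n' (tderiv U ψ y v), hnB]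
      ring
    have e3 : ‖tderiv U (fun y => ψ y - φ y) y v‖ ≤ L * ‖v‖ :=
      (ContinuousLinearMap.le_opNorm _ _).trans (mul_le_mul_of_nonneg_right
        (hlip.norm_tderiv_le hM (hψ.isCk.sub hφ.isCk) hL y) (norm_nonneg v))
    have e4 := hφ.lower.le_norm_tderiv hM hφ.isCk y hv
    have e5 : ‖tderiv U φ y v‖ ^ 2 ≤ q * ‖tderiv U φ y v‖ := by
      rw [← e1, e2]
      have e6 := abs_real_inner_le_norm ((tderiv U (fun y => ψ y - φ y) y) v) n'
      rw [hn', mul_one] at e6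
      have e7 : L * ‖v‖ ≤ q * ‖tderiv U φ y v‖ := by
        rw [hq, div_mul_eq_mul_div, le_div_iff₀ hc]
        nlinarith
      linarith [neg_abs_le (inner ℝ ((tderiv U (fun y => ψ y - φ y) y) v) n')]
    by_contra hcon
    push Not at hcon
    nlinarith [norm_nonneg (tderiv U φ y v)]
  have hsq : ‖tderiv U φ y v‖ ^ 2 + a ^ 2 = 1 := by
    have e1 : ‖n'‖ ^ 2 = 1 := by rw [hn']; norm_num
    rw [← e1, ← real_inner_self_eq_norm_sq n']
    conv_rhs => rw [hdec]
    rw [inner_add_left, inner_add_right, inner_add_right, real_inner_smul_left,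
      real_inner_smul_left, real_inner_smul_right, real_inner_smul_right,
      real_inner_comm n (tderiv U φ y v), hnA, real_inner_self_eq_norm_sq,
      real_inner_self_eq_norm_sq, hn]
    ring
  -- the normals cannot be opposite, because `H` moves points only slightly
  have hapos : -(1 / 2) < a := by
    by_contra hcon
    push Not at hcon
    have h0 : h (φ y) = 0 := (Hs.mem_iff _ hyW).1 ⟨y, rfl⟩
    have hneg := eventually_pos_of_inner (h := fun z => -h z)
      (((Hs.contDiffAt _ hyW).differentiableAt (by simp)).neg) (by simp [h0])
      (Hs.neg.fderiv_ne _ hyW) (η := 1 / 16) (by norm_num)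
    have hlim : Tendsto (fun s : ℝ => H.symm (ψ y + s • n')) (𝓝[>] 0) (𝓝 (φ y)) := by
      have := (H.symm.continuous.tendsto (ψ y)).comp (tendsto_add_smul (ψ y) n')
      rwa [← hHφ y, H.symm_apply_apply, hHφ y] at this
    obtain ⟨s, hs1, hs2, hs3, hs0⟩ := (hev.and ((hlim.eventually hneg).and
      ((hlim.eventually (Hs.isOpen.mem_nhds hyW)).and self_mem_nhdsWithin))).exists
    have hs0' : (0 : ℝ) < s := hs0
    set z := H.symm (ψ y + s • n') with hz
    have hHz : H z = ψ y + s • n' := H.apply_symm_apply _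
    have hzD : z ∉ D := fun hzD => hs1.1 ⟨z, hzD, hHz⟩
    have e1 : ‖s • n' - (z - φ y)‖ ≤ κ * ‖z - φ y‖ := by
      have := hH z (φ y)
      rwa [hHz, hHφ, add_sub_cancel_left] at this
    set w := z - φ y with hw
    have e2 : ‖s • n'‖ = s := by rw [norm_smul, hn', mul_one, Real.norm_of_nonneg hs0'.le]
    have e3 : ‖w‖ ≤ s + κ * ‖w‖ := by
      have := norm_sub_le (s • n') (s • n' - w)
      rw [sub_sub_cancel, e2] at this
      linarith
    have e3' : s ≤ ‖w‖ + κ * ‖w‖ := by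
      have := norm_add_le w (s • n' - w)
      rw [add_sub_cancel, e2] at this
      linarith
    have hw0 : 0 < ‖w‖ := by
      by_contra hcon
      have : ‖w‖ = 0 := le_antisymm (not_lt.1 hcon) (norm_nonneg _)
      rw [this] at e3'
      linarith
    have e4 : inner ℝ n w ≤ s * a + κ * ‖w‖ := by
      have e5 : inner ℝ n w = s * a - inner ℝ n (s • n' - w) := by
        rw [inner_sub_right n (s • n') w, real_inner_smul_right]; ring
      have e6 := abs_real_inner_le_norm n (s • n' - w)
      rw [hn, one_mul] at e6
      rw [e5]
      linarith [neg_abs_le (inner ℝ n (s • n' - w))]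
    have := hs2 (by
      rw [unitGradient_neg, ← hnh, inner_neg_left]
      nlinarith)
    exact hzD ((hDW z hs3).2 (by linarith))
  have ha1 : 1 - q ^ 2 ≤ a := by
    have hq2 : ‖tderiv U φ y v‖ ^ 2 ≤ q ^ 2 := pow_le_pow_left₀ (norm_nonneg _) hAv 2
    have ha2 : 1 - q ^ 2 ≤ a ^ 2 := by linarith
    have ha0 : 0 ≤ a := by
      by_contra hcon
      push Not at hcon
      nlinarith
    have ha3 : a ^ 2 ≤ 1 := by nlinarith [sq_nonneg ‖tderiv U φ y v‖]
    nlinarith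
  have hfin : ‖n' - n‖ ^ 2 ≤ (2 * q) ^ 2 := by
    rw [norm_sub_sq_real, hn, hn', real_inner_comm]
    nlinarith
  exact (pow_le_pow_iff_left₀ (norm_nonneg _) (by positivity) two_ne_zero).1 hfin

/-! ### Lipschitz dependence of the surface measure on the embedding -/

theorem isBiLipEmbedding_measurableEmbedding [CompactSpace (frontier U)] {c : ℝ}
    {φ : frontier U → Euc d} (hφ : IsBiLipEmbedding U c φ) : MeasurableEmbedding φ :=
  (hφ.isCk.continuous.isClosedEmbedding hφ.injective).measurableEmbedding

/-- A Lipschitz map of `ℝ^d` carrying `φ` to `ψ` increases the `(d-1)`-dimensional measure by at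
most the `(d-1)`-st power of its Lipschitz constant. -/
theorem pullbackSurface_le [CompactSpace (frontier U)] (hd : 1 ≤ d) {c c' : ℝ} {r : ℝ≥0}
    {φ ψ : frontier U → Euc d} (hφ : IsBiLipEmbedding U c φ) (hψ : IsBiLipEmbedding U c' ψ)
    {T : Euc d → Euc d} (hT : LipschitzWith r T) (hTφ : ∀ y, T (φ y) = ψ y) :
    pullbackSurface U ψ ≤ ((r ^ (d - 1) : ℝ≥0) : ℝ≥0∞) • pullbackSurface U φ := by
  refine Measure.le_iff.2 fun s _ => ?_
  rw [Measure.smul_apply, pullbackSurface, pullbackSurface,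
    (isBiLipEmbedding_measurableEmbedding hψ).comap_apply,
    (isBiLipEmbedding_measurableEmbedding hφ).comap_apply]
  have h1 : ψ '' s = T '' (φ '' s) := by
    rw [← image_comp]
    exact image_congr fun y _ => (hTφ y).symm
  have hd0 : (0 : ℝ) ≤ (d : ℝ) - 1 := by
    have : (1 : ℝ) ≤ d := by exact_mod_cast hd
    linarith
  have h2 := hT.hausdorffMeasure_image_le hd0 (φ '' s)
  rw [h1]
  refine h2.trans (le_of_eq ?_)
  have h3 : (d : ℝ) - 1 = ((d - 1 : ℕ) : ℝ) := by rw [Nat.cast_sub hd, Nat.cast_one]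
  rw [h3, ENNReal.rpow_natCast, smul_eq_mul, ENNReal.coe_pow]

/-- Normalization squares the constant of comparability. There is no assumption that the masses are
finite and nonzero, because the two masses are zero or infinite together. -/
theorem normalize_le {X : Type*} [MeasurableSpace X] {μ ν : Measure X} {a : ℝ≥0} (ha : a ≠ 0)
    (h₁ : ν ≤ (a : ℝ≥0∞) • μ) (h₂ : μ ≤ (a : ℝ≥0∞) • ν) :
    (ν univ)⁻¹ • ν ≤ ((a ^ 2 : ℝ≥0) : ℝ≥0∞) • ((μ univ)⁻¹ • μ) := by
  have h3 : μ univ ≤ a * ν univ := by simpa using Measure.le_iff'.1 h₂ univ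
  have h4 : (ν univ)⁻¹ ≤ a * (μ univ)⁻¹ := by
    have h5 : (a * ν univ)⁻¹ ≤ (μ univ)⁻¹ := ENNReal.inv_le_inv.2 h3
    rw [ENNReal.mul_inv (Or.inl (by simpa using ha)) (Or.inl ENNReal.coe_ne_top)] at h5
    calc (ν univ)⁻¹ = a * ((a : ℝ≥0∞)⁻¹ * (ν univ)⁻¹) := by
          rw [← mul_assoc, ENNReal.mul_inv_cancel (by simpa using ha) ENNReal.coe_ne_top, one_mul]
      _ ≤ a * (μ univ)⁻¹ := by gcongr
  refine Measure.le_iff'.2 fun s => ?_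
  have h6 : ν s ≤ a * μ s := by simpa using Measure.le_iff'.1 h₁ s
  simp only [Measure.smul_apply, smul_eq_mul, ENNReal.coe_pow]
  calc (ν univ)⁻¹ * ν s ≤ (a * (μ univ)⁻¹) * (a * μ s) := by gcongr
    _ = a ^ 2 * ((μ univ)⁻¹ * μ s) := by ring

theorem surfaceProb_univ_le (φ : frontier U → Euc d) : surfaceProb U φ univ ≤ 1 := by
  rw [surfaceProb, Measure.smul_apply, smul_eq_mul]
  exact ENNReal.inv_mul_le_one _

instance (φ : frontier U → Euc d) : IsFiniteMeasure (surfaceProb U φ) :=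
  ⟨(surfaceProb_univ_le φ).trans_lt ENNReal.one_lt_top⟩

theorem norm_integral_surfaceProb_le (φ : frontier U → Euc d) {g : frontier U → Euc d} {b : ℝ}
    (hb0 : 0 ≤ b) (hb : ∀ y, ‖g y‖ ≤ b) : ‖∫ y, g y ∂(surfaceProb U φ)‖ ≤ b := by
  have h1 := norm_integral_le_of_norm_le_const (μ := surfaceProb U φ) (.of_forall hb)
  have h2 : (surfaceProb U φ).real univ ≤ 1 :=
    ENNReal.toReal_mono ENNReal.one_ne_top (surfaceProb_univ_le φ)
  exact h1.trans (mul_le_of_le_one_right hb0 h2)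

end Stability

section ComparableMeasures

open scoped NNReal

variable {X : Type*} [TopologicalSpace X] [CompactSpace X] [MeasurableSpace X] [BorelSpace X]
  {μ ν : Measure X} [IsFiniteMeasure μ]

theorem integral_sub_le_of_nonneg {a : ℝ≥0} (h : ν ≤ (a : ℝ≥0∞) • μ) (ha : 1 ≤ a)
    (hμ : μ univ ≤ 1) {f : X → ℝ} (hf : Continuous f) (h0 : ∀ x, 0 ≤ f x) {b : ℝ}
    (hb : ∀ x, f x ≤ b) (hb0 : 0 ≤ b) : ∫ x, f x ∂ν - ∫ x, f x ∂μ ≤ (a - 1) * b := by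
  have hint : Integrable f μ :=
    hf.integrable_of_hasCompactSupport (HasCompactSupport.of_compactSpace f)
  have h1 : ∫ x, f x ∂ν ≤ ∫ x, f x ∂((a : ℝ≥0∞) • μ) :=
    integral_mono_measure h (.of_forall h0) (hint.smul_measure ENNReal.coe_ne_top)
  rw [integral_smul_measure, ENNReal.coe_toReal, smul_eq_mul] at h1
  have h2 : ∫ x, f x ∂μ ≤ b := by
    have h3 : ∫ x, f x ∂μ ≤ ∫ _, b ∂μ := integral_mono hint (integrable_const b) hb
    rw [integral_const, smul_eq_mul] at h3
    have h4 : μ.real univ ≤ 1 := ENNReal.toReal_mono ENNReal.one_ne_top hμ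
    nlinarith
  have ha' : (1 : ℝ) ≤ a := by exact_mod_cast ha
  nlinarith

theorem integral_sub_le [IsFiniteMeasure ν] {a : ℝ≥0} (h : ν ≤ (a : ℝ≥0∞) • μ)
    (h' : μ ≤ (a : ℝ≥0∞) • ν) (ha : 1 ≤ a)
    (hμ : μ univ ≤ 1) (hν : ν univ ≤ 1) {f : X → ℝ} (hf : Continuous f) {b : ℝ}
    (hb : ∀ x, |f x| ≤ b) (hb0 : 0 ≤ b) : ∫ x, f x ∂ν - ∫ x, f x ∂μ ≤ 2 * (a - 1) * b := by
  have hp : Continuous fun x => max (f x) 0 := hf.max continuous_const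
  have hm : Continuous fun x => max (-f x) 0 := hf.neg.max continuous_const
  have h1 := integral_sub_le_of_nonneg h ha hμ hp (fun x => le_max_right _ _)
    (fun x => max_le ((le_abs_self _).trans (hb x)) hb0) hb0
  have h2 := integral_sub_le_of_nonneg h' ha hν hm (fun x => le_max_right _ _)
    (fun x => max_le ((neg_le_abs _).trans (hb x)) hb0) hb0
  have hsplit : ∀ (ρ : Measure X) [IsFiniteMeasure ρ],
      ∫ x, f x ∂ρ = ∫ x, max (f x) 0 ∂ρ - ∫ x, max (-f x) 0 ∂ρ := by
    intro ρ _
    rw [← integral_sub (hp.integrable_of_hasCompactSupport (HasCompactSupport.of_compactSpace _))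
      (hm.integrable_of_hasCompactSupport (HasCompactSupport.of_compactSpace _))]
    congr 1
    ext x
    rcases le_total (f x) 0 with h3 | h3
    · rw [max_eq_right h3, max_eq_left (by linarith)]; ring
    · rw [max_eq_left h3, max_eq_right (by linarith)]; ring
  rw [hsplit ν, hsplit μ]
  linarith

/-- Integrals against mutually comparable measures of mass at most one are close. -/
theorem norm_integral_sub_le [IsFiniteMeasure ν] {a : ℝ≥0} (h : ν ≤ (a : ℝ≥0∞) • μ)
    (h' : μ ≤ (a : ℝ≥0∞) • ν) (ha : 1 ≤ a) (hμ : μ univ ≤ 1) (hν : ν univ ≤ 1) {f : X → Euc d}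
    (hf : Continuous f) {b : ℝ} (hb : ∀ x, ‖f x‖ ≤ b) (hb0 : 0 ≤ b) :
    ‖∫ x, f x ∂ν - ∫ x, f x ∂μ‖ ≤ 2 * (a - 1) * b := by
  set w := ∫ x, f x ∂ν - ∫ x, f x ∂μ with hw
  have hint : ∀ (ρ : Measure X) [IsFiniteMeasure ρ], Integrable f ρ := fun ρ _ =>
    hf.integrable_of_hasCompactSupport (HasCompactSupport.of_compactSpace f)
  have h1 : ‖w‖ ^ 2 = ∫ x, inner ℝ w (f x) ∂ν - ∫ x, inner ℝ w (f x) ∂μ := by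
    rw [integral_inner (hint ν), integral_inner (hint μ), ← inner_sub_right, ← hw,
      real_inner_self_eq_norm_sq]
  have h2 := integral_sub_le h h' ha hμ hν (f := fun x => inner ℝ w (f x))
    (continuous_const.inner hf) (b := ‖w‖ * b)
    (fun x => (abs_real_inner_le_norm _ _).trans (mul_le_mul_of_nonneg_left (hb x) (norm_nonneg w)))
    (by positivity)
  rw [← h1] at h2
  have ha' : (1 : ℝ) ≤ a := by exact_mod_cast ha
  by_contra hcon
  push Not at hcon
  have h0 : 0 ≤ 2 * ((a : ℝ) - 1) * b := by
    have : 0 ≤ (a : ℝ) - 1 := by linarith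
    positivity
  have hw0 : 0 < ‖w‖ := h0.trans_lt hcon
  nlinarith

end ComparableMeasures

theorem one_add_pow_le {x : ℝ} (h0 : 0 ≤ x) (h1 : x ≤ 1) (n : ℕ) :
    (1 + x) ^ n ≤ 1 + (2 ^ n - 1) * x := by
  induction n with
  | zero => simp
  | succ n ih =>
    have h2 : (1 : ℝ) ≤ 2 ^ n := one_le_pow₀ (by norm_num)
    calc (1 + x) ^ (n + 1) = (1 + x) ^ n * (1 + x) := pow_succ _ _
      _ ≤ (1 + (2 ^ n - 1) * x) * (1 + x) := by gcongr
      _ ≤ 1 + (2 ^ (n + 1) - 1) * x := by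
        rw [pow_succ]
        nlinarith [mul_nonneg (sub_nonneg.2 h2) (mul_nonneg h0 (sub_nonneg.2 h1))]

/-! ### The momentum of an embedding -/

section Momentum

open scoped NNReal

variable {U : Set (Euc d)} [CompactSpace (frontier U)]

/-- The Banach space of `ℝ^d`-valued vector measures on `∂U`, realised as operators on the
continuous functions. -/
def Momentum (U : Set (Euc d)) [CompactSpace (frontier U)] : Type :=
  C(frontier U, ℝ) →L[ℝ] Euc d

instance : NormedAddCommGroup (Momentum U) :=
  inferInstanceAs (NormedAddCommGroup (C(frontier U, ℝ) →L[ℝ] Euc d))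

instance : NormedSpace ℝ (Momentum U) :=
  inferInstanceAs (NormedSpace ℝ (C(frontier U, ℝ) →L[ℝ] Euc d))

instance : CompleteSpace (Momentum U) :=
  inferInstanceAs (CompleteSpace (C(frontier U, ℝ) →L[ℝ] Euc d))

/-- The pairing of a vector measure with a continuous function. -/
def Momentum.pairing (U : Set (Euc d)) [CompactSpace (frontier U)] :
    Momentum U →L[ℝ] C(frontier U, ℝ) →L[ℝ] Euc d :=
  ContinuousLinearMap.id ℝ (C(frontier U, ℝ) →L[ℝ] Euc d)

theorem Momentum.norm_pairing_le (m : Momentum U) (f : C(frontier U, ℝ)) :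
    ‖Momentum.pairing U m f‖ ≤ ‖m‖ * ‖f‖ :=
  ContinuousLinearMap.le_opNorm (Momentum.pairing U m) f

theorem Momentum.norm_le_of_pairing (m : Momentum U) {C : ℝ} (hC : 0 ≤ C)
    (h : ∀ f, ‖Momentum.pairing U m f‖ ≤ C * ‖f‖) : ‖m‖ ≤ C :=
  ContinuousLinearMap.opNorm_le_bound (Momentum.pairing U m) hC h

open Classical in
/-- The vector measure `n^φ T^φ`; it is set to zero if integration against it does not define a
bounded operator, which never happens for a bi-Lipschitz `C^1` embedding. -/
def momentum (U : Set (Euc d)) [CompactSpace (frontier U)] (φ : frontier U → Euc d) : Momentum U :=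
  if h : ∃ m : Momentum U, ∀ f : C(frontier U, ℝ),
    Momentum.pairing U m f = ∫ y, f y • outwardNormal U φ y ∂(surfaceProb U φ) then h.choose else 0

theorem IsBiLipEmbedding.integrable (hd : 1 ≤ d) (hM : IsHypersurface (frontier U)) {c : ℝ}
    {φ : frontier U → Euc d} (hφ : IsBiLipEmbedding U c φ) (f : C(frontier U, ℝ))
    (ρ : Measure (frontier U)) [IsFiniteMeasure ρ] :
    Integrable (fun y => f y • outwardNormal U φ y) ρ :=
  (f.continuous.smul (hφ.continuous_outwardNormal hd hM)).integrable_of_hasCompactSupport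
    (HasCompactSupport.of_compactSpace _)

theorem norm_smul_outwardNormal_le (φ : frontier U → Euc d) (f : C(frontier U, ℝ))
    (y : frontier U) : ‖f y • outwardNormal U φ y‖ ≤ ‖f‖ := by
  rw [norm_smul]
  exact (mul_le_mul (f.norm_coe_le_norm y) (norm_outwardNormal_le φ y) (norm_nonneg _)
    (norm_nonneg _)).trans (mul_one _).le

theorem IsBiLipEmbedding.momentum_apply (hd : 1 ≤ d) (hM : IsHypersurface (frontier U)) {c : ℝ}
    {φ : frontier U → Euc d} (hφ : IsBiLipEmbedding U c φ) (f : C(frontier U, ℝ)) :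
    Momentum.pairing U (momentum U φ) f = ∫ y, f y • outwardNormal U φ y ∂(surfaceProb U φ) := by
  have hex : ∃ m : Momentum U, ∀ f : C(frontier U, ℝ),
      Momentum.pairing U m f = ∫ y, f y • outwardNormal U φ y ∂(surfaceProb U φ) := by
    refine ⟨LinearMap.mkContinuous
      { toFun := fun f => ∫ y, f y • outwardNormal U φ y ∂(surfaceProb U φ)
        map_add' := fun f g => ?_
        map_smul' := fun r f => ?_ } 1 fun f => ?_, fun f => rfl⟩
    · rw [← integral_add (hφ.integrable hd hM f _) (hφ.integrable hd hM g _)]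
      simp only [ContinuousMap.add_apply, add_smul]
    · rw [RingHom.id_apply, ← integral_smul]
      simp only [ContinuousMap.smul_apply, smul_eq_mul, mul_smul]
    · rw [one_mul]
      exact norm_integral_surfaceProb_le φ (norm_nonneg f) (norm_smul_outwardNormal_le φ f)
  rw [momentum, dif_pos hex]
  exact hex.choose_spec f

theorem norm_momentum_le (φ : frontier U → Euc d) : ‖momentum U φ‖ ≤ 1 := by
  rw [momentum]
  split_ifs with h
  · refine Momentum.norm_le_of_pairing _ zero_le_one fun f => ?_
    rw [h.choose_spec f, one_mul]
    exact norm_integral_surfaceProb_le φ (norm_nonneg f) (norm_smul_outwardNormal_le φ f)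
  · refine Momentum.norm_le_of_pairing _ zero_le_one fun f => ?_
    rw [map_zero, zero_apply, norm_zero, one_mul]
    exact norm_nonneg f

/-- The momentum depends Lipschitz continuously on the embedding, for the Lipschitz seminorm. -/
theorem exists_momentum_lipschitz (hd : 1 ≤ d) (hM : IsHypersurface (frontier U)) {c : ℝ}
    (hc : 0 < c) : ∃ C δ : ℝ, 0 < C ∧ 0 < δ ∧ ∀ (φ ψ : frontier U → Euc d) (L : ℝ),
      IsBiLipEmbedding U c φ → IsCk U 1 ψ → 0 ≤ L → L ≤ δ →
      HasLipBound U L (fun y => ψ y - φ y) → ‖momentum U ψ - momentum U φ‖ ≤ C * L := by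
  set Λ : ℝ := ((lipschitzExtensionConstant (Euc d) : ℝ≥0) : ℝ) with hΛ
  have hΛ1 : 1 ≤ Λ := by exact_mod_cast one_le_lipschitzExtensionConstant (d := d)
  have hΛ0 : 0 < Λ := by linarith
  set n := (d - 1) * 2 with hn
  refine ⟨2 / c + 2 * (2 ^ n * (2 * (Λ / c))), c / (4 * Λ), by positivity, by positivity, ?_⟩
  intro φ ψ L hφ hψ hL hLδ hlip
  have hLc : L ≤ c / 4 := hLδ.trans (by
    rw [div_le_div_iff₀ (by positivity) (by norm_num)]; nlinarith)
  have hψ' : IsBiLipEmbedding U (c - L) ψ := ⟨hψ, by linarith, hφ.lower.perturb hlip⟩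
  set κ := Λ * (L / c) with hκ
  have hκ0 : 0 ≤ κ := by positivity
  have hκ1 : κ ≤ 1 / 4 := by
    have h2 : L * (4 * Λ) ≤ c := (le_div_iff₀ (by positivity)).1 hLδ
    rw [hκ, ← mul_div_assoc, div_le_iff₀ hc]
    linarith
  obtain ⟨H, hH, hHφ⟩ := hφ.lower.exists_homeomorph hd hc hL hlip (by
    rw [← hΛ, ← hκ]; linarith)
  rw [← hΛ, ← hκ] at hH
  let r : ℝ≥0 := ⟨1 + 2 * κ, by positivity⟩
  have hr1 : 1 ≤ r := by
    rw [← NNReal.coe_le_coe]; change (1 : ℝ) ≤ 1 + 2 * κ; linarith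
  have hHl : LipschitzWith r H := LipschitzWith.of_dist_le_mul fun a b => by
    rw [dist_eq_norm, dist_eq_norm]
    refine (hH.norm_le a b).trans (mul_le_mul_of_nonneg_right ?_ (norm_nonneg _))
    change 1 + κ ≤ 1 + 2 * κ
    linarith
  have hHsl : LipschitzWith r H.symm := LipschitzWith.of_dist_le_mul fun a b => by
    rw [dist_eq_norm, dist_eq_norm]
    exact hH.symm_norm_le hκ0 (by linarith) a b
  have hm1 := pullbackSurface_le hd hφ hψ' hHl hHφ
  have hm2 := pullbackSurface_le hd hψ' hφ hHsl fun y => by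
    rw [← hHφ, H.symm_apply_apply]
  have hr0 : r ^ (d - 1) ≠ 0 := pow_ne_zero _ (by
    intro h0; rw [h0] at hr1; exact absurd hr1 (by norm_num))
  have ht1 := normalize_le hr0 hm1 hm2
  have ht2 := normalize_le hr0 hm2 hm1
  have hone : 1 ≤ (r ^ (d - 1)) ^ 2 := one_le_pow₀ (one_le_pow₀ hr1)
  have hrn : (((r ^ (d - 1)) ^ 2 : ℝ≥0) : ℝ) - 1 ≤ 2 ^ n * (2 * κ) := by
    rw [← pow_mul, NNReal.coe_pow]
    change (1 + 2 * κ) ^ n - 1 ≤ _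
    have := one_add_pow_le (x := 2 * κ) (by positivity) (by linarith) n
    nlinarith
  refine Momentum.norm_le_of_pairing _ (by positivity) fun f => ?_
  rw [map_sub, sub_apply, hψ'.momentum_apply hd hM, hφ.momentum_apply hd hM]
  have hd1 : ‖∫ y, f y • outwardNormal U ψ y ∂(surfaceProb U ψ) -
      ∫ y, f y • outwardNormal U φ y ∂(surfaceProb U ψ)‖ ≤ ‖f‖ * (2 * (L / c)) := by
    rw [← integral_sub (hψ'.integrable hd hM f _) (hφ.integrable hd hM f _)]
    refine norm_integral_surfaceProb_le ψ (by positivity) fun y => ?_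
    rw [← smul_sub, norm_smul]
    exact mul_le_mul (f.norm_coe_le_norm y)
      (norm_outwardNormal_sub_le hd hM hL hLc hφ hψ' hlip hH hκ1 hHφ y) (norm_nonneg _)
      (norm_nonneg _)
  have hd2 : ‖∫ y, f y • outwardNormal U φ y ∂(surfaceProb U ψ) -
      ∫ y, f y • outwardNormal U φ y ∂(surfaceProb U φ)‖ ≤ 2 * (2 ^ n * (2 * κ)) * ‖f‖ := by
    refine (norm_integral_sub_le ht1 ht2 hone (surfaceProb_univ_le φ) (surfaceProb_univ_le ψ)
      (f.continuous.smul (hφ.continuous_outwardNormal hd hM))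
      (norm_smul_outwardNormal_le φ f) (norm_nonneg f)).trans ?_
    gcongr
  calc _ ≤ ‖f‖ * (2 * (L / c)) + 2 * (2 ^ n * (2 * κ)) * ‖f‖ := by
        refine le_trans ?_ (add_le_add hd1 hd2)
        rw [← sub_add_sub_cancel _ (∫ y, f y • outwardNormal U φ y ∂(surfaceProb U ψ)) _]
        exact norm_add_le _ _
    _ = _ := by rw [hκ]; ring

end Momentum

/-! ### Smoothness of the kernel as a curve of continuous functions -/

section Kernel

/-- A jointly continuous function, viewed as a map into the continuous functions of the second
variable in `∂U`. -/
def kernelCurve {E : Type*} [TopologicalSpace E] (U : Set (Euc d)) (g : C(Euc d × Euc d, E))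
    (x : Euc d) : C(frontier U, E) :=
  ⟨fun y => g (x, y), by fun_prop⟩

theorem continuous_kernelCurve {E : Type*} [NormedAddCommGroup E] {U : Set (Euc d)}
    (g : C(Euc d × Euc d, E)) : Continuous (kernelCurve U g) := by
  have : Continuous (Function.uncurry fun (x : Euc d) (y : frontier U) => g (x, (y : Euc d))) := by
    fun_prop
  exact ContinuousMap.continuous_of_continuous_uncurry _ this

variable {U : Set (Euc d)} [CompactSpace (frontier U)]

/-- Interchange of the order of evaluation for a continuous family of operators. -/
def evalFlip (U : Set (Euc d)) [CompactSpace (frontier U)] (F : Type*) [NormedAddCommGroup F]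
    [NormedSpace ℝ F] : C(frontier U, Euc d →L[ℝ] F) →L[ℝ] (Euc d →L[ℝ] C(frontier U, F)) :=
  LinearMap.mkContinuous₂
    (LinearMap.mk₂ ℝ (fun (A : C(frontier U, Euc d →L[ℝ] F)) (v : Euc d) =>
        (⟨fun y => A y v, by fun_prop⟩ : C(frontier U, F)))
      (fun A B v => by ext y; simp) (fun r A v => by ext y; simp)
      (fun A v w => by ext y; simp) (fun r A v => by ext y; simp)) 1
    (fun A v => by
      rw [one_mul]
      refine (ContinuousMap.norm_le _ (by positivity)).2 fun y => ?_
      exact ((A y).le_opNorm v).trans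
        (mul_le_mul_of_nonneg_right (A.norm_coe_le_norm y) (norm_nonneg v)))

/-- The partial derivative in the first variable. -/
def fderivFst (g : C(Euc d × Euc d, F)) (hg : ContDiff ℝ ∞ g) :
    C(Euc d × Euc d, Euc d →L[ℝ] F) :=
  ⟨fun p => (fderiv ℝ g p).comp (ContinuousLinearMap.inl ℝ (Euc d) (Euc d)),
    (hg.continuous_fderiv (by simp)).clm_comp continuous_const⟩

theorem contDiff_fderivFst (g : C(Euc d × Euc d, F)) (hg : ContDiff ℝ ∞ g) :
    ContDiff ℝ ∞ (fderivFst g hg) :=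
  (hg.fderiv_right (m := ∞) (by simp)).clm_comp contDiff_const

theorem hasFDerivAt_kernelCurve (g : C(Euc d × Euc d, F)) (hg : ContDiff ℝ ∞ g) (x : Euc d) :
    HasFDerivAt (kernelCurve U g) (evalFlip U F (kernelCurve U (fderivFst g hg) x)) x := by
  rw [hasFDerivAt_iff_isLittleO, Asymptotics.isLittleO_iff]
  intro ε hε
  obtain ⟨δ, hδ, hball⟩ := Metric.continuousAt_iff.1
    (continuous_kernelCurve (U := U) (fderivFst g hg)).continuousAt ε hε
  filter_upwards [Metric.ball_mem_nhds x hδ] with z hz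
  refine (ContinuousMap.norm_le _ (by positivity)).2 fun y => ?_
  have hd : ∀ w : Euc d, HasFDerivAt (fun w : Euc d => g (w, (y : Euc d)))
      (fderivFst g hg (w, y)) w := fun w => by
    have h1 := (hg.differentiable (by simp) (w, (y : Euc d))).hasFDerivAt
    exact h1.comp w (hasFDerivAt_prodMk_left w (y : Euc d))
  have hbd : ∀ w ∈ Metric.ball x δ, ‖fderivFst g hg (w, y) - fderivFst g hg (x, y)‖ ≤ ε :=
    fun w hw => by
      rw [← dist_eq_norm]
      exact (ContinuousMap.dist_apply_le_dist (f := kernelCurve U (fderivFst g hg) w)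
        (g := kernelCurve U (fderivFst g hg) x) y).trans (hball hw).le
  exact (convex_ball x δ).norm_image_sub_le_of_norm_hasFDerivWithin_le'
    (fun w _ => (hd w).hasFDerivWithinAt) hbd (Metric.mem_ball_self hδ) hz

theorem contDiff_kernelCurve_nat (n : ℕ) : ∀ {F : Type*} [NormedAddCommGroup F] [NormedSpace ℝ F]
    (g : C(Euc d × Euc d, F)), ContDiff ℝ ∞ g → ContDiff ℝ n (kernelCurve U g) := by
  induction n with
  | zero =>
    intro F _ _ g hg
    exact contDiff_zero.2 (continuous_kernelCurve g)
  | succ n ih =>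
    intro F _ _ g hg
    rw [Nat.cast_succ, contDiff_succ_iff_hasFDerivAt]
    exact ⟨_, (evalFlip U F).contDiff.comp (ih (fderivFst g hg) (contDiff_fderivFst g hg)),
      hasFDerivAt_kernelCurve g hg⟩

/-- A smooth kernel is a smooth map from `∂U` to the continuous functions on `∂U`. -/
theorem IsSmoothKernel.exists_sections {K : frontier U → frontier U → ℝ}
    (hK : IsSmoothKernel U K) : ∃ k : frontier U → C(frontier U, ℝ), IsCk U ∞ k ∧
      ∀ x y, k x y = K x y := by
  obtain ⟨g, hg, hgK⟩ := hK
  let g' : C(Euc d × Euc d, ℝ) := ⟨g, hg.continuous⟩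
  refine ⟨fun x => kernelCurve U g' x, ⟨kernelCurve U g', ?_, fun _ => rfl⟩, hgK⟩
  exact contDiff_infty.2 fun n => contDiff_kernelCurve_nat n g' hg

theorem IsCk.exists_hasLipBound (hM : IsHypersurface (frontier U)) {k : frontier U → F}
    (hk : IsCk U 1 k) : ∃ L : ℝ, 0 ≤ L ∧ HasLipBound U L k := by
  obtain ⟨C, hC, h⟩ := exists_lipBound (F := F) hM
  have hk' : IsCk U ((0 + 1 : ℕ) : WithTop ℕ∞) k := by simpa using hk
  have hc : Continuous fun y => ‖k y‖ + ‖tderiv U k y‖ :=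
    hk.continuous.norm.add (hk'.tderiv_nat hM).continuous.norm
  obtain ⟨B, hB⟩ := isCompact_univ.exists_bound_of_continuousOn hc.continuousOn
  have hB' : ∀ y, ‖k y‖ + ‖tderiv U k y‖ ≤ max B 0 := fun y =>
    ((le_abs_self _).trans (hB y trivial)).trans (le_max_left _ _)
  refine ⟨C * max B 0, by positivity, h k hk _ (le_max_right _ _) (fun y => ?_) (fun y => ?_)⟩
  · linarith [hB' y, norm_nonneg (tderiv U k y)]
  · linarith [hB' y, norm_nonneg (k y)]

end Kernel

/-! ### The flow as an ordinary differential equation for the accumulated momentum -/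

section Flow

open scoped NNReal

variable {U : Set (Euc d)} [CompactSpace (frontier U)]

theorem natCast_le_infty (n : ℕ) : (n : WithTop ℕ∞) ≤ (∞ : WithTop ℕ∞) := by
  exact_mod_cast le_top

/-- The configuration reached from `Φ₀` after the accumulated momentum `m`. -/
def displaced (Φ₀ : frontier U → Euc d) (k : frontier U → C(frontier U, ℝ)) (m : Momentum U) :
    frontier U → Euc d :=
  fun x => Φ₀ x + Momentum.pairing U m (k x)

theorem displaced_sub_hasLipBound {Φ₀ : frontier U → Euc d} {k : frontier U → C(frontier U, ℝ)}
    {L : ℝ} (hk : HasLipBound U L k) (m m' : Momentum U) :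
    HasLipBound U (L * ‖m - m'‖) (fun x => displaced Φ₀ k m x - displaced Φ₀ k m' x) := by
  intro y z
  have e : displaced Φ₀ k m y - displaced Φ₀ k m' y - (displaced Φ₀ k m z - displaced Φ₀ k m' z) =
      Momentum.pairing U (m - m') (k y - k z) := by
    simp only [displaced, sub_apply, map_sub]
    abel
  rw [e]
  calc _ ≤ ‖m - m'‖ * ‖k y - k z‖ := Momentum.norm_pairing_le _ _
    _ ≤ ‖m - m'‖ * (L * dist y z) := mul_le_mul_of_nonneg_left (hk y z) (norm_nonneg _)
    _ = _ := by ring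

theorem displaced_zero (Φ₀ : frontier U → Euc d) (k : frontier U → C(frontier U, ℝ)) :
    displaced Φ₀ k 0 = Φ₀ := by
  funext x
  simp [displaced]

theorem isCk_momentum_apply {k : frontier U → C(frontier U, ℝ)} {n : WithTop ℕ∞} (hk : IsCk U n k)
    (m : Momentum U) : IsCk U n (fun x => Momentum.pairing U m (k x)) :=
  hk.clm_comp (Momentum.pairing U m)

/-- A ball of momenta on which the flow equation is solved: all configurations reached there are
embeddings, and the vector field is Lipschitz. -/
structure IsFlowBall (U : Set (Euc d)) [CompactSpace (frontier U)] (Φ₀ : frontier U → Euc d)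
    (k : frontier U → C(frontier U, ℝ)) (r : ℝ) (C : ℝ≥0) : Prop where
  pos : 0 < r
  embeds : ∀ m : Momentum U, ‖m‖ ≤ r → displaced Φ₀ k m ∈ embeddings U 10
  lipschitz : LipschitzOnWith C (fun m => momentum U (displaced Φ₀ k m))
    (Metric.closedBall (0 : Momentum U) r)

/-- Displacements by small momenta have small Lipschitz constants, which keeps the configurations
uniformly bi-Lipschitz embedded. -/
theorem exists_isFlowBall (hd : 1 ≤ d) (hM : IsHypersurface (frontier U))
    {Φ₀ : frontier U → Euc d} (hΦ₀ : Φ₀ ∈ embeddings U 10) {k : frontier U → C(frontier U, ℝ)}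
    (hk : IsCk U ∞ k) : ∃ r C, IsFlowBall U Φ₀ k r C := by
  have h1 : (1 : WithTop ℕ∞) ≤ (∞ : WithTop ℕ∞) := by
    exact_mod_cast natCast_le_infty 1
  obtain ⟨L, hL, hkL⟩ := IsCk.exists_hasLipBound hM (hk.of_le h1)
  obtain ⟨c, hc, hlow⟩ := exists_hasLowerBound_of_mem_embeddings hM hΦ₀
  obtain ⟨C, δ, hC, hδ, hmom⟩ := exists_momentum_lipschitz hd hM (half_pos hc)
  have hΦ1 : IsCk U 1 Φ₀ := hΦ₀.1.1.of_le (one_le_natCast_succ 9)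
  set r := min (c / 2) (δ / 2) / (L + 1) with hr
  have hr0 : 0 < r := by positivity
  have hLr : L * r ≤ min (c / 2) (δ / 2) := by
    rw [hr, ← mul_div_assoc, div_le_iff₀ (by positivity)]
    have : 0 < min (c / 2) (δ / 2) := by positivity
    nlinarith
  have hlip0 : ∀ m : Momentum U, ‖m‖ ≤ r →
      HasLipBound U (c / 2) (fun x => Momentum.pairing U m (k x)) := by
    intro m hm y z
    have := displaced_sub_hasLipBound (Φ₀ := Φ₀) hkL m 0 y z
    rw [displaced_zero, sub_zero] at this
    simp only [displaced, add_sub_cancel_left] at this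
    refine this.trans (mul_le_mul_of_nonneg_right ?_ dist_nonneg)
    exact (mul_le_mul_of_nonneg_left hm hL).trans (hLr.trans (min_le_left _ _))
  have hbi : ∀ m : Momentum U, ‖m‖ ≤ r → IsBiLipEmbedding U (c / 2) (displaced Φ₀ k m) := by
    intro m hm
    refine ⟨hΦ1.add (isCk_momentum_apply (hk.of_le h1) m), half_pos hc, ?_⟩
    have := hlow.perturb (ψ := displaced Φ₀ k m) (L := c / 2)
      (by simpa [displaced] using hlip0 m hm)
    rwa [sub_half] at this
  refine ⟨r, ⟨C * L, by positivity⟩, hr0, fun m hm => ?_, ?_⟩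
  · exact add_mem_embeddings hM hΦ₀ hlow (half_lt_self hc) (isCk_momentum_apply hk m) (hlip0 m hm)
  · refine LipschitzOnWith.of_dist_le_mul fun m hm m' hm' => ?_
    rw [mem_closedBall_zero_iff] at hm hm'
    rw [dist_eq_norm, dist_eq_norm]
    have hmm : ‖m - m'‖ ≤ 2 * r := (norm_sub_le _ _).trans (by linarith)
    have := hmom _ _ (L * ‖m - m'‖) (hbi m' hm') (hbi m hm).isCk (by positivity) (by
      have := mul_le_mul_of_nonneg_left hmm hL
      linarith [min_le_right (c / 2) (δ / 2)]) (displaced_sub_hasLipBound hkL m m')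
    rw [← mul_assoc] at this
    exact this

theorem exists_isBiLipEmbedding (hM : IsHypersurface (frontier U)) {φ : frontier U → Euc d}
    (hφ : φ ∈ embeddings U 10) : ∃ c, IsBiLipEmbedding U c φ := by
  obtain ⟨c, hc, h⟩ := exists_hasLowerBound_of_mem_embeddings hM hφ
  exact ⟨c, hφ.1.1.of_le (one_le_natCast_succ 9), hc, h⟩

theorem momentum_apply_of_mem (hd : 1 ≤ d) (hM : IsHypersurface (frontier U))
    {φ : frontier U → Euc d} (hφ : φ ∈ embeddings U 10) (f : C(frontier U, ℝ)) :
    Momentum.pairing U (momentum U φ) f = ∫ y, f y • outwardNormal U φ y ∂(surfaceProb U φ) := by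
  obtain ⟨c, hc⟩ := exists_isBiLipEmbedding hM hφ
  exact hc.momentum_apply hd hM f

theorem ckConv_of_tendsto {U : Set (Euc d)} {ι : Type*} {l : Filter ι} {a : ι → F} {b : F}
    (h : Tendsto a l (𝓝 b)) (n : ℕ) :
    CkConv U l n (fun i _ => a i) (fun _ => b) := by
  have h0 : TendstoUniformly (fun i (_ : frontier U) => a i) (fun _ => b) l := by
    rw [Metric.tendstoUniformly_iff]
    intro ε hε
    filter_upwards [Metric.tendsto_nhds.1 h ε hε] with i hi y
    rwa [dist_comm]
  cases n with
  | zero => exact h0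
  | succ n =>
    refine ⟨h0, fun i => ?_⟩
    simp only [tpartial_const]
    exact ckConv_const n _

/-- A continuous path of momenta gives a path of embeddings that is continuous for `ckDist`. -/
theorem tendsto_ckDist_displaced {ι : Type*} {l : Filter ι} (hM : IsHypersurface (frontier U))
    {Φ₀ : frontier U → Euc d} (hΦ₀ : IsCk U ((9 + 1 : ℕ) : WithTop ℕ∞) Φ₀)
    {k : frontier U → C(frontier U, ℝ)}
    (hk : IsCk U ∞ k) {m : ι → Momentum U} {m₀ : Momentum U} (hm : Tendsto m l (𝓝 m₀))
    (hmem : ∀ᶠ i in l, displaced Φ₀ k (m i) ∈ embeddings U 10)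
    (hmem₀ : displaced Φ₀ k m₀ ∈ embeddings U 10) :
    Tendsto (fun i => ckDist U 10 (displaced Φ₀ k (m i)) (displaced Φ₀ k m₀)) l (𝓝 0) := by
  have hk' : IsCk U ((9 + 1 : ℕ) : WithTop ℕ∞) k := hk.of_le (natCast_le_infty _)
  have h1 : CkConv U l (9 + 1) (fun i x => Momentum.pairing U (m i) (k x))
      (fun x => Momentum.pairing U m₀ (k x)) :=
    CkConv.bilin hM (ckConv_of_tendsto hm _) (ckConv_const _ k)
      (.of_forall fun _ => isCk_const _) (isCk_const _) (.of_forall fun _ => hk') hk'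
      (Momentum.pairing U)
  have h2 : CkConv U l (9 + 1) (fun i => displaced Φ₀ k (m i)) (displaced Φ₀ k m₀) :=
    (ckConv_const _ Φ₀).add hM h1 (.of_forall fun _ => hΦ₀) hΦ₀
      (.of_forall fun i => isCk_momentum_apply hk' (m i)) (isCk_momentum_apply hk' m₀)
  have himm : ∀ φ ∈ embeddings U 10, IsCk U ((9 + 1 : ℕ) : WithTop ℕ∞) φ ∧ IsImmersion U φ :=
    fun φ hφ => ⟨hφ.1.1, isImmersion_of_mem_completedEmbeddings hM hφ.1⟩
  exact h2.tendsto_ckDist hM (hmem.mono fun i hi => himm _ hi) (himm _ hmem₀).1 (himm _ hmem₀).2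

theorem mem_timeInterval_ofReal {r t : ℝ} :
    t ∈ timeInterval (ENNReal.ofReal r) ↔ 0 ≤ t ∧ t < r := by
  constructor
  · rintro ⟨h0, h1⟩
    exact ⟨h0, (ENNReal.ofReal_lt_ofReal_iff_of_nonneg h0).1 h1⟩
  · rintro ⟨h0, h1⟩
    exact ⟨h0, (ENNReal.ofReal_lt_ofReal_iff_of_nonneg h0).2 h1⟩

/-- Solving the ordinary differential equation for the momentum. -/
theorem IsFlowBall.exists_momentum_path {Φ₀ : frontier U → Euc d}
    {k : frontier U → C(frontier U, ℝ)} {r : ℝ} {C : ℝ≥0} (h : IsFlowBall U Φ₀ k r C) :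
    ∃ α : ℝ → Momentum U, α 0 = 0 ∧ ∀ t ∈ Icc 0 r,
      HasDerivWithinAt α (momentum U (displaced Φ₀ k (α t))) (Icc 0 r) t ∧ ‖α t‖ ≤ r := by
  have hr := h.pos
  have hPL : IsPicardLindelof (fun _ m => momentum U (displaced Φ₀ k m)) (tmin := 0) (tmax := r)
      ⟨0, le_rfl, hr.le⟩ (0 : Momentum U) (⟨r, hr.le⟩ : ℝ≥0) 0 1 C :=
    IsPicardLindelof.of_time_independent (fun m _ => norm_momentum_le _) h.lipschitz (by
      change ((1 : ℝ≥0) : ℝ) * max (r - 0) (0 - 0) ≤ r - 0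
      simp [hr.le])
  obtain ⟨α, h0, hα⟩ := hPL.exists_eq_forall_mem_Icc_hasDerivWithinAt₀
  refine ⟨α, h0, fun t ht => ⟨hα t ht, ?_⟩⟩
  have := norm_image_sub_le_of_norm_deriv_le_segment' (C := 1) hα
    (fun s _ => norm_momentum_le _) t ht
  rw [show α 0 = 0 from h0, sub_zero] at this
  linarith [ht.2]

theorem IsFlowBall.continuousOn_velocity {Φ₀ : frontier U → Euc d}
    {k : frontier U → C(frontier U, ℝ)} {r : ℝ} {C : ℝ≥0} (h : IsFlowBall U Φ₀ k r C)
    {α : ℝ → Momentum U} {s : Set ℝ} (hα : ContinuousOn α s) (hb : ∀ t ∈ s, ‖α t‖ ≤ r) :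
    ContinuousOn (fun t => momentum U (displaced Φ₀ k (α t))) s :=
  h.lipschitz.continuousOn.comp hα fun t ht => mem_closedBall_zero_iff.2 (hb t ht)

theorem IsFlowBall.isFlowSolution (hd : 1 ≤ d) (hM : IsHypersurface (frontier U))
    {K : frontier U → frontier U → ℝ} {Φ₀ : frontier U → Euc d} (hΦ₀ : Φ₀ ∈ embeddings U 10)
    {k : frontier U → C(frontier U, ℝ)} (hk : IsCk U ∞ k) (hkK : ∀ x y, k x y = K x y)
    {r : ℝ} {C : ℝ≥0} (h : IsFlowBall U Φ₀ k r C) {α : ℝ → Momentum U} (h0 : α 0 = 0)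
    (hα : ∀ t ∈ Icc 0 r,
      HasDerivWithinAt α (momentum U (displaced Φ₀ k (α t))) (Icc 0 r) t ∧ ‖α t‖ ≤ r) :
    IsFlowSolution U K Φ₀ (ENNReal.ofReal r) (fun t => displaced Φ₀ k (α t)) := by
  have hsub : timeInterval (ENNReal.ofReal r) ⊆ Icc 0 r := fun t ht =>
    ⟨(mem_timeInterval_ofReal.1 ht).1, (mem_timeInterval_ofReal.1 ht).2.le⟩
  have hmem : ∀ t ∈ Icc 0 r, displaced Φ₀ k (α t) ∈ embeddings U 10 := fun t ht =>
    h.embeds _ (hα t ht).2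
  have hαc : ContinuousOn α (Icc 0 r) := fun t ht => (hα t ht).1.continuousWithinAt
  refine ⟨fun t ht => hmem t (hsub ht), fun t ht => ?_, ?_, fun t ht x => ?_⟩
  · refine tendsto_ckDist_displaced hM hΦ₀.1.1 hk ((hαc t (hsub ht)).mono hsub) ?_
      (hmem t (hsub ht))
    filter_upwards [self_mem_nhdsWithin] with s hs using hmem s (hsub hs)
  · simp only [h0, displaced_zero]
  · have ht' := mem_timeInterval_ofReal.1 ht
    have hsub' : Icc 0 t ⊆ Icc 0 r := Icc_subset_Icc_right ht'.2.le
    let ev : Momentum U →L[ℝ] Euc d := (Momentum.pairing U).flip (k x)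
    have e1 : ∫ s in (0 : ℝ)..t, ∫ y, K x y • outwardNormal U (displaced Φ₀ k (α s)) y
        ∂(surfaceProb U (displaced Φ₀ k (α s))) =
        ∫ s in (0 : ℝ)..t, ev (momentum U (displaced Φ₀ k (α s))) := by
      refine intervalIntegral.integral_congr fun s hs => ?_
      rw [uIcc_of_le ht'.1] at hs
      have := momentum_apply_of_mem hd hM (hmem s (hsub' hs)) (k x)
      simp only [hkK] at this
      exact this.symm
    have e2 : ∫ s in (0 : ℝ)..t, ev (momentum U (displaced Φ₀ k (α s))) =
        ev (α t) - ev (α 0) := by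
      refine intervalIntegral.integral_eq_sub_of_hasDeriv_right_of_le (f := fun s => ev (α s)) ht'.1
        (ev.continuous.comp_continuousOn (hαc.mono hsub')) (fun s hs => ?_) ?_
      · have hs' : s ∈ Ioo 0 r := ⟨hs.1, hs.2.trans ht'.2⟩
        have := ((hα s (Ioo_subset_Icc_self hs')).1.hasDerivAt (Icc_mem_nhds hs'.1 hs'.2))
        exact (ev.hasFDerivAt.comp_hasDerivAt s this).hasDerivWithinAt
      · refine ContinuousOn.intervalIntegrable ?_
        rw [uIcc_of_le ht'.1]
        exact ev.continuous.comp_continuousOn ((h.continuousOn_velocity hαc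
          fun s hs => (hα s hs).2).mono hsub')
    rw [e1, e2, h0, map_zero, sub_zero]
    simp only [displaced_zero]
    rfl

/-- Along a solution the momentum is continuous in time. -/
theorem IsFlowSolution.continuousOn_momentum (hd : 1 ≤ d) (hM : IsHypersurface (frontier U))
    {K : frontier U → frontier U → ℝ} {Φ₀ : frontier U → Euc d} {τ : ℝ≥0∞}
    {Ψ : ℝ → frontier U → Euc d} (hΨ : IsFlowSolution U K Φ₀ τ Ψ) :
    ContinuousOn (fun t => momentum U (Ψ t)) (timeInterval τ) := by
  intro t ht
  obtain ⟨c, hc⟩ := exists_isBiLipEmbedding hM (hΨ.mem t ht)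
  obtain ⟨C, δ, hC, hδ, hmom⟩ := exists_momentum_lipschitz hd hM hc.pos
  have hev : ∀ᶠ s in 𝓝[timeInterval τ] t, IsCk U ((9 + 1 : ℕ) : WithTop ℕ∞) (Ψ s) := by
    filter_upwards [self_mem_nhdsWithin] with s hs using (hΨ.mem s hs).1.1
  have hconv : CkConv U (𝓝[timeInterval τ] t) (9 + 1) Ψ (Ψ t) :=
    ckConv_of_tendsto_ckDist hM hev (hΨ.mem t ht).1.1 (hΨ.continuous t ht)
  rw [ContinuousWithinAt, Metric.tendsto_nhds]
  intro ε hε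
  have hη : 0 < min δ (ε / (2 * C)) := by positivity
  filter_upwards [hconv.eventually_hasLipBound hM hev (hΨ.mem t ht).1.1 hη, hev] with s hs hs'
  rw [dist_eq_norm]
  refine (hmom _ _ _ hc (hs'.of_le (one_le_natCast_succ 9)) hη.le (min_le_left _ _) hs).trans_lt ?_
  calc C * min δ (ε / (2 * C)) ≤ C * (ε / (2 * C)) :=
        mul_le_mul_of_nonneg_left (min_le_right _ _) hC.le
    _ = ε / 2 := by field_simp
    _ < ε := half_lt_self hε

/-- Every solution comes from a momentum path solving the same differential equation, hence is
unique. -/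
theorem IsFlowBall.unique (hd : 1 ≤ d) (hM : IsHypersurface (frontier U))
    {K : frontier U → frontier U → ℝ} {Φ₀ : frontier U → Euc d}
    {k : frontier U → C(frontier U, ℝ)} (hkK : ∀ x y, k x y = K x y)
    {r : ℝ} {C : ℝ≥0} (h : IsFlowBall U Φ₀ k r C) {α : ℝ → Momentum U} (h0 : α 0 = 0)
    (hα : ∀ t ∈ Icc 0 r,
      HasDerivWithinAt α (momentum U (displaced Φ₀ k (α t))) (Icc 0 r) t ∧ ‖α t‖ ≤ r)
    {Ψ : ℝ → frontier U → Euc d} (hΨ : IsFlowSolution U K Φ₀ (ENNReal.ofReal r) Ψ) {T : ℝ}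
    (hT : T ∈ timeInterval (ENNReal.ofReal r)) : Ψ T = displaced Φ₀ k (α T) := by
  obtain ⟨hT0, hTr⟩ := mem_timeInterval_ofReal.1 hT
  have hsub : Icc 0 T ⊆ timeInterval (ENNReal.ofReal r) := fun t ht =>
    mem_timeInterval_ofReal.2 ⟨ht.1, ht.2.trans_lt hTr⟩
  -- the momentum along `Ψ`, extended to a continuous function of all times
  let w : ℝ → Momentum U := fun s => momentum U (Ψ (projIcc 0 T hT0 s))
  have hw : Continuous w :=
    ((hΨ.continuousOn_momentum hd hM).mono hsub).comp_continuous
      (continuous_subtype_val.comp continuous_projIcc) fun s => (projIcc 0 T hT0 s).2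
  have hwe : ∀ s ∈ Icc 0 T, w s = momentum U (Ψ s) := fun s hs => by
    simp only [w, projIcc_of_mem hT0 hs]
  let β : ℝ → Momentum U := fun t => ∫ s in (0 : ℝ)..t, w s
  have hβd : ∀ t, HasDerivAt β (w t) t := fun t =>
    (hw.integral_hasStrictDerivAt 0 t).hasDerivAt
  have hβ0 : β 0 = 0 := intervalIntegral.integral_same
  have hβn : ∀ t ∈ Icc 0 T, ‖β t‖ ≤ r := fun t ht => by
    have := norm_image_sub_le_of_norm_deriv_le_segment' (f := β) (C := 1) (a := 0) (b := T)
      (fun s _ => (hβd s).hasDerivWithinAt) (fun s _ => norm_momentum_le _) t ht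
    rw [hβ0, sub_zero] at this
    linarith [ht.2]
  have hΨβ : ∀ t ∈ Icc 0 T, Ψ t = displaced Φ₀ k (β t) := fun t ht => by
    funext x
    let ev : Momentum U →L[ℝ] Euc d := (Momentum.pairing U).flip (k x)
    have e1 : ∫ s in (0 : ℝ)..t, ∫ y, K x y • outwardNormal U (Ψ s) y ∂(surfaceProb U (Ψ s)) =
        ∫ s in (0 : ℝ)..t, ev (w s) := by
      refine intervalIntegral.integral_congr fun s hs => ?_
      rw [uIcc_of_le ht.1] at hs
      have hs' : s ∈ Icc 0 T := ⟨hs.1, hs.2.trans ht.2⟩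
      have := momentum_apply_of_mem hd hM (hΨ.mem s (hsub hs')) (k x)
      simp only [hkK] at this
      simp only [hwe s hs']
      exact this.symm
    have e2 : ∫ s in (0 : ℝ)..t, ev (w s) = ev (β t) :=
      ev.intervalIntegral_comp_comm (hw.intervalIntegrable 0 t)
    rw [hΨ.equation t (hsub ht) x, e1, e2, hΨ.initial]
    rfl
  have huniq : EqOn β α (Icc 0 T) := by
    refine ODE_solution_unique_of_mem_Icc_right (K := C)
      (v := fun _ m => momentum U (displaced Φ₀ k m))
      (s := fun _ => Metric.closedBall (0 : Momentum U) r) (fun _ _ => h.lipschitz)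
      (fun t _ => (hβd t).continuousAt.continuousWithinAt) (fun t ht => ?_)
      (fun t ht => mem_closedBall_zero_iff.2 (hβn t (Ico_subset_Icc_self ht)))
      (fun t ht => ((hα t ⟨ht.1, ht.2.trans hTr.le⟩).1.continuousWithinAt).mono
        (Icc_subset_Icc_right hTr.le)) (fun t ht => ?_)
      (fun t ht => mem_closedBall_zero_iff.2 (hα t ⟨ht.1, ht.2.le.trans hTr.le⟩).2)
      (hβ0.trans h0.symm)
    · have ht' := Ico_subset_Icc_self ht
      have e := (hβd t).hasDerivWithinAt (s := Ici t)
      rwa [hwe t ht', hΨβ t ht'] at e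
    · have e := (hα t ⟨ht.1, ht.2.le.trans hTr.le⟩).1
      exact e.mono_of_mem_nhdsWithin (mem_of_superset
        (Icc_mem_nhdsGE (ht.2.trans hTr)) (Icc_subset_Icc_left ht.1))
  rw [hΨβ T ⟨hT0, le_rfl⟩, huniq ⟨hT0, le_rfl⟩]

end Flow

end GrowthFlow

end

theorem theorem1p2 (d : ℕ) (hd : 1 ≤ d) (U : Set (GrowthFlow.Euc d))
    (hUcompact : IsCompact U) (hUconn : IsConnected U) (hUsmooth : GrowthFlow.HasSmoothBoundary U)
    (K : frontier U → frontier U → ℝ) (hKsmooth : GrowthFlow.IsSmoothKernel U K)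
    (hKnonneg : ∀ x y, 0 ≤ K x y)
    (Φ₀ : frontier U → GrowthFlow.Euc d) (hΦ₀ : Φ₀ ∈ GrowthFlow.embeddings U 10) :
    ∃ τ : ENNReal, 0 < τ ∧
      ∃ Φ : ℝ → frontier U → GrowthFlow.Euc d,
        GrowthFlow.IsFlowSolution U K Φ₀ τ Φ ∧
        ∀ Ψ : ℝ → frontier U → GrowthFlow.Euc d,
          GrowthFlow.IsFlowSolution U K Φ₀ τ Ψ →
            ∀ t ∈ GrowthFlow.timeInterval τ, Ψ t = Φ t := by
  have hM := hUsmooth.isHypersurface hUcompact.isClosed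
  have hfc : IsCompact (frontier U) :=
    hUcompact.of_isClosed_subset isClosed_frontier hUcompact.isClosed.frontier_subset
  have : CompactSpace (frontier U) := isCompact_iff_compactSpace.1 hfc
  obtain ⟨k, hk, hkK⟩ := hKsmooth.exists_sections
  obtain ⟨r, C, hball⟩ := GrowthFlow.exists_isFlowBall hd hM hΦ₀ hk
  obtain ⟨α, h0, hα⟩ := hball.exists_momentum_path
  refine ⟨ENNReal.ofReal r, ENNReal.ofReal_pos.2 hball.pos,
    fun t => GrowthFlow.displaced Φ₀ k (α t),
    hball.isFlowSolution hd hM hΦ₀ hk hkK h0 hα, fun Ψ hΨ t ht => ?_⟩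
  exact hball.unique hd hM hkK h0 hα hΨ ht
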